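/- \textbf{Programs.} Fix a data domain $D$ with $0\in D$, whose elements also serve as memory addresses. A parallel program $P$ consists of finitely many threads; each thread has local registers, an initial label, and a finite sequence of labelled instructions $l:\mathit{inst};\ \mathtt{goto}\ l'$, where $\mathit{inst}$ is a load $r\leftarrow \mathrm{mem}[e]$, a store $\mathrm{mem}[e_1]\leftarrow e_2$, a fence $\mathtt{mfence}$, an assignment $r\leftarrow e$, or $\mathtt{assert}\ e$, and an expression is a function on $D$ applied to registers. $\mathrm{LAB}$ is the finite set of labels occurring in $P$. Several instructions may have the same label. \textbf{Semantics.} Initially, all registers and addresses hold $0$. Under TSO each thread has a FIFO store buffer, initially empty. A store instruction of thread $t$ yields an issue action $(t,\mathrm{isu})$ and enqueues an address-value pair. The oldest pair $(a,v)$ of the buffer of $t$ can at any time be written to memory, with action $(t,\mathrm{st},a,v)$. A load yields $(t,\mathrm{ld},a,v)$ and takes its value from the newest entry for $a$ in the own buffer if there is one, else from memory. A fence requires the own buffer to be empty, and an assertion requires the value to be non-zero; fences, assignments and assertions yield a local action of $t$. TSO computations are the action sequences from the initial state to a state with empty buffers. Under SC there are no buffers: a store yields its issue immediately followed by its store action,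 fences have no effect, and SC computations are all action sequences from the initial state. \textbf{Traces.} In the trace of a computation, the nodes are the actions, an issue and its store (the $k$-th issue and the $k$-th store of a thread) being one node; the trace records the labels of the nodes, program order (the order of the actions of a thread, stores being placed at their issue), store order (the order of the stores to each address) and the source relation (from the store a load reads from to that load). The conflict relation leads from a load to every store that follows its source in store order, and from a load of the initial value of an address to every store to that address. Happens-before $\to_{hb}$ is the union of program order, store order, source and conflict relation. $P$ is \emph{robust} if its set of TSO traces equals its set of SC traces. \textbf{Attacks.} An attack $A=(t,\mathit{st},\mathit{ld})$ consists of a thread $t$ (the attacker), a store instruction and a load instruction of $t$. It is \emph{feasible} if there is a TSO computation $\tau=\tau_1\cdot \mathrm{isu}\cdot\tau_2\cdot\mathrm{ld}\cdot\tau_3\cdot\mathrm{st}\cdot\tau_4$ such that: $\mathrm{isu}$ and $\mathrm{st}$ are the issue and the store action of one execution of $\mathit{st}$ by $t$, and $\mathrm{ld}$ is the action of an execution of $\mathit{ld}$ by $t$; only $t$ delays stores (a store is delayed if an action of its thread lies between its issue and the store action); $\mathrm{st}$ is the first delayed store of $t$; $\tau_3$ contains no action of $t$; $\mathrm{ld}\to_{hb}^+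 b$ for every action $b$ in $\mathrm{ld}\cdot\tau_3\cdot\mathrm{st}$; $\tau_4$ consists of stores of $t$ only; and no store in $\mathrm{st}\cdot\tau_4$ has the address of $\mathrm{ld}$. \textbf{Fences.} Inserting fences at $F\subseteq \mathrm{LAB}$ introduces for each $l\in F$ a fresh label $l_f$, replaces each instruction $l:\mathit{inst};\ \mathtt{goto}\ l'$ by $l_f:\mathit{inst};\ \mathtt{goto}\ l'$, and adds $l:\mathtt{mfence};\ \mathtt{goto}\ l_f$. $F$ is a \emph{valid fence set} if the resulting program is robust. $F$ is an \emph{eliminating fence set} for an attack $A$ if $A$ (with relabelled instructions) is not feasible in the resulting program, and is \emph{irreducible} if no strict subset of it is eliminating for $A$. The \emph{fence computation problem} asks, given $P$ and a strictly positive cost function $c:\mathrm{LAB}\to\mathbb R$, for a valid fence set $F$ with $\sum_{l\in F}c(l)$ minimal. \textbf{ILP.} The $0/1$ integer linear program has a variable $x_l\in\{0,1\}$ for each $l\in\mathrm{LAB}$ and a variable $x_F\in\{0,1\}$ for each irreducible eliminating fence set $F$ of a feasible attack. The constraints are $\sum_{i=1}^n x_{F_i}\ge 1$ for every feasible attack of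 $P$, where $F_1,\dots,F_n$ are its irreducible eliminating fence sets, and $\sum_{l\in F}x_l\ge |F|\,x_F$ for every variable $x_F$. The objective is to minimize $f(x)=\sum_{l\in\mathrm{LAB}}c(l)\,x_l$. \textbf{Theorem.} For every program $P$ and every strictly positive cost function $c$, the integer linear program has an optimal solution, and for every optimal solution $x^*$ the set $F(x^*)=\{l\in\mathrm{LAB} : x^*_l=1\}$ is a valid fence set of minimal cost among all valid fence sets of $P$; that is, $F(x^*)$ solves the fence computation problem. -/

import Mathlib

/-! Parallel programs under SC and TSO, traces and robustness, attacks, fence insertion, and the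
0/1 integer linear program for fence computation. -/

namespace TSO

/-! ### Programs -/

/-- An expression `f(r*)`: a function on the data domain applied to a list of registers. -/
structure Expr (D R : Type*) where
  arity : ℕ
  fn : (Fin arity → D) → D
  args : Fin arity → R

/-- Value of an expression under a valuation of the registers. -/
def Expr.eval {D R : Type*} (e : Expr D R) (ρ : R → D) : D :=
  e.fn fun k => ρ (e.args k)

inductive Instr (D R : Type*) where
  /-- `r ← mem[e]` -/
  | load (r : R) (e : Expr D R)
  /-- `mem[e₁] ← e₂` -/
  | store (e₁ e₂ : Expr D R)
  | mfence
  /-- `r ← e` -/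
  | assign (r : R) (e : Expr D R)
  /-- `assert e` -/
  | assertion (e : Expr D R)

/-- A labelled instruction `src: instr; goto dst;`. -/
structure LInstr (D R L : Type*) where
  src : L
  instr : Instr D R
  dst : L

/-- A thread: initial label and a finite sequence of labelled instructions. -/
structure Thread (D R L : Type*) where
  entry : L
  code : List (LInstr D R L)

/-- A program with threads `T` over the data domain `D` (whose elements are also the addresses),
with register names `R` (registers are local: each thread has its own copy of them) and labels taken
from `L`. -/
structure Program (D R L T : Type*) where
  thread : T → Thread D R L

section
variable {D R L T : Type*} [DecidableEq L]

/-- The labels that occur in a thread. -/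
def Thread.labels (th : Thread D R L) : Finset L :=
  insert th.entry ((th.code.map LInstr.src).toFinset ∪ (th.code.map LInstr.dst).toFinset)

/-- The labels that occur in the program. -/
def Program.labels [Fintype T] (P : Program D R L T) : Finset L :=
  Finset.univ.biUnion fun t => (P.thread t).labels

end

/-! ### Actions, TSO semantics and SC semantics -/

/-- Actions: issue of a store, local action, load and store, each with the acting thread; loads and
stores also carry address and value. -/
inductive Act (D T : Type*) where
  | isu (t : T)
  | loc (t : T)
  | ld (t : T) (a v : D)
  | st (t : T) (a v : D)

def Act.thread {D T : Type*} : Act D T → T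
  | .isu t => t
  | .loc t => t
  | .ld t _ _ => t
  | .st t _ _ => t

def Act.isIssue {D T : Type*} : Act D T → Bool
  | .isu _ => true
  | _ => false

def Act.isStore {D T : Type*} : Act D T → Bool
  | .st _ _ _ => true
  | _ => false

/-- SC states: program counters, memory and registers. -/
structure SCState (D R L T : Type*) where
  pc : T → L
  mem : D → D
  reg : T → R → D

/-- TSO states: program counters, memory, registers, and one store buffer per thread (the oldest
entry comes first). -/
structure State (D R L T : Type*) where
  pc : T → L
  mem : D → D
  reg : T → R → D
  buf : T → List (D × D)

section
variable {D R L T : Type*} [Zero D] [DecidableEq D] [DecidableEq R] [DecidableEq T]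

/-- `InstrStep P t i s b s'`: in the TSO state `s`, thread `t` executes its labelled instruction `i`,
which yields the action `b` and the state `s'`. -/
inductive InstrStep (P : Program D R L T) (t : T) (i : LInstr D R L) :
    State D R L T → Act D T → State D R L T → Prop
  | loadBuf (s : State D R L T) (r : R) (e : Expr D R) (a v : D) (β : List (D × D)) :
      i ∈ (P.thread t).code → s.pc t = i.src → i.instr = .load r e → a = e.eval (s.reg t) →
      (s.buf t).filter (fun p => decide (p.1 = a)) = β ++ [(a, v)] →
      InstrStep P t i s (.ld t a v)
        { s with pc := Function.update s.pc t i.dst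
                 reg := Function.update s.reg t (Function.update (s.reg t) r v) }
  | loadMem (s : State D R L T) (r : R) (e : Expr D R) (a v : D) :
      i ∈ (P.thread t).code → s.pc t = i.src → i.instr = .load r e → a = e.eval (s.reg t) →
      (s.buf t).filter (fun p => decide (p.1 = a)) = [] → v = s.mem a →
      InstrStep P t i s (.ld t a v)
        { s with pc := Function.update s.pc t i.dst
                 reg := Function.update s.reg t (Function.update (s.reg t) r v) }
  | store (s : State D R L T) (e₁ e₂ : Expr D R) (a v : D) :
      i ∈ (P.thread t).code → s.pc t = i.src → i.instr = .store e₁ e₂ →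
      a = e₁.eval (s.reg t) → v = e₂.eval (s.reg t) →
      InstrStep P t i s (.isu t)
        { s with pc := Function.update s.pc t i.dst
                 buf := Function.update s.buf t (s.buf t ++ [(a, v)]) }
  | mfence (s : State D R L T) :
      i ∈ (P.thread t).code → s.pc t = i.src → i.instr = .mfence → s.buf t = [] →
      InstrStep P t i s (.loc t) { s with pc := Function.update s.pc t i.dst }
  | assign (s : State D R L T) (r : R) (e : Expr D R) :
      i ∈ (P.thread t).code → s.pc t = i.src → i.instr = .assign r e →
      InstrStep P t i s (.loc t)
        { s with pc := Function.update s.pc t i.dst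
                 reg := Function.update s.reg t
                   (Function.update (s.reg t) r (e.eval (s.reg t))) }
  | assertion (s : State D R L T) (e : Expr D R) :
      i ∈ (P.thread t).code → s.pc t = i.src → i.instr = .assertion e → e.eval (s.reg t) ≠ 0 →
      InstrStep P t i s (.loc t) { s with pc := Function.update s.pc t i.dst }

/-- TSO transitions: a thread executes an instruction, or the oldest entry of a buffer is written to
memory. -/
inductive Step (P : Program D R L T) : State D R L T → Act D T → State D R L T → Prop
  | instr (t : T) (i : LInstr D R L) (s : State D R L T) (b : Act D T) (s' : State D R L T) :
      InstrStep P t i s b s' → Step P s b s'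
  | flush (s : State D R L T) (t : T) (a v : D) (β : List (D × D)) :
      s.buf t = (a, v) :: β →
      Step P s (.st t a v)
        { s with mem := Function.update s.mem a v
                 buf := Function.update s.buf t β }

/-- Sequences of TSO transitions, labelled by the sequence of their actions. -/
inductive Run (P : Program D R L T) : State D R L T → List (Act D T) → State D R L T → Prop
  | nil (s : State D R L T) : Run P s [] s
  | cons (s s' s'' : State D R L T) (b : Act D T) (w : List (Act D T)) :
      Step P s b s' → Run P s' w s'' → Run P s (b :: w) s''

/-- The initial TSO state. -/
def Program.initState (P : Program D R L T) : State D R L T where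
  pc t := (P.thread t).entry
  mem _ := 0
  reg _ _ := 0
  buf _ := []

/-- The TSO computations: sequences of actions from the initial state to a state with empty
buffers. -/
def Program.tsoComputations (P : Program D R L T) : Set (List (Act D T)) :=
  {τ | ∃ s, Run P P.initState τ s ∧ ∀ t, s.buf t = []}

/-- SC transitions. A store instruction yields an issue action followed by the store action; fences
have no effect. -/
inductive SCStep (P : Program D R L T) (t : T) (i : LInstr D R L) :
    SCState D R L T → List (Act D T) → SCState D R L T → Prop
  | load (s : SCState D R L T) (r : R) (e : Expr D R) (a v : D) :
      i ∈ (P.thread t).code → s.pc t = i.src → i.instr = .load r e →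
      a = e.eval (s.reg t) → v = s.mem a →
      SCStep P t i s [.ld t a v]
        { s with pc := Function.update s.pc t i.dst
                 reg := Function.update s.reg t (Function.update (s.reg t) r v) }
  | store (s : SCState D R L T) (e₁ e₂ : Expr D R) (a v : D) :
      i ∈ (P.thread t).code → s.pc t = i.src → i.instr = .store e₁ e₂ →
      a = e₁.eval (s.reg t) → v = e₂.eval (s.reg t) →
      SCStep P t i s [.isu t, .st t a v]
        { s with pc := Function.update s.pc t i.dst
                 mem := Function.update s.mem a v }
  | mfence (s : SCState D R L T) :
      i ∈ (P.thread t).code → s.pc t = i.src → i.instr = .mfence →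
      SCStep P t i s [.loc t] { s with pc := Function.update s.pc t i.dst }
  | assign (s : SCState D R L T) (r : R) (e : Expr D R) :
      i ∈ (P.thread t).code → s.pc t = i.src → i.instr = .assign r e →
      SCStep P t i s [.loc t]
        { s with pc := Function.update s.pc t i.dst
                 reg := Function.update s.reg t
                   (Function.update (s.reg t) r (e.eval (s.reg t))) }
  | assertion (s : SCState D R L T) (e : Expr D R) :
      i ∈ (P.thread t).code → s.pc t = i.src → i.instr = .assertion e → e.eval (s.reg t) ≠ 0 →
      SCStep P t i s [.loc t] { s with pc := Function.update s.pc t i.dst }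

inductive SCRun (P : Program D R L T) : SCState D R L T → List (Act D T) → SCState D R L T → Prop
  | nil (s : SCState D R L T) : SCRun P s [] s
  | cons (t : T) (i : LInstr D R L) (s s' s'' : SCState D R L T) (u w : List (Act D T)) :
      SCStep P t i s u s' → SCRun P s' w s'' → SCRun P s (u ++ w) s''

/-- The initial SC state. -/
def Program.initSCState (P : Program D R L T) : SCState D R L T where
  pc t := (P.thread t).entry
  mem _ := 0
  reg _ _ := 0

/-- The SC computations. -/
def Program.scComputations (P : Program D R L T) : Set (List (Act D T)) :=
  {σ | ∃ s, SCRun P P.initSCState σ s}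

end

/-! ### Traces and robustness -/

/-- Traces. The node `(t, k)` is the `k`-th event of thread `t` in program order (an issue and its
store are one event), so that the nodes have canonical names and isomorphic traces are equal.
`events t` lists the labels of the nodes `(t, 0), (t, 1), …`, `stores a` lists the store nodes of the
address `a` in store order, and `source n` is the store node from which the load node `n` receives
its value (`none` if it reads the initial value). -/
@[ext]
structure Trace (D T : Type*) where
  events : T → List (Act D T)
  stores : D → List (T × ℕ)
  source : T × ℕ → Option (T × ℕ)

/-- The trace of the empty word. -/
def Trace.empty (D T : Type*) : Trace D T where
  events _ := []
  stores _ := []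
  source _ := none

section
variable {D T : Type*}

/-- The node to which an action belongs when it is appended to a computation with trace `θ`: a store
belongs to the first issue of its thread that has no store yet, any other action to a fresh node. -/
def Trace.next (θ : Trace D T) : Act D T → T × ℕ
  | .isu t => (t, (θ.events t).length)
  | .loc t => (t, (θ.events t).length)
  | .ld t _ _ => (t, (θ.events t).length)
  | .st t _ _ => (t, (θ.events t).findIdx Act.isIssue)

variable [DecidableEq D] [DecidableEq T]

open Classical in
/-- The trace after appending one action. A load receives its value from the last store to its
address; when a store is executed, it becomes the source of the loads of its thread that come later
in program order and have the same address and value (these have read early). -/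
noncomputable def Trace.append (θ : Trace D T) : Act D T → Trace D T
  | .isu t => { θ with events := Function.update θ.events t (θ.events t ++ [.isu t]) }
  | .loc t => { θ with events := Function.update θ.events t (θ.events t ++ [.loc t]) }
  | .ld t a v =>
      { θ with events := Function.update θ.events t (θ.events t ++ [.ld t a v])
               source := Function.update θ.source (θ.next (.ld t a v)) (θ.stores a).getLast? }
  | .st t a v =>
      { events := Function.update θ.events t
          ((θ.events t).set (θ.next (.st t a v)).2 (.st t a v))
        stores := Function.update θ.stores a (θ.stores a ++ [θ.next (.st t a v)])
        source := fun m =>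
          if m.1 = t ∧ (θ.next (.st t a v)).2 < m.2 ∧ (θ.events t)[m.2]? = some (.ld t a v)
          then some (θ.next (.st t a v)) else θ.source m }

/-- The trace of a sequence of actions. -/
noncomputable def traceOf (w : List (Act D T)) : Trace D T :=
  w.foldl Trace.append (Trace.empty D T)

/-- The happens-before relation: union of program order, store order, source relation and conflict
relation. -/
inductive Trace.HB (θ : Trace D T) : T × ℕ → T × ℕ → Prop
  | programOrder (t : T) (j k : ℕ) : j < k → k < (θ.events t).length → Trace.HB θ (t, j) (t, k)
  | storeOrder (a : D) (m n : T × ℕ) : [m, n].Sublist (θ.stores a) → Trace.HB θ m n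
  | source (m n : T × ℕ) : θ.source n = some m → Trace.HB θ m n
  /-- the load `(t, k)` reads from `m`, which the store `n` overwrites -/
  | conflict (t : T) (k : ℕ) (a v : D) (m n : T × ℕ) :
      (θ.events t)[k]? = some (.ld t a v) → θ.source (t, k) = some m →
      [m, n].Sublist (θ.stores a) → Trace.HB θ (t, k) n
  /-- the load `(t, k)` reads the initial value, which the store `n` overwrites -/
  | conflictInit (t : T) (k : ℕ) (a v : D) (n : T × ℕ) :
      (θ.events t)[k]? = some (.ld t a v) → θ.source (t, k) = none →
      n ∈ θ.stores a → Trace.HB θ (t, k) n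

/-- A program is robust if its TSO traces are its SC traces. -/
def Program.Robust {R L : Type*} [Zero D] [DecidableEq R] (P : Program D R L T) : Prop :=
  traceOf '' P.tsoComputations = traceOf '' P.scComputations

/-! ### Attacks -/

/-- Number of issue actions of thread `t` in `w`. -/
def issueCount (t : T) (w : List (Act D T)) : ℕ :=
  w.countP fun b => b.isIssue && decide (b.thread = t)

/-- Number of store actions of thread `t` in `w`. -/
def storeCount (t : T) (w : List (Act D T)) : ℕ :=
  w.countP fun b => b.isStore && decide (b.thread = t)

/-- `τ = α · (t, isu) · β · (t, st, a, v) · γ` where the issue and the store correspond to each other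
(as buffers are FIFO, the `k`-th issue of a thread corresponds to its `k`-th store). The store is
delayed if `β` contains an action of `t`. -/
def IssueStorePair (τ : List (Act D T)) (t : T) (α β γ : List (Act D T)) (a v : D) : Prop :=
  τ = α ++ .isu t :: (β ++ .st t a v :: γ) ∧ issueCount t α = storeCount t (α ++ β)

end

/-- An attack: the attacker thread, a store instruction and a load instruction. -/
structure Attack (D R L T : Type*) where
  attacker : T
  store : LInstr D R L
  load : LInstr D R L

section
variable {D R L T : Type*}

/-- `A` is an attack of the program `P`: its store and its load are instructions of the attacker. -/
def Program.IsAttack (P : Program D R L T) (A : Attack D R L T) : Prop :=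
  (A.store ∈ (P.thread A.attacker).code ∧ ∃ e₁ e₂, A.store.instr = .store e₁ e₂) ∧
  (A.load ∈ (P.thread A.attacker).code ∧ ∃ r e, A.load.instr = .load r e)

variable [Zero D] [DecidableEq D] [DecidableEq R] [DecidableEq T]

/-- The computation `τ₁ · isu · τ₂ · ld · τ₃ · st · τ₄`, with `isu = (t, isu)`, `ld = (t, ld, x, v)`,
`st = (t, st, y, w)` and `t` the attacker, is a TSO witness for `A`. -/
structure Program.IsWitness (P : Program D R L T) (A : Attack D R L T)
    (τ₁ τ₂ τ₃ τ₄ : List (Act D T)) (x v y w : D) (τ : List (Act D T)) : Prop where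
  word : τ = τ₁ ++ .isu A.attacker :: (τ₂ ++ .ld A.attacker x v ::
    (τ₃ ++ .st A.attacker y w :: τ₄))
  /-- `τ` is a TSO computation in which `isu` and `ld` are instances of the store and the load
  instruction of the attack. -/
  run : ∃ s₁ s₂ s₃ s₄ s₅ : State D R L T,
    Run P P.initState τ₁ s₁ ∧
    InstrStep P A.attacker A.store s₁ (.isu A.attacker) s₂ ∧
    Run P s₂ τ₂ s₃ ∧
    InstrStep P A.attacker A.load s₃ (.ld A.attacker x v) s₄ ∧
    Run P s₄ (τ₃ ++ .st A.attacker y w :: τ₄) s₅ ∧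
    ∀ t, s₅.buf t = []
  /-- Only the attacker delays stores. -/
  helpers : ∀ t, t ≠ A.attacker → ∀ α β γ a d, IssueStorePair τ t α β γ a d →
    ∀ b ∈ β, b.thread ≠ t
  /-- `st` is the store issued by `isu`. -/
  pair : IssueStorePair τ A.attacker τ₁ (τ₂ ++ .ld A.attacker x v :: τ₃) τ₄ y w
  /-- `st` is the first store of the attacker that is delayed. -/
  first : ∀ α β γ a d, IssueStorePair τ A.attacker α β γ a d → α.length < τ₁.length →
    ∀ b ∈ β, b.thread ≠ A.attacker
  /-- `ld` is the last action of the attacker that is overstepped by `st`. -/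
  last : ∀ b ∈ τ₃, b.thread ≠ A.attacker
  /-- `ld` happens before every action `b` in `ld · τ₃ · st`. -/
  path : ∀ α b γ, Act.ld A.attacker x v :: (τ₃ ++ [.st A.attacker y w]) = α ++ b :: γ →
    Relation.TransGen (traceOf τ).HB
      ((traceOf (τ₁ ++ .isu A.attacker :: τ₂)).next (.ld A.attacker x v))
      ((traceOf (τ₁ ++ .isu A.attacker :: (τ₂ ++ α))).next b)
  /-- `τ₄` only consists of stores of the attacker (by `last`, these are issued before `ld`, hence
  delayed). -/
  tail : ∀ b ∈ τ₄, ∃ a d, b = .st A.attacker a d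
  /-- `ld` has not read its value early: no store in `st · τ₄` accesses its address. -/
  noEarlyRead : ∀ a d, .st A.attacker a d ∈ Act.st A.attacker y w :: τ₄ → a ≠ x

/-- The attack is feasible: it has a TSO witness. -/
def Program.Feasible (P : Program D R L T) (A : Attack D R L T) : Prop :=
  P.IsAttack A ∧ ∃ τ₁ τ₂ τ₃ τ₄ x v y w τ, P.IsWitness A τ₁ τ₂ τ₃ τ₄ x v y w τ

end

/-! ### Fence insertion -/

section
variable {D R L T : Type*} [DecidableEq L]

/-- Relabelling of an instruction when fences are inserted at the labels in `F`. The labels of the new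
program are `Sum.inl l` for the old label `l` and `Sum.inr l` for the fresh label that belongs
to `l`. -/
def LInstr.fence (F : Finset L) (i : LInstr D R L) : LInstr D R (L ⊕ L) where
  src := if i.src ∈ F then .inr i.src else .inl i.src
  instr := i.instr
  dst := .inl i.dst

/-- Inserting fences at the labels in `F`: the instructions at `l ∈ F` move to the fresh label of `l`,
and a fence leads from `l` to its fresh label. -/
noncomputable def Thread.fence (F : Finset L) (th : Thread D R L) : Thread D R (L ⊕ L) where
  entry := .inl th.entry
  code := th.code.map (LInstr.fence F) ++
    (F ∩ th.labels).toList.map fun l => ⟨.inl l, .mfence, .inr l⟩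

noncomputable def Program.fence (P : Program D R L T) (F : Finset L) : Program D R (L ⊕ L) T where
  thread t := (P.thread t).fence F

/-- The attack in the program with fences that corresponds to the attack `A`. -/
def Attack.fence (A : Attack D R L T) (F : Finset L) : Attack D R (L ⊕ L) T where
  attacker := A.attacker
  store := A.store.fence F
  load := A.load.fence F

variable [Zero D] [DecidableEq D] [DecidableEq R] [DecidableEq T] [Fintype T]

/-- Valid fence sets: sets of labels at which the insertion of fences yields a robust program. -/
def Program.IsValidFenceSet (P : Program D R L T) (F : Finset L) : Prop :=
  F ⊆ P.labels ∧ (P.fence F).Robust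

/-- `F` is a solution of the fence computation problem for the cost function `c`: a valid fence set of
minimal cost. -/
def Program.SolvesFenceComputation (P : Program D R L T) (c : L → ℝ) (F : Finset L) : Prop :=
  P.IsValidFenceSet F ∧ ∀ F', P.IsValidFenceSet F' → ∑ l ∈ F, c l ≤ ∑ l ∈ F', c l

/-- Eliminating fence sets for `A`: sets of labels at which the insertion of fences makes `A`
infeasible. -/
def Program.IsEliminating (P : Program D R L T) (A : Attack D R L T) (F : Finset L) : Prop :=
  F ⊆ P.labels ∧ ¬ (P.fence F).Feasible (A.fence F)

/-- Irreducible eliminating fence sets: no strict subset eliminates the attack. -/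
def Program.IsIrreducibleEliminating (P : Program D R L T) (A : Attack D R L T) (F : Finset L) :
    Prop :=
  P.IsEliminating A F ∧ ∀ F', F' ⊂ F → ¬ P.IsEliminating A F'

/-! ### The 0/1 integer linear program -/

open Classical in
/-- The irreducible eliminating fence sets of all feasible attacks. -/
noncomputable def Program.attackFenceSets (P : Program D R L T) : Finset (Finset L) :=
  {F ∈ P.labels.powerset | ∃ A, P.Feasible A ∧ P.IsIrreducibleEliminating A F}

/-- The variables of the integer linear program: `x_l` for each label `l` of the program, and `x_F` for
each irreducible eliminating fence set `F` of a feasible attack. -/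
abbrev Program.ILPVar (P : Program D R L T) : Type _ :=
  {l // l ∈ P.labels} ⊕ {F // F ∈ P.attackFenceSets}

open Classical in
/-- The feasible points of the 0/1 integer linear program. -/
structure Program.IsILPFeasible (P : Program D R L T) (x : P.ILPVar → ℤ) : Prop where
  zero_one : ∀ n, x n = 0 ∨ x n = 1
  /-- For each feasible attack, one of its irreducible eliminating fence sets is selected. -/
  select : ∀ A, P.Feasible A →
    ∑ F : {F // F ∈ P.attackFenceSets} with P.IsIrreducibleEliminating A F.1, x (.inr F) ≥ 1
  /-- For each selected fence set, fences are inserted at all its labels. -/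
  insertion : ∀ F : {F // F ∈ P.attackFenceSets},
    ∑ l : {l // l ∈ P.labels} with l.1 ∈ F.1, x (.inl l) ≥ (F.1.card : ℤ) * x (.inr F)

/-- The objective function. -/
def Program.objective (P : Program D R L T) (c : L → ℝ) (x : P.ILPVar → ℤ) : ℝ :=
  ∑ l : {l // l ∈ P.labels}, c l.1 * (x (.inl l) : ℝ)

/-- The optimal solutions: feasible points with minimal objective. -/
def Program.IsILPOptimal (P : Program D R L T) (c : L → ℝ) (x : P.ILPVar → ℤ) : Prop :=
  P.IsILPFeasible x ∧ ∀ x', P.IsILPFeasible x' → P.objective c x ≤ P.objective c x'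

open Classical in
/-- The fence set denoted by `x`: the labels `l` with `x_l = 1`. -/
noncomputable def Program.fenceSet (P : Program D R L T) (x : P.ILPVar → ℤ) : Finset L :=
  {l ∈ P.labels | ∃ h : l ∈ P.labels, x (.inl ⟨l, h⟩) = 1}

end

end TSO

/-! The integer program is correct because a set `F` of labels is a valid fence set iff it
eliminates every feasible attack of `P` (`Program.isValidFenceSet_iff`), and because eliminating
sets are upward closed (`Program.IsEliminating.mono`). A valid `F` therefore contains an irreducible
eliminating set for each feasible attack. This makes the 0/1 point of `F` feasible with objective
the cost of `F`. Conversely, a feasible point selects an irreducible set for every attack and forces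
fences at all its labels, so its fence set is valid. Optimal solutions exist since there are
finitely many 0/1 points and at least one feasible one: with fences at all labels, a thread cannot
reach its next load while the store is pending.

The first ingredient is that a program is robust iff no attack is feasible (`robust_iff`). If an
attack is feasible, its witness has a path from `ld` to `st`, and program order leads from `st` back
to `ld`; but happens-before is acyclic in SC traces. For the converse, TSO executions are
represented by event graphs, which forget the order of independent actions. Appending an event
creates a sink, so the first happens-before cycle appears when a pending store is executed; this is
a `Graph.Violation`. In a violation of least size, removing the last event of a thread with pending
stores would destroy every cycle, so this event lies on all of them. Consequently only one thread
has pending stores, and its last event is a load from memory (`Graph.Violation.exists_attackGraph`).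
The graph is then turned back into a computation by peeling off happens-before maximal nodes,
successors of the load first, so that only events depending on the load come after it
(`Graph.Valid.exists_peeled`). Emptying the buffer yields a witness. If no violation exists, the
same peeling turns the acyclic graph of any TSO computation into an SC computation with the same
trace.

The second ingredient is that removing fences preserves feasibility (`Program.Sim.feasible`). A run
of the program with more fences becomes a run of the other program when the local actions of the
extra fences are erased. Erased events have only program order edges, so a happens-before path
between remaining nodes can bypass them (`TraceErase.transGen`). Since fences are neither loads nor
stores, every feasible attack of the fenced program comes from a feasible attack of `P`. -/

set_option linter.unusedSectionVars false

namespace TSO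

/-! ### Event graphs -/

/-- Events of a thread as seen by its control flow: stores carry address and value already when they
are issued, and fences are distinguished from other local events. -/
inductive LEv (D : Type*) where
  | ld (a v : D)
  | st (a v : D)
  | loc
  | fence

/-- The action of an event; a pending store is only issued. -/
def LEv.act {D T : Type*} (t : T) (pending : Bool) : LEv D → Act D T
  | .ld a v => .ld t a v
  | .st a v => if pending then .isu t else .st t a v
  | .loc => .loc t
  | .fence => .loc t

/-- A TSO execution up to the order of independent actions: the events of each thread, the positions
of its pending stores, the order of the executed stores to each address, and the stores from which
the loads receive their values (which may still be pending). -/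
@[ext]
structure Graph (D T : Type*) where
  ev : T → List (LEv D)
  pend : T → List ℕ
  stores : D → List (T × ℕ)
  src : T × ℕ → Option (T × ℕ)

namespace Graph
variable {D T : Type*}

/-- The event at a node. -/
def lab (G : Graph D T) (n : T × ℕ) : Option (LEv D) := (G.ev n.1)[n.2]?

/-- The actions of a thread, in program order. -/
def acts (G : Graph D T) (t : T) : List (Act D T) :=
  (G.ev t).mapIdx fun k e => e.act t (decide (k ∈ G.pend t))

/-- Happens-before of an event graph. -/
inductive HB (G : Graph D T) : T × ℕ → T × ℕ → Prop
  | po (t : T) (j k : ℕ) : j < k → (G.lab (t, k)).isSome → HB G (t, j) (t, k)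
  | so (a : D) (m n : T × ℕ) : [m, n].Sublist (G.stores a) → HB G m n
  | src (m n : T × ℕ) : G.src n = some m → HB G m n
  | cf (n : T × ℕ) (a v : D) (m n' : T × ℕ) : G.lab n = some (.ld a v) → G.src n = some m →
      [m, n'].Sublist (G.stores a) → HB G n n'
  | cfi (n : T × ℕ) (a v : D) (n' : T × ℕ) : G.lab n = some (.ld a v) → G.src n = none →
      n' ∈ G.stores a → HB G n n'

def Acyclic (G : Graph D T) : Prop := ∀ n, ¬ Relation.TransGen G.HB n n

end Graph

/-- Effect of an instruction on the registers of its thread, together with the event it yields. -/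
inductive Instr.Eff {D R : Type*} [Zero D] [DecidableEq R] :
    Instr D R → (R → D) → LEv D → (R → D) → Prop
  | load (r : R) (e : Expr D R) (ρ : R → D) (v : D) :
      Eff (.load r e) ρ (.ld (e.eval ρ) v) (Function.update ρ r v)
  | store (e₁ e₂ : Expr D R) (ρ : R → D) :
      Eff (.store e₁ e₂) ρ (.st (e₁.eval ρ) (e₂.eval ρ)) ρ
  | mfence (ρ : R → D) : Eff .mfence ρ .fence ρ
  | assign (r : R) (e : Expr D R) (ρ : R → D) :
      Eff (.assign r e) ρ .loc (Function.update ρ r (e.eval ρ))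
  | assertion (e : Expr D R) (ρ : R → D) : e.eval ρ ≠ 0 → Eff (.assertion e) ρ .loc ρ

section
variable {D R L T : Type*} [Zero D] [DecidableEq R]

/-- Runs of a single thread, in which loads may receive arbitrary values. -/
inductive LRun (P : Program D R L T) (t : T) : List (LEv D) → L → (R → D) → Prop
  | nil : LRun P t [] (P.thread t).entry fun _ => 0
  | snoc (l : List (LEv D)) (ρ : R → D) (i : LInstr D R L) (e : LEv D) (ρ' : R → D) :
      LRun P t l i.src ρ → i ∈ (P.thread t).code → i.instr.Eff ρ e ρ' →
      LRun P t (l ++ [e]) i.dst ρ'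

theorem LRun.snoc_inv {P : Program D R L T} {t : T} {l : List (LEv D)} {e : LEv D} {pc : L}
    {ρ' : R → D} (h : LRun P t (l ++ [e]) pc ρ') :
    ∃ ρ i, LRun P t l i.src ρ ∧ i ∈ (P.thread t).code ∧ i.instr.Eff ρ e ρ' ∧ pc = i.dst := by
  generalize hl : l ++ [e] = l' at h
  cases h with
  | nil => simp at hl
  | snoc l₀ ρ i e₀ ρ' h₁ h₂ h₃ =>
    obtain ⟨rfl, h⟩ := List.append_inj' hl rfl
    obtain rfl : e = e₀ := by simpa using h
    exact ⟨ρ, i, h₁, h₂, h₃, rfl⟩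

/-- The event graphs of TSO executions. -/
structure Graph.Valid (P : Program D R L T) (G : Graph D T) : Prop where
  run : ∀ t, ∃ pc ρ, LRun P t (G.ev t) pc ρ
  nodup : ∀ a, (G.stores a).Nodup
  mem_stores : ∀ a t k,
    (t, k) ∈ G.stores a ↔ (∃ v, G.lab (t, k) = some (.st a v)) ∧ k ∉ G.pend t
  sorted : ∀ t, (G.pend t).Pairwise (· < ·)
  pend_st : ∀ t k, k ∈ G.pend t → ∃ a v, G.lab (t, k) = some (.st a v)
  fifo : ∀ t j k a v, k ∈ G.pend t → G.lab (t, j) = some (.st a v) → j ∉ G.pend t → j < k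
  fence : ∀ t k j, G.lab (t, k) = some .fence → j ∈ G.pend t → k < j
  src_load : ∀ n m, G.src n = some m → ∃ a v, G.lab n = some (.ld a v)
  src_some : ∀ t k a v m, G.lab (t, k) = some (.ld a v) → G.src (t, k) = some m →
    G.lab m = some (.st a v) ∧
    ((m.2 ∉ G.pend m.1 ∧ ∀ j v', j < k → G.lab (t, j) = some (.st a v') → j ∉ G.pend t) ∨
     (m.1 = t ∧ m.2 ∈ G.pend t ∧ m.2 < k ∧
        ∀ j v', m.2 < j → j < k → G.lab (t, j) ≠ some (.st a v')))
  src_none : ∀ t k a v, G.lab (t, k) = some (.ld a v) → G.src (t, k) = none →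
    v = 0 ∧ ∀ j v', j < k → G.lab (t, j) = some (.st a v') → j ∉ G.pend t

end

/-! ### Appending, executing and removing events of a graph -/

namespace Graph
variable {D T : Type*} [DecidableEq D] [DecidableEq T]

/-- Appending an event, which is pending if it is a store. -/
def push (G : Graph D T) (t : T) (e : LEv D) (o : Option (T × ℕ)) : Graph D T where
  ev := Function.update G.ev t (G.ev t ++ [e])
  pend := match e with
    | .st _ _ => Function.update G.pend t (G.pend t ++ [(G.ev t).length])
    | _ => G.pend
  stores := G.stores
  src := Function.update G.src (t, (G.ev t).length) o

/-- Executing the oldest pending store `(t, p)` of `t`, whose address is `a`. -/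
def flush (G : Graph D T) (t : T) (p : ℕ) (a : D) : Graph D T where
  ev := G.ev
  pend := Function.update G.pend t (G.pend t).tail
  stores := Function.update G.stores a (G.stores a ++ [(t, p)])
  src := G.src

/-- Removing the last event of a thread. -/
def pop (G : Graph D T) (t : T) : Graph D T where
  ev := Function.update G.ev t (G.ev t).dropLast
  pend := Function.update G.pend t ((G.pend t).filter (· ≠ (G.ev t).length - 1))
  stores a := (G.stores a).filter (· ≠ (t, (G.ev t).length - 1))
  src := Function.update G.src (t, (G.ev t).length - 1) none

@[simp] theorem flush_ev (G : Graph D T) (t : T) (p : ℕ) (a : D) :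
    (G.flush t p a).ev = G.ev := rfl

@[simp] theorem flush_lab (G : Graph D T) (t : T) (p : ℕ) (a : D) :
    (G.flush t p a).lab = G.lab := rfl

@[simp] theorem flush_src (G : Graph D T) (t : T) (p : ℕ) (a : D) :
    (G.flush t p a).src = G.src := rfl

@[simp] theorem push_stores (G : Graph D T) (t : T) (e : LEv D) (o : Option (T × ℕ)) :
    (G.push t e o).stores = G.stores := rfl

theorem lab_eq_none_iff {G : Graph D T} {t : T} {k : ℕ} :
    G.lab (t, k) = none ↔ (G.ev t).length ≤ k := by
  simp [lab]

theorem lt_length_of_lab {G : Graph D T} {t : T} {k : ℕ} {e : LEv D}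
    (h : G.lab (t, k) = some e) : k < (G.ev t).length := by
  by_contra hk
  rw [lab_eq_none_iff.2 (by omega)] at h
  cases h

theorem lab_push (G : Graph D T) (t : T) (e : LEv D) (o : Option (T × ℕ)) :
    (G.push t e o).lab = Function.update G.lab (t, (G.ev t).length) (some e) := by
  funext ⟨u, k⟩
  by_cases hu : u = t
  · subst hu
    by_cases hk : k = (G.ev u).length
    · subst hk; simp [lab, push]
    · rw [Function.update_of_ne (by simp [hk])]
      simp only [lab, push, Function.update_self]
      rcases lt_or_gt_of_ne hk with h | h
      · rw [List.getElem?_append_left h]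
      · rw [List.getElem?_eq_none (by simp; omega), List.getElem?_eq_none (by omega)]
  · simp [lab, push, hu]

theorem lab_pop {G : Graph D T} {t : T} {k : ℕ} (h : (G.ev t).length = k + 1) :
    (G.pop t).lab = Function.update G.lab (t, k) none := by
  funext ⟨u, j⟩
  by_cases hu : u = t
  · subst hu
    by_cases hk : j = k
    · subst hk; simp [lab, pop, h]
    · rw [Function.update_of_ne (by simp [hk])]
      simp only [lab, pop, Function.update_self]
      simp only [List.getElem?_dropLast, h]
      split_ifs with h'
      · rfl
      · rw [List.getElem?_eq_none (by omega)]
  · simp [lab, pop, hu]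

end Graph
end TSO

/-! ### Validity is preserved by the graph operations -/

namespace TSO
namespace Graph
variable {D R L T : Type*} [DecidableEq D] [DecidableEq T] [Zero D] [DecidableEq R]
  {P : Program D R L T} {G : Graph D T}

theorem Valid.pend_lt (hG : G.Valid P) {t : T} {k : ℕ} (h : k ∈ G.pend t) :
    k < (G.ev t).length := by
  obtain ⟨a, v, h⟩ := hG.pend_st t k h
  exact lt_length_of_lab h

theorem mem_pend_push {t u : T} {e : LEv D} {o : Option (T × ℕ)} {k : ℕ} :
    k ∈ (G.push t e o).pend u ↔
      k ∈ G.pend u ∨ u = t ∧ k = (G.ev t).length ∧ ∃ a v, e = .st a v := by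
  by_cases hu : u = t
  · subst hu
    cases e <;> simp [push]
  · cases e <;> simp [push, hu]

/-- The hypotheses `ho` and `hn` are the TSO load rule at the moment of the load. All events of `t`
are earlier than the new one, so the bounds `j < k` of `src_some` and `src_none` do not appear. -/
theorem Valid.push (hG : G.Valid P) {t : T} {e : LEv D} {o : Option (T × ℕ)}
    (hrun : ∃ pc ρ, LRun P t (G.ev t ++ [e]) pc ρ) (hf : e = .fence → G.pend t = [])
    (ho : ∀ m, o = some m → ∃ a v, e = .ld a v ∧ G.lab m = some (.st a v) ∧
      ((m.2 ∉ G.pend m.1 ∧ ∀ j v', G.lab (t, j) = some (.st a v') → j ∉ G.pend t) ∨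
       (m.1 = t ∧ m.2 ∈ G.pend t ∧ ∀ j v', m.2 < j → G.lab (t, j) ≠ some (.st a v'))))
    (hn : o = none → ∀ a v, e = .ld a v →
      v = 0 ∧ ∀ j v', G.lab (t, j) = some (.st a v') → j ∉ G.pend t) :
    (G.push t e o).Valid P := by
  have hlt : ∀ u k, k ∈ G.pend u → k < (G.ev u).length := fun u k => hG.pend_lt
  have hlab : ∀ u k x, G.lab (u, k) = some x → k < (G.ev u).length :=
    fun u k x h => lt_length_of_lab h
  have hsrc : (G.push t e o).src = Function.update G.src (t, (G.ev t).length) o := rfl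
  constructor
  · intro u
    by_cases hu : u = t
    · subst hu; simpa [Graph.push] using hrun
    · simpa [Graph.push, hu] using hG.run u
  · exact hG.nodup
  · intro a u k
    have := hG.mem_stores a u k
    simp only [push_stores, lab_push, mem_pend_push, Function.update_apply]
    grind
  · intro u
    have := hG.sorted u
    by_cases hu : u = t
    · subst hu
      cases e <;> simp [Graph.push, this, List.pairwise_append]
      exact hlt u
    · cases e <;> simp [Graph.push, hu, this]
  · intro u k
    have := hG.pend_st u k
    simp only [lab_push, mem_pend_push, Function.update_apply]
    grind
  · intro u j k a v
    have := hG.fifo u j k a v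
    simp only [lab_push, mem_pend_push, Function.update_apply]
    grind
  · intro u k j
    have := hG.fence u k j
    simp only [lab_push, mem_pend_push, Function.update_apply]
    grind
  · intro n m
    have := hG.src_load n m
    simp only [lab_push, hsrc, Function.update_apply]
    grind
  · intro u k a v m
    have := hG.src_some u k a v m
    simp only [lab_push, mem_pend_push, hsrc, Function.update_apply]
    obtain ⟨m, l⟩ := m
    grind
  · intro u k a v
    have := hG.src_none u k a v
    simp only [lab_push, mem_pend_push, hsrc, Function.update_apply]
    grind

/-- Since `p` is the least pending position, FIFO order persists. A load that read `(t, p)` early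
moves from the second to the first alternative of `src_some`: between `p` and the load there is no
store to its address, and before `p` nothing is pending. -/
theorem Valid.flush (hG : G.Valid P) {t : T} {p : ℕ} {β : List ℕ} {a v : D}
    (hp : G.pend t = p :: β) (hl : G.lab (t, p) = some (.st a v)) :
    (G.flush t p a).Valid P := by
  have hmem : ∀ u k, k ∈ (G.flush t p a).pend u ↔ k ∈ G.pend u ∧ ¬ (u = t ∧ k = p) := by
    intro u k
    have hs := hG.sorted t
    rw [hp, List.pairwise_cons] at hs
    by_cases hu : u = t
    · subst hu
      simp only [Graph.flush, Function.update_self, hp, List.tail_cons, List.mem_cons]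
      grind
    · simp [Graph.flush, hu]
  have hpm : p ∈ G.pend t := by simp [hp]
  have hs := hG.sorted t
  rw [hp, List.pairwise_cons] at hs
  have hst : (G.flush t p a).stores = Function.update G.stores a (G.stores a ++ [(t, p)]) := rfl
  constructor
  · exact hG.run
  · intro b
    have := hG.nodup b
    rw [hst]
    by_cases hb : b = a
    · subst hb
      have h2 := (hG.mem_stores b t p).not
      simp only [Function.update_self, List.nodup_append]
      grind
    · simpa [hb] using this
  · intro b u k
    have := hG.mem_stores b u k
    rw [hmem, hst, flush_lab, Function.update_apply]
    grind
  · intro u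
    by_cases hu : u = t
    · subst hu
      simpa [Graph.flush, hp] using hs.2
    · simpa [Graph.flush, hu] using hG.sorted u
  · intro u k
    rw [hmem]
    exact fun h => hG.pend_st u k h.1
  · intro u j k b w
    have := hG.fifo u j k b w
    simp only [hmem, flush_lab]
    grind
  · intro u k j
    have := hG.fence u k j
    simp only [hmem, flush_lab]
    grind
  · exact hG.src_load
  · intro u k b w m
    have := hG.src_some u k b w m
    obtain ⟨m, l⟩ := m
    simp only [hmem, flush_lab, flush_src]
    grind
  · intro u k b w
    have := hG.src_none u k b w
    simp only [hmem, flush_lab, flush_src]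
    grind

/-- Removing the last event of a thread can only hurt a load that reads from it, which `hs`
excludes. -/
theorem Valid.pop (hG : G.Valid P) {t : T} {k : ℕ} (hk : (G.ev t).length = k + 1)
    (hs : ∀ n, G.src n ≠ some (t, k)) : (G.pop t).Valid P := by
  have hmem : ∀ u j, j ∈ (G.pop t).pend u ↔ j ∈ G.pend u ∧ ¬ (u = t ∧ j = k) := by
    intro u j
    by_cases hu : u = t
    · subst hu
      simp [Graph.pop, hk]
    · simp [Graph.pop, hu]
  have hsrc : (G.pop t).src = Function.update G.src (t, k) none := by simp [Graph.pop, hk]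
  constructor
  · intro u
    by_cases hu : u = t
    · subst hu
      obtain ⟨pc, ρ, h⟩ := hG.run u
      have hne : G.ev u ≠ [] := by intro h; simp [h] at hk
      rw [← List.dropLast_append_getLast hne] at h
      obtain ⟨ρ', i, h, -⟩ := h.snoc_inv
      exact ⟨i.src, ρ', by simpa [Graph.pop] using h⟩
    · simpa [Graph.pop, hu] using hG.run u
  · intro a
    exact (hG.nodup a).filter _
  · intro a u j
    have := hG.mem_stores a u j
    rw [hmem, lab_pop hk]
    simp only [Graph.pop, List.mem_filter, this, Function.update_apply, hk]
    grind
  · intro u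
    by_cases hu : u = t
    · subst hu
      simpa [Graph.pop] using (hG.sorted u).filter _
    · simpa [Graph.pop, hu] using hG.sorted u
  · intro u j
    have := hG.pend_st u j
    rw [hmem, lab_pop hk, Function.update_apply]
    grind
  · intro u i j a v
    have := hG.fifo u i j a v
    simp only [hmem, lab_pop hk, Function.update_apply]
    grind
  · intro u i j
    have := hG.fence u i j
    simp only [hmem, lab_pop hk, Function.update_apply]
    grind
  · intro n m
    have := hG.src_load n m
    simp only [lab_pop hk, hsrc, Function.update_apply]
    grind
  · intro u j a v m
    have := hG.src_some u j a v m
    have h2 := hs (u, j)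
    obtain ⟨m, l⟩ := m
    simp only [hmem, lab_pop hk, hsrc, Function.update_apply]
    grind
  · intro u j a v
    have := hG.src_none u j a v
    simp only [hmem, lab_pop hk, hsrc, Function.update_apply]
    grind

end Graph
end TSO

/-! ### Cycles and paths in relations -/

namespace TSO

section Relations
open Relation
variable {α : Type*} {R R' : α → α → Prop}

/-- Adding edges to a new sink preserves acyclicity. -/
theorem acyclic_of_sink {x : α} (h : ∀ m n, R' m n → R m n ∨ n = x) (hx : ∀ n, ¬ R' x n)
    (hR : ∀ n, ¬ TransGen R n n) (n : α) : ¬ TransGen R' n n := by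
  have key : ∀ m n, TransGen R' m n → TransGen R m n ∨ n = x := by
    intro m n hmn
    induction hmn with
    | single h' => exact (h _ _ h').imp_left .single
    | tail _ h' ih =>
      rcases h _ _ h' with h₂ | h₂
      · rcases ih with ih | rfl
        · exact .inl (ih.tail h₂)
        · exact (hx _ h').elim
      · exact .inr h₂
  intro hn
  rcases key n n hn with h' | rfl
  · exact hR n h'
  · obtain ⟨b, hb, -⟩ := TransGen.head'_iff.1 hn
    exact hx b hb

/-- A cycle that arises from adding edges into `x` leads through one of them. -/
theorem exists_path_of_cycle {x : α} {N : α → Prop} (h : ∀ m n, R' m n → R m n ∨ n = x ∧ N m)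
    (hR : ∀ n, ¬ TransGen R n n) {c : α} (hc : TransGen R' c c) :
    ∃ y, N y ∧ ReflTransGen R x y := by
  have key : ∀ m n, TransGen R' m n → TransGen R m n ∨
      (∃ y, N y ∧ ReflTransGen R m y ∧ ReflTransGen R x n) ∨ ∃ y, N y ∧ ReflTransGen R x y := by
    intro m n hmn
    induction hmn with
    | single h' =>
      rcases h _ _ h' with h' | ⟨rfl, h'⟩
      · exact .inl (.single h')
      · exact .inr (.inl ⟨m, h', .refl, .refl⟩)
    | @tail b c _ h' ih =>
      rcases h _ _ h' with h' | ⟨rfl, h'⟩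
      · rcases ih with ih | ⟨y, hy, h₁, h₂⟩ | ih
        · exact .inl (ih.tail h')
        · exact .inr (.inl ⟨y, hy, h₁, h₂.tail h'⟩)
        · exact .inr (.inr ih)
      · rcases ih with ih | ⟨y, hy, h₁, h₂⟩ | ih
        · exact .inr (.inl ⟨b, h', ih.to_reflTransGen, .refl⟩)
        · exact .inr (.inr ⟨b, h', h₂⟩)
        · exact .inr (.inr ih)
  rcases key c c hc with h' | ⟨y, hy, h₁, h₂⟩ | h'
  · exact (hR c h').elim
  · exact ⟨y, hy, h₂.trans h₁⟩
  · exact h'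

/-- A path either avoids `e` or leads through it. -/
theorem path_avoids_or {e s y : α} (h : ∀ m n, R m n → m ≠ e → n ≠ e → R' m n) (hs : s ≠ e)
    (hp : ReflTransGen R s y) :
    (ReflTransGen R' s y ∧ y ≠ e) ∨ (TransGen R s e ∧ ReflTransGen R e y) := by
  induction hp with
  | refl => exact .inl ⟨.refl, hs⟩
  | @tail b c hb hc ih =>
    rcases ih with ⟨h₁, h₂⟩ | ⟨h₁, h₂⟩
    · by_cases hce : c = e
      · subst hce
        exact .inr ⟨.tail' hb hc, .refl⟩
      · exact .inl ⟨h₁.tail (h _ _ hc h₂ hce), hce⟩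
    · exact .inr ⟨h₁, h₂.tail hc⟩

end Relations

/-! ### Happens-before under the graph operations -/

namespace Graph
open Relation
variable {D R L T : Type*} [DecidableEq D] [DecidableEq T] [Zero D] [DecidableEq R]
  {P : Program D R L T} {G : Graph D T}

/-- The node `y` accesses the address `a` in memory: it is an executed store or a load that does not
read from a pending store. -/
def Acc (G : Graph D T) (a : D) (y : T × ℕ) : Prop :=
  y ∈ G.stores a ∨ (∃ v, G.lab y = some (.ld a v)) ∧
    (G.src y = none ∨ ∃ m ∈ G.stores a, G.src y = some m)

theorem Valid.lab_of_mem (hG : G.Valid P) {a : D} {n : T × ℕ} (h : n ∈ G.stores a) :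
    ∃ v, G.lab n = some (.st a v) := ((hG.mem_stores a n.1 n.2).1 h).1

theorem Valid.isSome_of_hb (hG : G.Valid P) {m n : T × ℕ} (h : G.HB m n) :
    (G.lab m).isSome ∧ (G.lab n).isSome := by
  have hm : ∀ a n, n ∈ G.stores a → (G.lab n).isSome := by
    intro a n h
    obtain ⟨v, h⟩ := hG.lab_of_mem h
    simp [h]
  cases h with
  | po t j k hjk hk =>
    refine ⟨?_, hk⟩
    simp only [lab] at hk ⊢
    grind
  | so a _ _ h => exact ⟨hm a _ (h.subset (by simp)), hm a _ (h.subset (by simp))⟩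
  | src _ _ h =>
    obtain ⟨a, v, h'⟩ := hG.src_load _ _ h
    have := (hG.src_some n.1 n.2 a v m h' h).1
    simp [h', this]
  | cf _ a v m' _ h₁ h₂ h₃ => exact ⟨by simp [h₁], hm a _ (h₃.subset (by simp))⟩
  | cfi _ a v _ h₁ h₂ h₃ => exact ⟨by simp [h₁], hm a _ h₃⟩

theorem Valid.isSome_of_transGen (hG : G.Valid P) {m n : T × ℕ} (h : TransGen G.HB m n) :
    (G.lab m).isSome ∧ (G.lab n).isSome := by
  obtain ⟨b, hb, -⟩ := TransGen.head'_iff.1 h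
  obtain ⟨c, -, hc⟩ := TransGen.tail'_iff.1 h
  exact ⟨(hG.isSome_of_hb hb).1, (hG.isSome_of_hb hc).2⟩

/-- The executed store is put at the end of the store order, so edges are only added. -/
theorem HB.flush {m n : T × ℕ} (h : G.HB m n) (t : T) (p : ℕ) (a : D) :
    (G.flush t p a).HB m n := by
  have hs : ∀ b, (G.stores b).Sublist ((G.flush t p a).stores b) := by
    intro b
    by_cases hb : b = a
    · subst hb; simp [Graph.flush]
    · simp [Graph.flush, hb]
  cases h with
  | po t j k hjk hk => exact .po _ _ _ hjk hk
  | so b _ _ h => exact .so b _ _ (h.trans (hs b))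
  | src _ _ h => exact .src _ _ h
  | cf _ b v m' _ h₁ h₂ h₃ => exact .cf _ b v m' _ h₁ h₂ (h₃.trans (hs b))
  | cfi _ b v _ h₁ h₂ h₃ => exact .cfi _ b v _ h₁ h₂ ((hs b).subset h₃)

theorem Acc.flush {b : D} {y : T × ℕ} (h : G.Acc b y) (t : T) (p : ℕ) (a : D) :
    (G.flush t p a).Acc b y := by
  have hs : ∀ n ∈ G.stores b, n ∈ (G.flush t p a).stores b := by
    intro n hn
    by_cases hb : b = a
    · subst hb; simp [Graph.flush, hn]
    · simp [Graph.flush, hb, hn]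
  rcases h with h | ⟨h, h' | ⟨m, hm, h'⟩⟩
  · exact .inl (hs _ h)
  · exact .inr ⟨h, .inl h'⟩
  · exact .inr ⟨h, .inr ⟨m, hs _ hm, h'⟩⟩

theorem sublist_append_singleton {α : Type*} {m n x : α} {l : List α}
    (h : [m, n].Sublist (l ++ [x])) : [m, n].Sublist l ∨ n = x ∧ m ∈ l := by
  rw [List.sublist_append_iff] at h
  obtain ⟨l₁, l₂, h₁, h₂, h₃⟩ := h
  rcases List.sublist_singleton.1 h₃ with rfl | rfl
  · left; simpa [h₁] using h₂
  · right
    have : [m] ++ [n] = l₁ ++ [x] := h₁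
    obtain ⟨rfl, h⟩ := List.append_inj' this rfl
    exact ⟨by simpa using h, by simpa using h₂⟩

theorem sublist_pair_append {α : Type*} {m x : α} {l : List α} (h : m ∈ l) :
    [m, x].Sublist (l ++ [x]) := by
  have : [m, x] = [m] ++ [x] := rfl
  rw [this]
  exact (List.singleton_sublist.2 h).append (List.Sublist.refl _)

/-- Accesses are exactly the nodes from which executing a store to `a` creates an edge, by store
order or by conflict; `hb_of_hb_flush` is the converse. -/
theorem Acc.hb_flush (t : T) (p : ℕ) {a : D} {y : T × ℕ} (h : G.Acc a y) :
    (G.flush t p a).HB y (t, p) := by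
  have hs : (G.flush t p a).stores a = G.stores a ++ [(t, p)] := by simp [Graph.flush]
  rcases h with h | ⟨⟨v, h⟩, h' | ⟨m, hm, h'⟩⟩
  · exact .so a _ _ (hs ▸ sublist_pair_append h)
  · exact .cfi _ a v _ h h' (by simp [hs])
  · exact .cf _ a v m _ h h' (hs ▸ sublist_pair_append hm)

theorem hb_of_hb_flush {t : T} {p : ℕ} {a : D} (ht : ∀ n ∈ G.stores a, n ≠ (t, p))
    {m n : T × ℕ} (h : (G.flush t p a).HB m n) :
    G.HB m n ∨ n = (t, p) ∧ G.Acc a m := by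
  have hs : (G.flush t p a).stores a = G.stores a ++ [(t, p)] := by simp [Graph.flush]
  have hs' : ∀ b ≠ a, (G.flush t p a).stores b = G.stores b := by
    intro b hb; simp [Graph.flush, hb]
  cases h with
  | po t j k hjk hk => exact .inl (.po _ _ _ hjk hk)
  | so b _ _ h =>
    by_cases hb : b = a
    · subst hb
      rw [hs] at h
      exact (sublist_append_singleton h).imp (.so _ _ _) fun h => ⟨h.1, .inl h.2⟩
    · rw [hs' b hb] at h
      exact .inl (.so _ _ _ h)
  | src _ _ h => exact .inl (.src _ _ h)
  | cf _ b v m' _ h₁ h₂ h₃ =>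
    by_cases hb : b = a
    · subst hb
      rw [hs] at h₃
      exact (sublist_append_singleton h₃).imp (.cf _ _ v m' _ h₁ h₂)
        fun h => ⟨h.1, .inr ⟨⟨v, h₁⟩, .inr ⟨m', h.2, h₂⟩⟩⟩
    · rw [hs' b hb] at h₃
      exact .inl (.cf _ _ v m' _ h₁ h₂ h₃)
  | cfi _ b v _ h₁ h₂ h₃ =>
    by_cases hb : b = a
    · subst hb
      rw [hs, List.mem_append] at h₃
      exact h₃.imp (.cfi _ _ v _ h₁ h₂) fun h => ⟨by simpa using h, .inr ⟨⟨v, h₁⟩, .inl h₂⟩⟩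
    · rw [hs' b hb] at h₃
      exact .inl (.cfi _ _ v _ h₁ h₂ h₃)

/-- A cycle that arises when a store is executed. -/
theorem Valid.path_of_flush_cycle (hG : G.Valid P) (hac : G.Acyclic) {t : T} {p : ℕ} {a v : D}
    (hp : p ∈ G.pend t) (hl : G.lab (t, p) = some (.st a v)) (hc : ¬ (G.flush t p a).Acyclic) :
    ∃ y, G.Acc a y ∧ TransGen G.HB (t, p) y := by
  have ht : ∀ b, (t, p) ∉ G.stores b := fun b h => ((hG.mem_stores b t p).1 h).2 hp
  simp only [Graph.Acyclic, not_forall, not_not] at hc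
  obtain ⟨c, hc⟩ := hc
  obtain ⟨y, hy, h⟩ := exists_path_of_cycle (R := G.HB) (N := G.Acc a)
    (fun m n h => hb_of_hb_flush (fun n hn h => ht a (h ▸ hn)) h) hac hc
  refine ⟨y, hy, ?_⟩
  -- The path is not trivial: `(t, p)` is still a pending store, hence no access to memory.
  rcases reflTransGen_iff_eq_or_transGen.1 h with rfl | h
  · rcases hy with hy | ⟨⟨w, hy⟩, -⟩
    · exact (ht _ hy).elim
    · simp [hl] at hy
  · exact h

theorem pop_stores {t : T} {k : ℕ} (hk : (G.ev t).length = k + 1) (a : D) :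
    (G.pop t).stores a = (G.stores a).filter (· ≠ (t, k)) := by
  simp [pop, hk]

theorem pop_src {t : T} {k : ℕ} (hk : (G.ev t).length = k + 1) :
    (G.pop t).src = Function.update G.src (t, k) none := by
  simp [pop, hk]

theorem hb_of_hb_pop {t : T} {k : ℕ} (hk : (G.ev t).length = k + 1) {m n : T × ℕ}
    (h : (G.pop t).HB m n) : G.HB m n := by
  have hs : ∀ b, ((G.pop t).stores b).Sublist (G.stores b) := fun b => List.filter_sublist
  have hlab : ∀ n x, (G.pop t).lab n = some x → n ≠ (t, k) ∧ G.lab n = some x := by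
    intro n x h
    rw [lab_pop hk, Function.update_apply] at h
    split_ifs at h with h'
    exact ⟨h', h⟩
  cases h with
  | po u j l hjl hl =>
    obtain ⟨x, hx⟩ := Option.isSome_iff_exists.1 hl
    exact .po _ _ _ hjl (by simp [(hlab _ _ hx).2])
  | so b _ _ h => exact .so b _ _ (h.trans (hs b))
  | src _ _ h =>
    rw [pop_src hk, Function.update_apply] at h
    split_ifs at h
    exact .src _ _ h
  | cf _ b v m' _ h₁ h₂ h₃ =>
    obtain ⟨h₀, h₁⟩ := hlab _ _ h₁
    rw [pop_src hk, Function.update_of_ne h₀] at h₂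
    exact .cf _ b v m' _ h₁ h₂ (h₃.trans (hs b))
  | cfi _ b v _ h₁ h₂ h₃ =>
    obtain ⟨h₀, h₁⟩ := hlab _ _ h₁
    rw [pop_src hk, Function.update_of_ne h₀] at h₂
    exact .cfi _ b v _ h₁ h₂ ((hs b).subset h₃)

/-- A conflict edge depends on a third node, the source of the load. By `hsrc` the removed event is
no source, so edges between remaining nodes survive. -/
theorem HB.pop {t : T} {k : ℕ} (hk : (G.ev t).length = k + 1) (hsrc : ∀ n, G.src n ≠ some (t, k))
    {m n : T × ℕ} (h : G.HB m n) (hm : m ≠ (t, k)) (hn : n ≠ (t, k)) : (G.pop t).HB m n := by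
  have hs : ∀ b m n, [m, n].Sublist (G.stores b) → m ≠ (t, k) → n ≠ (t, k) →
      [m, n].Sublist ((G.pop t).stores b) := by
    intro b m n h hm hn
    rw [pop_stores hk]
    simpa [List.filter_cons, hm, hn] using h.filter (· ≠ (t, k))
  have hlab : ∀ n, n ≠ (t, k) → (G.pop t).lab n = G.lab n := fun n hn => by
    rw [lab_pop hk, Function.update_of_ne hn]
  have hsr : ∀ n, n ≠ (t, k) → (G.pop t).src n = G.src n := fun n hn => by
    rw [pop_src hk, Function.update_of_ne hn]
  cases h with
  | po u j l hjl hl => exact .po _ _ _ hjl (by rwa [hlab _ hn])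
  | so b _ _ h => exact .so b _ _ (hs b _ _ h hm hn)
  | src _ _ h => exact .src _ _ (by rwa [hsr _ hn])
  | cf _ b v m' _ h₁ h₂ h₃ =>
    refine .cf _ b v m' _ (by rwa [hlab _ hm]) (by rwa [hsr _ hm]) (hs b _ _ h₃ ?_ hn)
    rintro rfl
    exact hsrc _ h₂
  | cfi _ b v _ h₁ h₂ h₃ =>
    refine .cfi _ b v _ (by rwa [hlab _ hm]) (by rwa [hsr _ hm]) ?_
    rw [pop_stores hk]
    simpa [hn] using h₃

theorem Acyclic.pop (h : G.Acyclic) {t : T} {k : ℕ} (hk : (G.ev t).length = k + 1) :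
    (G.pop t).Acyclic :=
  fun n hn => h n (TransGen.mono (fun _ _ => hb_of_hb_pop hk) _ _ hn)

/-- Appending an event whose source is the last store, or a pending one, creates a sink. -/
theorem Valid.push_sink (hG : G.Valid P) {t : T} {e : LEv D} {o : Option (T × ℕ)}
    (ho : ∀ m, o = some m → (G.lab m).isSome)
    (hld : ∀ a v, e = .ld a v → (∃ m, o = some m ∧ m.2 ∈ G.pend m.1) ∨ o = (G.stores a).getLast?) :
    ∀ n, ¬ (G.push t e o).HB (t, (G.ev t).length) n := by
  have hlab : G.lab (t, (G.ev t).length) = none := lab_eq_none_iff.2 le_rfl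
  have hst : ∀ a, (t, (G.ev t).length) ∉ G.stores a := by
    intro a h
    obtain ⟨v, h⟩ := hG.lab_of_mem h
    simp [hlab] at h
  intro n h
  generalize hx : (t, (G.ev t).length) = x at h
  have hsrc : (G.push t e o).src = Function.update G.src x o := by rw [← hx]; rfl
  cases h with
  | po u j k hjk hk =>
    obtain ⟨rfl, rfl⟩ := Prod.mk.inj hx
    rw [lab_push, Function.update_of_ne (by simp; omega), lab_eq_none_iff.2 hjk.le] at hk
    simp at hk
  | so b _ _ h => exact hst b (hx ▸ h.subset (by simp))
  | src _ _ h =>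
    rw [hsrc, Function.update_apply] at h
    split_ifs at h with hn
    · have := ho _ h
      rw [← hx, hlab] at this
      simp at this
    · obtain ⟨a, v, h'⟩ := hG.src_load _ _ h
      have := (hG.src_some n.1 n.2 a v x h' h).1
      rw [← hx, hlab] at this
      simp at this
  | cf _ b v m' _ h₁ h₂ h₃ =>
    rw [lab_push, hx, Function.update_self] at h₁
    rw [hsrc, Function.update_self] at h₂
    rcases hld b v (by simpa using h₁) with ⟨m, hm, hm'⟩ | h'
    · obtain rfl : m = m' := by rw [hm] at h₂; simpa using h₂
      exact ((hG.mem_stores b m.1 m.2).1 (h₃.subset (by simp))).2 hm'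
    -- The source is the last element of a duplicate-free list, so no store follows it.
    · rw [h'] at h₂
      obtain ⟨l, hl⟩ := List.getLast?_eq_some_iff.1 h₂
      have hnd := hG.nodup b
      simp only [push_stores, hl] at h₃ hnd
      rw [List.nodup_append] at hnd
      rcases sublist_append_singleton h₃ with h | ⟨-, h⟩
      · exact hnd.2.2 m' (h.subset (by simp)) m' (by simp) rfl
      · exact hnd.2.2 m' h m' (by simp) rfl
  | cfi _ b v _ h₁ h₂ h₃ =>
    rw [lab_push, hx, Function.update_self] at h₁
    rw [hsrc, Function.update_self] at h₂
    rcases hld b v (by simpa using h₁) with ⟨m, hm, -⟩ | h'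
    · simp [hm] at h₂
    · rw [h', List.getLast?_eq_none_iff] at h₂
      rw [push_stores, h₂] at h₃
      simp at h₃

theorem hb_of_hb_push {t : T} {e : LEv D} {o : Option (T × ℕ)}
    (hs : ∀ n, ¬ (G.push t e o).HB (t, (G.ev t).length) n) {m n : T × ℕ}
    (h : (G.push t e o).HB m n) : G.HB m n ∨ n = (t, (G.ev t).length) := by
  by_cases hn : n = (t, (G.ev t).length)
  · exact .inr hn
  left
  have hm : m ≠ (t, (G.ev t).length) := by rintro rfl; exact hs _ h
  have hlab : ∀ n, n ≠ (t, (G.ev t).length) → (G.push t e o).lab n = G.lab n := fun n hn => by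
    rw [lab_push, Function.update_of_ne hn]
  have hsr : ∀ n, n ≠ (t, (G.ev t).length) → (G.push t e o).src n = G.src n := fun n hn =>
    Function.update_of_ne hn _ _
  cases h with
  | po u j l hjl hl => exact .po _ _ _ hjl (by rwa [hlab _ hn] at hl)
  | so b _ _ h => exact .so b _ _ h
  | src _ _ h => exact .src _ _ (by rwa [hsr _ hn] at h)
  | cf _ b v m' _ h₁ h₂ h₃ =>
    exact .cf _ b v m' _ (by rwa [hlab _ hm] at h₁) (by rwa [hsr _ hm] at h₂) h₃
  | cfi _ b v _ h₁ h₂ h₃ =>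
    exact .cfi _ b v _ (by rwa [hlab _ hm] at h₁) (by rwa [hsr _ hm] at h₂) h₃

theorem Acyclic.push (h : G.Acyclic) {t : T} {e : LEv D} {o : Option (T × ℕ)}
    (hs : ∀ n, ¬ (G.push t e o).HB (t, (G.ev t).length) n) : (G.push t e o).Acyclic :=
  acyclic_of_sink (fun _ _ => hb_of_hb_push hs) hs h

/-- Only finitely many nodes carry events, so the converse of the transitive closure is well-founded
on them. -/
theorem Acyclic.exists_maximal [Finite T] (hac : G.Acyclic) (S : Set (T × ℕ))
    (hS : S.Nonempty) (hS' : ∀ n ∈ S, (G.lab n).isSome) :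
    ∃ n ∈ S, ∀ n', G.HB n n' → n' ∉ S := by
  have hfin : Finite {n // (G.lab n).isSome} := by
    refine Finite.of_injective (β := Σ t, Fin (G.ev t).length)
      (fun n => ⟨n.1.1, n.1.2, ?_⟩) ?_
    · obtain ⟨x, hx⟩ := Option.isSome_iff_exists.1 n.2
      exact lt_length_of_lab hx
    · rintro ⟨⟨t, j⟩, h⟩ ⟨⟨u, k⟩, h'⟩ he
      simp only [Sigma.mk.injEq] at he
      obtain ⟨rfl, he⟩ := he
      simpa using he
  let r : {n // (G.lab n).isSome} → {n // (G.lab n).isSome} → Prop :=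
    fun m n => TransGen G.HB n.1 m.1
  have : IsTrans _ r := ⟨fun a b c h₁ h₂ => TransGen.trans h₂ h₁⟩
  have : Std.Irrefl r := ⟨fun a h => hac _ h⟩
  have hwf := Finite.wellFounded_of_trans_of_irrefl r
  obtain ⟨n, hn⟩ := hS
  obtain ⟨⟨x, hx'⟩, hx, hmin⟩ := hwf.has_min {y | y.1 ∈ S} ⟨⟨n, hS' n hn⟩, hn⟩
  exact ⟨x, hx, fun n' h h' => hmin ⟨n', hS' n' h'⟩ h' (.single h)⟩

/-- A node without successors is the last one of its thread. -/
theorem length_of_maximal {t : T} {k : ℕ} (hn : (G.lab (t, k)).isSome)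
    (h : ¬ (G.lab (t, k + 1)).isSome) : (G.ev t).length = k + 1 := by
  obtain ⟨x, hx⟩ := Option.isSome_iff_exists.1 hn
  have h₁ := lt_length_of_lab hx
  rw [Option.not_isSome_iff_eq_none, lab_eq_none_iff] at h
  omega

end Graph
end TSO

/-! ### Minimal violations -/

namespace TSO
namespace Graph
open Relation
variable {D R L T : Type*} [DecidableEq D] [DecidableEq T] [Zero D] [DecidableEq R]
  {P : Program D R L T} {G : Graph D T}

/-- Executing the oldest pending store `(t, p)` of `t`, whose address is `a`, creates the first
happens-before cycle. -/
structure Violation (P : Program D R L T) (G : Graph D T) (t : T) (p : ℕ) (a : D) : Prop where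
  valid : G.Valid P
  acyclic : G.Acyclic
  head : ∃ β, G.pend t = p :: β
  lab : ∃ v, G.lab (t, p) = some (.st a v)
  path : ∃ y, G.Acc a y ∧ TransGen G.HB (t, p) y

/-- The number of events plus the number of pending stores. -/
def size [Fintype T] (G : Graph D T) : ℕ := ∑ t, ((G.ev t).length + (G.pend t).length)

/-- An executed store precedes all pending stores of its thread, so it is not the last event; a
pending store is read only by later events of its own thread, and there are none. -/
theorem Valid.src_ne_last (hG : G.Valid P) {u : T} {K : ℕ} (hu : G.pend u ≠ [])
    (hK : (G.ev u).length = K + 1) (n : T × ℕ) : G.src n ≠ some (u, K) := by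
  intro h
  obtain ⟨q, hq⟩ := List.exists_mem_of_ne_nil _ hu
  obtain ⟨a, v, h'⟩ := hG.src_load _ _ h
  have hn := lt_length_of_lab (t := n.1) (k := n.2) h'
  obtain ⟨h₁, ⟨h₂, -⟩ | ⟨h₂, -, h₃, -⟩⟩ := hG.src_some n.1 n.2 a v _ h' h
  · have := hG.fifo u K q a v hq h₁ h₂
    have := hG.pend_lt hq
    omega
  · simp only at h₂ h₃
    rw [← h₂] at hn
    omega

/-- Only loads from memory lead out of the last event of a thread with pending stores. -/
theorem Valid.acc_of_hb_last (hG : G.Valid P) {u : T} {K : ℕ} (hu : G.pend u ≠ [])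
    (hK : (G.ev u).length = K + 1) {z : T × ℕ} (h : G.HB (u, K) z) :
    ∃ a v, G.lab (u, K) = some (.ld a v) ∧ G.Acc a (u, K) := by
  obtain ⟨q, hq⟩ := List.exists_mem_of_ne_nil _ hu
  generalize hx : (u, K) = x at h
  cases h with
  | po t j k hjk hk =>
    obtain ⟨rfl, rfl⟩ := Prod.mk.inj hx
    rw [lab_eq_none_iff.2 (by omega)] at hk
    simp at hk
  | so b _ _ h =>
    subst hx
    obtain ⟨⟨v, h₁⟩, h₂⟩ := (hG.mem_stores b u K).1 (h.subset (by simp))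
    have := hG.fifo u K q b v hq h₁ h₂
    have := hG.pend_lt hq
    omega
  | src _ _ h => exact (hG.src_ne_last hu hK _ (hx ▸ h)).elim
  | cf _ b v m' _ h₁ h₂ h₃ =>
    exact ⟨b, v, h₁, .inr ⟨⟨v, h₁⟩, .inr ⟨m', h₃.subset (by simp), h₂⟩⟩⟩
  | cfi _ b v _ h₁ h₂ h₃ => exact ⟨b, v, h₁, .inr ⟨⟨v, h₁⟩, .inl h₂⟩⟩

theorem size_pop_lt [Fintype T] {u : T} {K : ℕ} (hK : (G.ev u).length = K + 1) :
    (G.pop u).size < G.size := by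
  apply Finset.sum_lt_sum
  · intro t _
    by_cases ht : t = u
    · subst ht
      have := List.length_filter_le (fun j => decide (j ≠ (G.ev t).length - 1)) (G.pend t)
      simp only [pop, Function.update_self, List.length_dropLast]
      omega
    · simp [pop, ht]
  · refine ⟨u, Finset.mem_univ _, ?_⟩
    have := List.length_filter_le (fun j => decide (j ≠ (G.ev u).length - 1)) (G.pend u)
    simp only [pop, Function.update_self, List.length_dropLast]
    omega

theorem size_flush_lt [Fintype T] {u : T} {p : ℕ} {a : D} (hu : G.pend u ≠ []) :
    (G.flush u p a).size < G.size := by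
  have := List.length_pos_iff.2 hu
  apply Finset.sum_lt_sum
  · intro t _
    by_cases ht : t = u
    · subst ht
      simp [flush]
    · simp [flush, ht]
  · refine ⟨u, Finset.mem_univ _, ?_⟩
    simp [flush]
    omega

section Minimal
variable [Fintype T] {t : T} {p : ℕ} {a : D}

/-- The cycle leaves `(t, p)`, but only a load can have an edge out of the last event of a thread
with pending stores. -/
theorem Violation.p_lt (h : G.Violation P t p a) {K : ℕ} (hK : (G.ev t).length = K + 1) : p < K := by
  obtain ⟨β, hβ⟩ := h.head
  obtain ⟨v, hv⟩ := h.lab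
  obtain ⟨y, -, hy⟩ := h.path
  have := lt_length_of_lab hv
  rcases Nat.lt_or_ge p K with h' | h'
  · exact h'
  · obtain rfl : p = K := by omega
    obtain ⟨z, hz, -⟩ := TransGen.head'_iff.1 hy
    obtain ⟨b, w, hb, -⟩ := h.valid.acc_of_hb_last (by simp [hβ]) hK hz
    simp [hv] at hb

/-- In a minimal violation, the last event of a thread with pending stores lies on every cycle. -/
theorem Violation.no_path_pop (h : G.Violation P t p a)
    (hmin : ∀ (G' : Graph D T) t' p' a', G'.Violation P t' p' a' → G.size ≤ G'.size)
    {u : T} {K : ℕ} (hu : G.pend u ≠ []) (hK : (G.ev u).length = K + 1) {y : T × ℕ}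
    (hy : G.Acc a y) (hyK : y ≠ (u, K)) : ¬ TransGen (G.pop u).HB (t, p) y := by
  intro hpath
  -- With such a path, `G.pop u` would be a smaller violation at the same store.
  refine absurd (hmin (G.pop u) t p a ?_) (not_le.2 (size_pop_lt hK))
  have hsrc := h.valid.src_ne_last hu hK
  have hne : (t, p) ≠ (u, K) := by
    intro he
    obtain ⟨rfl, rfl⟩ := Prod.mk.inj he
    exact absurd (h.p_lt hK) (lt_irrefl _)
  obtain ⟨β, hβ⟩ := h.head
  obtain ⟨v, hv⟩ := h.lab
  refine ⟨h.valid.pop hK hsrc, h.acyclic.pop hK, ?_, ?_, y, ?_, hpath⟩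
  · by_cases ht : t = u
    · subst ht
      have : p ≠ K := fun he => hne (by rw [he])
      simp [pop, hβ, hK, this]
    · simp [pop, ht, hβ]
  · exact ⟨v, by rw [lab_pop hK, Function.update_of_ne hne, hv]⟩
  · have hs : ∀ m ∈ G.stores a, m ≠ (u, K) → m ∈ (G.pop u).stores a := by
      intro m hm hm'
      rw [pop_stores hK]
      simpa [hm'] using hm
    rcases hy with hy | ⟨hy, hy'⟩
    · exact .inl (hs _ hy hyK)
    · refine .inr ⟨by rwa [lab_pop hK, Function.update_of_ne hyK], ?_⟩
      rw [pop_src hK, Function.update_of_ne hyK]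
      refine hy'.imp_right ?_
      rintro ⟨m, hm, hm'⟩
      exact ⟨m, hs _ hm (fun he => hsrc y (he ▸ hm')), hm'⟩

theorem Violation.acc_ne (h : G.Violation P t p a) {y : T × ℕ} (hy : G.Acc a y) : (t, p) ≠ y := by
  rintro rfl
  obtain ⟨β, hβ⟩ := h.head
  obtain ⟨v, hv⟩ := h.lab
  rcases hy with hy | ⟨⟨w, hy⟩, -⟩
  · exact ((h.valid.mem_stores a t p).1 hy).2 (by simp [hβ])
  · simp [hv] at hy

/-- A path to `y` that avoids the last event of `t` would survive the removal of this event, against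
minimality. -/
theorem Violation.last_path (h : G.Violation P t p a)
    (hmin : ∀ (G' : Graph D T) t' p' a', G'.Violation P t' p' a' → G.size ≤ G'.size)
    {K : ℕ} (hK : (G.ev t).length = K + 1) {y : T × ℕ} (hy : G.Acc a y)
    (hpath : TransGen G.HB (t, p) y) : ReflTransGen G.HB (t, K) y := by
  obtain ⟨β, hβ⟩ := h.head
  have hu : G.pend t ≠ [] := by simp [hβ]
  have hne : (t, p) ≠ (t, K) := by
    have := h.p_lt hK
    simp; omega
  rcases path_avoids_or (R' := (G.pop t).HB) (e := (t, K))
    (fun m n h' => h'.pop hK (h.valid.src_ne_last hu hK)) hne hpath.to_reflTransGen with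
    ⟨h₁, h₂⟩ | ⟨-, h₂⟩
  · rcases reflTransGen_iff_eq_or_transGen.1 h₁ with he | h₁
    · exact (h.acc_ne hy he.symm).elim
    · exact (h.no_path_pop hmin hu hK hy h₂ h₁).elim
  · exact h₂

/-- By `last_path` there is a path from `(t, K)` to an access. If it avoided `(u, M)`, then together
with the program order edge from `(t, p)` to `(t, K)` it would survive in `G.pop u`, against
minimality. -/
theorem Violation.path_between (h : G.Violation P t p a)
    (hmin : ∀ (G' : Graph D T) t' p' a', G'.Violation P t' p' a' → G.size ≤ G'.size)
    {K : ℕ} (hK : (G.ev t).length = K + 1) {u : T} (hut : u ≠ t) (hu : G.pend u ≠ []) {M : ℕ}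
    (hM : (G.ev u).length = M + 1) : TransGen G.HB (t, K) (u, M) := by
  obtain ⟨y, hy, hpath⟩ := h.path
  have hne : ∀ j, (t, j) ≠ (u, M) := fun j he => hut (Prod.mk.inj he).1.symm
  have hsrc := h.valid.src_ne_last hu hM
  rcases path_avoids_or (R' := (G.pop u).HB) (e := (u, M))
    (fun m n h' => h'.pop hM hsrc) (hne K) (h.last_path hmin hK hy hpath) with
    ⟨h₁, h₂⟩ | ⟨h₂, -⟩
  · have hpo : G.HB (t, p) (t, K) := by
      refine .po _ _ _ (h.p_lt hK) ?_
      rw [Option.isSome_iff_ne_none, Ne, lab_eq_none_iff]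
      omega
    exact (h.no_path_pop hmin hu hM hy h₂
      (TransGen.head' (hpo.pop hM hsrc (hne p) (hne K)) h₁)).elim
  · exact h₂

theorem Valid.exists_length (hG : G.Valid P) {u : T} (hu : G.pend u ≠ []) :
    ∃ K, (G.ev u).length = K + 1 := by
  obtain ⟨q, hq⟩ := List.exists_mem_of_ne_nil _ hu
  have := hG.pend_lt hq
  exact ⟨(G.ev u).length - 1, by omega⟩

/-- In a minimal violation, only one thread has pending stores. -/
theorem Violation.pend_eq_nil (h : G.Violation P t p a)
    (hmin : ∀ (G' : Graph D T) t' p' a', G'.Violation P t' p' a' → G.size ≤ G'.size)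
    {u : T} (hut : u ≠ t) : G.pend u = [] := by
  by_contra hu
  obtain ⟨β, hβ⟩ := h.head
  obtain ⟨K, hK⟩ := h.valid.exists_length (u := t) (by simp [hβ])
  obtain ⟨M, hM⟩ := h.valid.exists_length hu
  obtain ⟨q, γ, hγ⟩ := List.exists_cons_of_ne_nil hu
  obtain ⟨b, w, hb⟩ := h.valid.pend_st u q (by simp [hγ])
  -- If executing the oldest pending store of `u` is harmless, it leads to a smaller violation.
  -- Otherwise the same graph is also a minimal violation at `(u, q)`; then the last events of `t`
  -- and `u` reach each other, a cycle in `G`.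
  by_cases hf : (G.flush u q b).Acyclic
  · refine absurd (hmin (G.flush u q b) t p a ?_) (not_le.2 (size_flush_lt hu))
    obtain ⟨y, hy, hpath⟩ := h.path
    refine ⟨h.valid.flush hγ hb, hf, ⟨β, ?_⟩, h.lab, y, hy.flush _ _ _,
      TransGen.mono (fun _ _ h => h.flush _ _ _) _ _ hpath⟩
    simp [flush, hut.symm, hβ]
  · have h' : G.Violation P u q b := ⟨h.valid, h.acyclic, ⟨γ, hγ⟩, ⟨w, hb⟩,
      h.valid.path_of_flush_cycle h.acyclic (by simp [hγ]) hb hf⟩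
    exact h.acyclic _ ((h.path_between hmin hK hut hu hM).trans
      (h'.path_between hmin hM hut.symm (by simp [hβ]) hK))

end Minimal

/-- A violation in which only one thread `t` has pending stores, and the last event `(t, K)` of this
thread is a load from memory, which happens before an access to the address of the oldest pending
store of `t`. -/
structure AttackGraph (P : Program D R L T) (G : Graph D T) (t : T) (p K : ℕ) (a x v : D) :
    Prop where
  valid : G.Valid P
  acyclic : G.Acyclic
  head : ∃ β, G.pend t = p :: β
  pend : ∀ u, u ≠ t → G.pend u = []
  lab : ∃ w, G.lab (t, p) = some (.st a w)
  length : (G.ev t).length = K + 1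
  load : G.lab (t, K) = some (.ld x v)
  noEarly : ∀ k ∈ G.pend t, ∀ w, G.lab (t, k) ≠ some (.st x w)
  path : ∃ y, G.Acc a y ∧ ReflTransGen G.HB (t, K) y
  lt : p < K

/-- A violation with the least number of events and pending stores has all the required properties.
-/
theorem Violation.exists_attackGraph [Fintype T] {t : T} {p : ℕ} {a : D}
    (h : G.Violation P t p a) :
    ∃ (G' : Graph D T) (t' : T) (p' K : ℕ) (a' x v : D), G'.AttackGraph P t' p' K a' x v := by
  have hne : {N | ∃ (G' : Graph D T) (t' : T) (p' : ℕ) (a' : D),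
      G'.Violation P t' p' a' ∧ G'.size = N}.Nonempty := ⟨_, G, t, p, a, h, rfl⟩
  obtain ⟨G', t', p', a', h', hN⟩ := Nat.sInf_mem hne
  have hmin : ∀ (G'' : Graph D T) t'' p'' a'', G''.Violation P t'' p'' a'' → G'.size ≤ G''.size :=
    fun G'' t'' p'' a'' h'' => hN ▸ Nat.sInf_le ⟨G'', t'', p'', a'', h'', rfl⟩
  obtain ⟨β, hβ⟩ := h'.head
  have hpend : G'.pend t' ≠ [] := by simp [hβ]
  obtain ⟨K, hK⟩ := h'.valid.exists_length hpend
  obtain ⟨y, hy, hpath⟩ := h'.path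
  have hlast := h'.last_path hmin hK hy hpath
  obtain ⟨x, v, hx, hacc⟩ : ∃ x v, G'.lab (t', K) = some (.ld x v) ∧ G'.Acc x (t', K) := by
    -- The last event is either itself the access that closes the cycle, and then no executed store
    -- because of FIFO order, or it has an outgoing edge.
    rcases ReflTransGen.cases_head hlast with he | ⟨z, hz, -⟩
    · rw [← he] at hy
      have hacc := hy
      rcases hacc with hy' | ⟨⟨v, hv⟩, -⟩
      · exfalso
        obtain ⟨⟨w, h₁⟩, h₂⟩ := (h'.valid.mem_stores _ _ _).1 hy'
        have := h'.valid.fifo t' K p' _ w (by simp [hβ]) h₁ h₂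
        have := h'.p_lt hK
        omega
      · exact ⟨a', v, hv, hy⟩
    · exact h'.valid.acc_of_hb_last hpend hK hz
  refine ⟨G', t', p', K, a', x, v, h'.valid, h'.acyclic, h'.head,
    fun u hu => h'.pend_eq_nil hmin hu, h'.lab, hK, hx, ?_, ⟨y, hy, hlast⟩, h'.p_lt hK⟩
  intro k hk w hw
  have hkK : k < K := by
    have := h'.valid.pend_lt hk
    have : k ≠ K := by rintro rfl; simp [hx] at hw
    omega
  -- A load that reads from memory has no pending store to its address before it in its own thread.
  rcases hacc with hacc | ⟨-, hacc | ⟨m, hm, hm'⟩⟩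
  · obtain ⟨w', h⟩ := h'.valid.lab_of_mem hacc
    simp [hx] at h
  · exact (h'.valid.src_none t' K x v hx hacc).2 k w hkK hw hk
  · obtain ⟨-, ⟨-, h₁⟩ | ⟨h₀, h₁, -⟩⟩ := h'.valid.src_some t' K x v m hx hm'
    · exact h₁ k w hkK hw hk
    · exact ((h'.valid.mem_stores _ _ _).1 hm).2 (h₀ ▸ h₁)

end Graph
end TSO

/-! ### Runs, single steps, and graphs represented by words -/

namespace TSO

section Words
variable {D T : Type*} [DecidableEq T]

theorem issueCount_append (t : T) (u w : List (Act D T)) :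
    issueCount t (u ++ w) = issueCount t u + issueCount t w := List.countP_append

theorem storeCount_append (t : T) (u w : List (Act D T)) :
    storeCount t (u ++ w) = storeCount t u + storeCount t w := List.countP_append

theorem traceOf_append_singleton [DecidableEq D] (w : List (Act D T)) (b : Act D T) :
    traceOf (w ++ [b]) = (traceOf w).append b := by
  simp [traceOf, List.foldl_append]

@[simp] theorem LEv.act_thread (t : T) (b : Bool) (e : LEv D) : (e.act t b).thread = t := by
  cases e <;> cases b <;> rfl

end Words

section
variable {D R L T : Type*} [Zero D] [DecidableEq D] [DecidableEq R] [DecidableEq T]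
  {P : Program D R L T}

theorem Run.append {s s' s'' : State D R L T} {u w : List (Act D T)} (h : Run P s u s')
    (h' : Run P s' w s'') : Run P s (u ++ w) s'' := by
  induction h with
  | nil => exact h'
  | cons s₁ s₂ s₃ b w hb _ ih => exact .cons _ _ _ _ _ hb (ih h')

theorem Run.single {s s' : State D R L T} {b : Act D T} (h : Step P s b s') : Run P s [b] s' :=
  .cons _ _ _ _ _ h (.nil _)

theorem Run.append_inv {s s'' : State D R L T} {u w : List (Act D T)} (h : Run P s (u ++ w) s'') :
    ∃ s', Run P s u s' ∧ Run P s' w s'' := by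
  induction u generalizing s with
  | nil => exact ⟨s, .nil s, h⟩
  | cons b u ih =>
    cases h with
    | cons _ s₁ _ _ _ hb h =>
      obtain ⟨s', h₁, h₂⟩ := ih h
      exact ⟨s', .cons _ _ _ _ _ hb h₁, h₂⟩

theorem Run.cons_inv {s s'' : State D R L T} {b : Act D T} {w : List (Act D T)}
    (h : Run P s (b :: w) s'') : ∃ s', Step P s b s' ∧ Run P s' w s'' := by
  cases h with
  | cons _ s₁ _ _ _ hb h => exact ⟨s₁, hb, h⟩

theorem Run.nil_inv {s s' : State D R L T} (h : Run P s [] s') : s' = s := by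
  cases h; rfl

theorem SCRun.append {s s' s'' : SCState D R L T} {u w : List (Act D T)} (h : SCRun P s u s')
    (h' : SCRun P s' w s'') : SCRun P s (u ++ w) s'' := by
  induction h with
  | nil => exact h'
  | cons t i s₁ s₂ s₃ u w hb _ ih =>
    rw [List.append_assoc]
    exact .cons _ _ _ _ _ _ _ hb (ih h')

theorem SCRun.single {t : T} {i : LInstr D R L} {s s' : SCState D R L T} {u : List (Act D T)}
    (h : SCStep P t i s u s') : SCRun P s u s' := by
  have := SCRun.cons t i s s' s' u [] h (.nil _)
  rwa [List.append_nil] at this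

/-- The buffer of `t` admits the event. -/
def State.Enabled (s : State D R L T) (t : T) : LEv D → Prop
  | .ld a v => (∃ β, (s.buf t).filter (fun p => decide (p.1 = a)) = β ++ [(a, v)]) ∨
      (s.buf t).filter (fun p => decide (p.1 = a)) = [] ∧ v = s.mem a
  | .fence => s.buf t = []
  | _ => True

/-- The state after an event of `t`. -/
def State.exec (s : State D R L T) (t : T) (e : LEv D) (l : L) (ρ : R → D) : State D R L T where
  pc := Function.update s.pc t l
  mem := s.mem
  reg := Function.update s.reg t ρ
  buf := match e with
    | .st a v => Function.update s.buf t (s.buf t ++ [(a, v)])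
    | _ => s.buf

/-- This separates the effect of an instruction on its thread (`Instr.Eff`) from the condition on
buffer and memory (`State.Enabled`), so that later proofs treat all instructions at once. A store
yields its issue, hence the flag `true`. -/
theorem instrStep_iff {t : T} {i : LInstr D R L} {s : State D R L T} {b : Act D T}
    {s' : State D R L T} :
    InstrStep P t i s b s' ↔ ∃ e ρ, i ∈ (P.thread t).code ∧ s.pc t = i.src ∧
      i.instr.Eff (s.reg t) e ρ ∧ s.Enabled t e ∧ b = e.act t true ∧ s' = s.exec t e i.dst ρ := by
  constructor
  · intro h
    cases h with
    | loadBuf r e a v β h₁ h₂ h₃ h₄ h₅ =>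
      exact ⟨.ld a v, _, h₁, h₂, h₃ ▸ h₄ ▸ .load r e _ v, .inl ⟨β, h₅⟩, rfl, rfl⟩
    | loadMem r e a v h₁ h₂ h₃ h₄ h₅ h₆ =>
      exact ⟨.ld a v, _, h₁, h₂, h₃ ▸ h₄ ▸ .load r e _ v, .inr ⟨h₅, h₆⟩, rfl, rfl⟩
    | store e₁ e₂ a v h₁ h₂ h₃ h₄ h₅ =>
      refine ⟨.st a v, s.reg t, h₁, h₂, h₃ ▸ h₄ ▸ h₅ ▸ .store e₁ e₂ _, trivial, rfl, ?_⟩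
      simp [State.exec]
    | mfence h₁ h₂ h₃ h₄ =>
      refine ⟨.fence, s.reg t, h₁, h₂, h₃ ▸ .mfence _, h₄, rfl, ?_⟩
      simp [State.exec]
    | assign r e h₁ h₂ h₃ =>
      exact ⟨.loc, _, h₁, h₂, h₃ ▸ .assign r e _, trivial, rfl, rfl⟩
    | assertion e h₁ h₂ h₃ h₄ =>
      refine ⟨.loc, s.reg t, h₁, h₂, h₃ ▸ .assertion e _ h₄, trivial, rfl, ?_⟩
      simp [State.exec]
  · rintro ⟨e, ρ, h₁, h₂, h₃, h₄, rfl, rfl⟩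
    generalize hi : i.instr = ins at h₃
    generalize hr : s.reg t = reg at h₃
    cases h₃ with
    | load r e ρ v =>
      subst hr
      rcases h₄ with ⟨β, h₄⟩ | ⟨h₄, h₅⟩
      · exact .loadBuf s r e _ v β h₁ h₂ hi rfl h₄
      · exact .loadMem s r e _ v h₁ h₂ hi rfl h₄ h₅
    | store e₁ e₂ ρ =>
      have := InstrStep.store s e₁ e₂ _ _ h₁ h₂ hi rfl rfl
      subst hr
      simpa [State.exec, LEv.act] using this
    | mfence ρ =>
      have := InstrStep.mfence s h₁ h₂ hi h₄
      subst hr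
      simpa [State.exec, LEv.act] using this
    | assign r e ρ =>
      subst hr
      exact .assign s r e h₁ h₂ hi
    | assertion e ρ he =>
      subst hr
      have := InstrStep.assertion s e h₁ h₂ hi he
      simpa [State.exec, LEv.act] using this

/-- The word `ω` leads from the initial state to `s` and is an execution of the event graph `G`. -/
structure Rep (P : Program D R L T) (ω : List (Act D T)) (s : State D R L T) (G : Graph D T) :
    Prop where
  run : Run P P.initState ω s
  loc : ∀ t, LRun P t (G.ev t) (s.pc t) (s.reg t)
  mem : ∀ a, (G.stores a = [] ∧ s.mem a = 0) ∨
    ∃ m, (G.stores a).getLast? = some m ∧ G.lab m = some (.st a (s.mem a))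
  buf : ∀ t, List.Forall₂ (fun k p => G.lab (t, k) = some (.st p.1 p.2)) (G.pend t) (s.buf t)
  cnt : ∀ t, issueCount t ω = storeCount t ω + (s.buf t).length
  events : (traceOf ω).events = G.acts
  stores : (traceOf ω).stores = G.stores
  source : ∀ n, (∀ m, G.src n = some m → m.2 ∉ G.pend m.1) → (traceOf ω).source n = G.src n

namespace Graph

/-- The graph without events. -/
def empty (D T : Type*) : Graph D T := ⟨fun _ => [], fun _ => [], fun _ => [], fun _ => none⟩

theorem rep_empty : Rep P [] P.initState (empty D T) where
  run := .nil _
  loc _ := .nil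
  mem _ := .inl ⟨rfl, rfl⟩
  buf _ := .nil
  cnt _ := rfl
  events := rfl
  stores := rfl
  source _ _ := rfl

theorem valid_empty : (empty D T).Valid P := by
  constructor <;> intros <;> simp_all [empty, lab]
  exact ⟨_, _, .nil⟩

theorem acyclic_empty : (empty D T).Acyclic := by
  intro n h
  obtain ⟨b, hb, -⟩ := Relation.TransGen.head'_iff.1 h
  cases hb <;> simp_all [empty, lab]

variable {G : Graph D T}

theorem acts_getElem? (G : Graph D T) (t : T) (k : ℕ) :
    (G.acts t)[k]? = (G.lab (t, k)).map fun e => e.act t (decide (k ∈ G.pend t)) := by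
  simp [acts, lab]

theorem acts_getElem?_eq_ld {t : T} {k : ℕ} {a v : D} :
    (G.acts t)[k]? = some (.ld t a v) ↔ G.lab (t, k) = some (.ld a v) := by
  rw [acts_getElem?]
  constructor
  · intro h
    obtain ⟨e, he, h⟩ := Option.map_eq_some_iff.1 h
    rw [he]
    cases e <;> simp [LEv.act] at h ⊢
    · exact h
    · split_ifs at h
  · intro h
    simp [h, LEv.act]

@[simp] theorem length_acts (G : Graph D T) (t : T) : (G.acts t).length = (G.ev t).length := by
  simp [acts]

theorem acts_push (hG : G.Valid P) (t : T) (e : LEv D) (o : Option (T × ℕ)) :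
    (G.push t e o).acts = Function.update G.acts t (G.acts t ++ [e.act t true]) := by
  funext u
  apply List.ext_getElem?
  intro k
  rw [acts_getElem?, lab_push]
  by_cases hu : u = t
  · subst hu
    rw [Function.update_self]
    rcases lt_trichotomy k (G.ev u).length with hk | hk | hk
    · rw [List.getElem?_append_left (by simpa using hk), acts_getElem?,
        Function.update_of_ne (by simp; omega)]
      have : (k ∈ (G.push u e o).pend u) ↔ k ∈ G.pend u := by
        rw [mem_pend_push]; constructor
        · rintro (h | ⟨-, h, -⟩)
          · exact h
          · omega
        · exact .inl
      simp [this]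
    · subst hk
      rw [Function.update_self, List.getElem?_append_right (by simp)]
      have h : (G.ev u).length ∈ (G.push u e o).pend u ↔ ∃ a v, e = .st a v := by
        rw [mem_pend_push]
        constructor
        · rintro (h | ⟨-, -, h⟩)
          · exact absurd (hG.pend_lt h) (lt_irrefl _)
          · exact h
        · exact fun h => .inr ⟨rfl, rfl, h⟩
      cases e <;> simp [LEv.act, h]
    · rw [Function.update_of_ne (by simp; omega), lab_eq_none_iff.2 hk.le,
        List.getElem?_eq_none (by simp; omega)]
      rfl
  · rw [Function.update_of_ne (by simp [hu]), Function.update_of_ne hu, acts_getElem?]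
    have : (k ∈ (G.push t e o).pend u) ↔ k ∈ G.pend u := by
      rw [mem_pend_push]; simp [hu]
    simp [this]

end Graph

end
end TSO

/-! ### Actions of a computation as graph operations -/

namespace TSO
section
variable {D R L T : Type*} [Zero D] [DecidableEq D] [DecidableEq R] [DecidableEq T]
  {P : Program D R L T} {G : Graph D T} {ω : List (Act D T)} {s : State D R L T}

theorem issueCount_act (u t : T) (e : LEv D) :
    issueCount u [e.act t true] = match e with
      | .st _ _ => if u = t then 1 else 0
      | _ => 0 := by
  cases e <;> simp [issueCount, LEv.act, Act.isIssue, Act.thread, List.countP_cons, eq_comm]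

theorem storeCount_act (u t : T) (e : LEv D) : storeCount u [e.act t true] = 0 := by
  cases e <;> simp [storeCount, LEv.act, Act.isStore, Act.thread]

theorem Trace.append_act_events (θ : Trace D T) (t : T) (e : LEv D) :
    (θ.append (e.act t true)).events =
      Function.update θ.events t (θ.events t ++ [e.act t true]) := by
  cases e <;> rfl

theorem Trace.append_act_stores (θ : Trace D T) (t : T) (e : LEv D) :
    (θ.append (e.act t true)).stores = θ.stores := by
  cases e <;> rfl

theorem Rep.length_events (h : Rep P ω s G) (t : T) :
    ((traceOf ω).events t).length = (G.ev t).length := by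
  rw [h.events, Graph.length_acts]

theorem Rep.next_act (h : Rep P ω s G) (t : T) (e : LEv D) :
    (traceOf ω).next (e.act t true) = (t, (G.ev t).length) := by
  cases e <;> simp [LEv.act, Trace.next, h.length_events]

/-- At first the trace lets every load read from the last executed store. For a load served from the
buffer this differs from the source in the graph, which is why `Rep.source` exempts nodes whose
source is pending. -/
theorem Rep.push (h : Rep P ω s G) (hG : G.Valid P) {t : T} {i : LInstr D R L} {e : LEv D}
    {ρ : R → D} {o : Option (T × ℕ)} (hi : i ∈ (P.thread t).code) (hpc : s.pc t = i.src)
    (heff : i.instr.Eff (s.reg t) e ρ) (hen : s.Enabled t e)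
    (hld : ∀ a v, e = .ld a v → (∃ m, o = some m ∧ m.2 ∈ G.pend m.1) ∨ o = (G.stores a).getLast?)
    (ho : (∀ a v, e ≠ .ld a v) → o = none) :
    Rep P (ω ++ [e.act t true]) (s.exec t e i.dst ρ) (G.push t e o) := by
  have hnew : G.lab (t, (G.ev t).length) = none := Graph.lab_eq_none_iff.2 le_rfl
  have hlab : ∀ n x, G.lab n = some x → (G.push t e o).lab n = some x := by
    intro n x hn
    rw [Graph.lab_push, Function.update_of_ne, hn]
    rintro rfl
    simp [hnew] at hn
  constructor
  · exact h.run.append (.single (.instr t i _ _ _ (instrStep_iff.2 ⟨e, ρ, hi, hpc, heff, hen, rfl, rfl⟩)))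
  · intro u
    by_cases hu : u = t
    · subst hu
      have := h.loc u
      rw [hpc] at this
      simpa [Graph.push, State.exec] using LRun.snoc _ _ i e ρ this hi heff
    · simpa [Graph.push, State.exec, hu] using h.loc u
  · intro a
    exact (h.mem a).imp_right fun ⟨m, hm, hm'⟩ => ⟨m, hm, hlab _ _ hm'⟩
  · intro u
    have hb := (h.buf u).imp fun k (p : D × D) => hlab (u, k) (.st p.1 p.2)
    by_cases he : ∃ a v, e = .st a v
    · obtain ⟨a, v, rfl⟩ := he
      by_cases hu : u = t
      · subst hu
        have hp : (G.push u (.st a v) o).pend u = G.pend u ++ [(G.ev u).length] := by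
          simp [Graph.push]
        have hs : (s.exec u (.st a v) i.dst ρ).buf u = s.buf u ++ [(a, v)] := by
          simp [State.exec]
        rw [hp, hs]
        refine List.rel_append hb (.cons ?_ .nil)
        rw [Graph.lab_push, Function.update_self]
      · simpa [Graph.push, State.exec, hu] using hb
    · have h₁ : (G.push t e o).pend = G.pend := by
        cases e <;> simp [Graph.push] at he ⊢
      have h₂ : (s.exec t e i.dst ρ).buf = s.buf := by
        cases e <;> simp [State.exec] at he ⊢
      rwa [h₁, h₂]
  · intro u
    rw [issueCount_append, storeCount_append, h.cnt, issueCount_act, storeCount_act]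
    by_cases hu : u = t
    · subst hu
      cases e <;> simp [State.exec]
      omega
    · cases e <;> simp [State.exec, hu]
  · rw [traceOf_append_singleton, Trace.append_act_events, h.events, Graph.acts_push hG]
  · rw [traceOf_append_singleton, Trace.append_act_stores, h.stores, Graph.push_stores]
  · have hsrc : (G.push t e o).src = Function.update G.src (t, (G.ev t).length) o := rfl
    have hnone : G.src (t, (G.ev t).length) = none := by
      by_contra hc
      obtain ⟨m, hm⟩ := Option.ne_none_iff_exists'.1 hc
      obtain ⟨a, v, hl⟩ := hG.src_load _ _ hm
      simp [hnew] at hl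
    have key : (traceOf (ω ++ [e.act t true])).source =
        Function.update (traceOf ω).source (t, (G.ev t).length)
          (match e with
            | .ld a _ => (G.stores a).getLast?
            | _ => none) := by
      rw [traceOf_append_singleton]
      -- The position is new and has no source yet, so for events other than loads the update by
      -- `none` changes nothing.
      have hsn : (traceOf ω).source (t, (G.ev t).length) = none := by
        rw [h.source _ (by simp [hnone]), hnone]
      cases e with
      | ld a v =>
        have := h.next_act t (.ld a v)
        simp only [LEv.act] at this
        simp [LEv.act, Trace.append, this, h.stores]
      | st a v => simp [LEv.act, Trace.append, ← hsn]
      | loc => simp [LEv.act, Trace.append, ← hsn]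
      | fence => simp [LEv.act, Trace.append, ← hsn]
    intro n hn
    rw [hsrc] at hn ⊢
    rw [key]
    by_cases hne : n = (t, (G.ev t).length)
    · subst hne
      rw [Function.update_self] at hn ⊢
      rw [Function.update_self]
      cases e with
      | ld a v =>
        rcases hld a v rfl with ⟨m, hm, hm'⟩ | h'
        · exact absurd (Graph.mem_pend_push.2 (.inl hm')) (hn m hm)
        · exact h'.symm
      | st a v => exact (ho (by simp)).symm
      | loc => exact (ho (by simp)).symm
      | fence => exact (ho (by simp)).symm
    · rw [Function.update_of_ne hne] at hn ⊢
      rw [Function.update_of_ne hne]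
      exact h.source n fun m hm hp => hn m hm (Graph.mem_pend_push.2 (.inl hp))

/-- The entries of the trace that are still issues are the pending positions, and the head of the
sorted list `G.pend t` is the first of them. -/
theorem Rep.next_st (h : Rep P ω s G) (hG : G.Valid P) {t : T} {p : ℕ} {β : List ℕ}
    (hp : G.pend t = p :: β) (a v : D) : (traceOf ω).next (.st t a v) = (t, p) := by
  have hpt : p ∈ G.pend t := by simp [hp]
  have hs := hG.sorted t
  rw [hp, List.pairwise_cons] at hs
  have hl : p < (G.acts t).length := by simpa using hG.pend_lt hpt
  simp only [Trace.next, h.events, Prod.mk.injEq, true_and]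
  rw [List.findIdx_eq hl]
  have hget : ∀ j (hj : j < (G.acts t).length), (G.acts t)[j].isIssue = true →
      j ∈ G.pend t := by
    intro j hj hi
    have h₁ := Graph.acts_getElem? G t j
    rw [List.getElem?_eq_getElem hj] at h₁
    obtain ⟨e, he, h₂⟩ := Option.map_eq_some_iff.1 h₁.symm
    rw [← h₂] at hi
    cases e <;> simp [LEv.act, Act.isIssue] at hi
    by_contra hc
    simp [hc] at hi
  constructor
  · obtain ⟨b, w, hb⟩ := hG.pend_st t p hpt
    have h₁ := Graph.acts_getElem? G t p
    rw [List.getElem?_eq_getElem hl, hb] at h₁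
    simp only [Option.map_some, Option.some.injEq] at h₁
    rw [h₁]
    simp [LEv.act, hpt, Act.isIssue]
  · intro j hj
    by_contra hc
    have := hget j (by omega) (by simpa using hc)
    rw [hp, List.mem_cons] at this
    rcases this with rfl | hm
    · omega
    · have := hs.1 j hm
      omega

/-- The state after the oldest entry of the buffer of `t` is written to memory. -/
def State.flush (s : State D R L T) (t : T) (a v : D) : State D R L T :=
  { s with mem := Function.update s.mem a v
           buf := Function.update s.buf t (s.buf t).tail }

theorem Rep.buf_eq (h : Rep P ω s G) {t : T} {p : ℕ} {β : List ℕ} {a v : D}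
    (hp : G.pend t = p :: β) (hl : G.lab (t, p) = some (.st a v)) :
    s.buf t = (a, v) :: (s.buf t).tail := by
  have := h.buf t
  rw [hp] at this
  generalize hb : s.buf t = bf at this
  cases this with
  | cons h₁ h₂ =>
    rw [hl] at h₁
    simp only [Option.some.injEq, LEv.st.injEq] at h₁
    simp [h₁.1, h₁.2]

theorem Rep.pend_eq (h : Rep P ω s G) {t : T} {β : List (D × D)} {a v : D}
    (hp : s.buf t = (a, v) :: β) :
    ∃ p γ, G.pend t = p :: γ ∧ G.lab (t, p) = some (.st a v) := by
  have := h.buf t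
  rw [hp] at this
  generalize hb : G.pend t = bf at this
  cases this with
  | cons h₁ h₂ => exact ⟨_, _, rfl, h₁⟩

theorem Graph.acts_flush (hG : G.Valid P) {t : T} {p : ℕ} {β : List ℕ} {a v : D}
    (hp : G.pend t = p :: β) (hl : G.lab (t, p) = some (.st a v)) :
    (G.flush t p a).acts = Function.update G.acts t ((G.acts t).set p (.st t a v)) := by
  have hs := hG.sorted t
  rw [hp, List.pairwise_cons] at hs
  funext u
  apply List.ext_getElem?
  intro k
  rw [Graph.acts_getElem?, Graph.flush_lab]
  by_cases hu : u = t
  · subst hu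
    rw [Function.update_self, List.getElem?_set]
    simp only [Graph.flush, Function.update_self, hp, List.tail_cons]
    split_ifs with h₁ h₂
    · subst h₁
      rw [hl]
      have : p ∉ β := fun h => lt_irrefl _ (hs.1 p h)
      simp [LEv.act, this]
    · have := Graph.lt_length_of_lab hl
      rw [Graph.length_acts] at h₂
      exact absurd this (h₁ ▸ h₂)
    · rw [Graph.acts_getElem?, hp]
      have : k ∈ p :: β ↔ k ∈ β := by simp [Ne.symm h₁]
      simp [this]
  · rw [Function.update_of_ne hu, Graph.acts_getElem?]
    simp [Graph.flush, hu]

/-- The delicate point is the source relation. The trace makes `(t, p)` the source of all later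
loads of `t` with the same address and value. Some of these may read from a newer pending store of
equal value; their source is still pending, so `Rep.source` does not constrain them. -/
theorem Rep.flush (h : Rep P ω s G) (hG : G.Valid P) {t : T} {p : ℕ} {β : List ℕ} {a v : D}
    (hp : G.pend t = p :: β) (hl : G.lab (t, p) = some (.st a v)) :
    Step P s (.st t a v) (s.flush t a v) ∧
    Rep P (ω ++ [.st t a v]) (s.flush t a v) (G.flush t p a) := by
  have hbuf := h.buf_eq hp hl
  have hstep : Step P s (.st t a v) (s.flush t a v) := .flush s t a v _ hbuf
  refine ⟨hstep, ?_⟩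
  have hpt : p ∈ G.pend t := by simp [hp]
  have hst : (G.flush t p a).stores = Function.update G.stores a (G.stores a ++ [(t, p)]) := rfl
  have hnext := h.next_st hG hp a v
  constructor
  · exact h.run.append (.single hstep)
  · exact h.loc
  · intro b
    rw [hst]
    by_cases hb : b = a
    · subst hb
      right
      refine ⟨(t, p), by simp, ?_⟩
      simp [State.flush, hl]
    · simpa [hb, State.flush] using h.mem b
  · intro u
    change List.Forall₂ (fun k p => G.lab (u, k) = some (.st p.1 p.2)) ((G.flush t p a).pend u)
      ((s.flush t a v).buf u)
    by_cases hu : u = t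
    · subst hu
      have := h.buf u
      rw [hp, hbuf] at this
      simp only [Graph.flush, State.flush, Function.update_self, hp, List.tail_cons]
      cases this with
      | cons h₁ h₂ => exact h₂
    · simpa [Graph.flush, State.flush, hu] using h.buf u
  · intro u
    rw [issueCount_append, storeCount_append, h.cnt]
    by_cases hu : u = t
    · subst hu
      have : (s.buf u).length = (s.buf u).tail.length + 1 := by rw [hbuf]; simp
      simp [State.flush, issueCount, storeCount, Act.isIssue, Act.isStore, Act.thread]
      rw [hbuf]
      simp
      omega
    · have hu' : ¬ t = u := fun h => hu h.symm
      simp [State.flush, issueCount, storeCount, Act.isIssue, Act.isStore, Act.thread,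
        hu, hu']
  · rw [traceOf_append_singleton, Graph.acts_flush hG hp hl]
    simp only [Trace.append, hnext, h.events]
  · rw [traceOf_append_singleton, hst]
    simp only [Trace.append, hnext, h.stores]
  · intro n hn
    have hmem : ∀ u k, k ∈ (G.flush t p a).pend u ↔ k ∈ G.pend u ∧ ¬ (u = t ∧ k = p) := by
      intro u k
      have hs := hG.sorted t
      rw [hp, List.pairwise_cons] at hs
      by_cases hu : u = t
      · subst hu
        simp only [Graph.flush, Function.update_self, hp, List.tail_cons, List.mem_cons]
        grind
      · simp [Graph.flush, hu]
    rw [traceOf_append_singleton]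
    simp only [Trace.append, hnext, h.events, Graph.flush_src] at hn ⊢
    obtain ⟨u, k⟩ := n
    simp only
    -- A redirected load comes after the pending store `(t, p)` to its address, so it reads from a
    -- pending store of `t`. As its source is no longer pending, it is `(t, p)`.
    split_ifs with hc
    · obtain ⟨rfl, hpk, hk⟩ := hc
      rw [hnext] at hpk
      rw [h.events, Graph.acts_getElem?_eq_ld] at hk
      rcases hsr : G.src (u, k) with _ | m
      · exact absurd hpt ((hG.src_none u k a v hk hsr).2 p v hpk hl)
      · obtain ⟨-, ⟨-, h₁⟩ | ⟨h₁, h₂, -⟩⟩ := hG.src_some u k a v m hk hsr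
        · exact absurd hpt (h₁ p v hpk hl)
        · have := hn m hsr
          rw [hmem, h₁] at this
          obtain ⟨m, l⟩ := m
          simp only at h₁ h₂ this
          subst h₁
          have : l = p := by
            by_contra hne
            exact this ⟨h₂, fun h => hne h.2⟩
          rw [this]
    · apply h.source
      intro m hm hmp
      have := hn m hm
      rw [hmem] at this
      -- If the source was pending before and is not pending now, it is `(t, p)`. Then the load
      -- satisfies the condition of the redirection.
      have hmt : m = (t, p) := by
        by_contra hne
        exact this ⟨hmp, fun h => hne (Prod.ext h.1 h.2)⟩
      subst hmt
      obtain ⟨b, w, hb⟩ := hG.src_load _ _ hm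
      obtain ⟨h₁, ⟨h₂, -⟩ | ⟨rfl, -, h₂, -⟩⟩ := hG.src_some u k b w _ hb hm
      · exact h₂ hpt
      · simp only at h₁ h₂
        rw [hl] at h₁
        simp only [Option.some.injEq, LEv.st.injEq] at h₁
        obtain ⟨rfl, rfl⟩ := h₁
        exact hc ⟨rfl, by rwa [hnext], by rw [h.events]; exact Graph.acts_getElem?_eq_ld.2 hb⟩

end
end TSO

/-! ### From computations to event graphs -/

namespace TSO
section
variable {D R L T : Type*} [Zero D] [DecidableEq D] [DecidableEq R] [DecidableEq T]
  {P : Program D R L T} {G : Graph D T} {ω : List (Act D T)} {s : State D R L T}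

/-- The newest buffer entry for an address comes from the last pending store to it. -/
theorem filter_buf {f : ℕ → Option (LEv D)} {ks : List ℕ} {ps : List (D × D)}
    (h : List.Forall₂ (fun k p => f k = some (.st p.1 p.2)) ks ps) (hs : ks.Pairwise (· < ·))
    (a : D) :
    (ps.filter (fun p => decide (p.1 = a)) = [] ∧ ∀ k ∈ ks, ∀ v, f k ≠ some (.st a v)) ∨
    ∃ k ∈ ks, ∃ v β, f k = some (.st a v) ∧
      ps.filter (fun p => decide (p.1 = a)) = β ++ [(a, v)] ∧
      ∀ j ∈ ks, k < j → ∀ v', f j ≠ some (.st a v') := by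
  induction h with
  | nil => simp
  | @cons k p ks ps hk _ ih =>
    rw [List.pairwise_cons] at hs
    rcases ih hs.2 with ⟨h₁, h₂⟩ | ⟨k', hk', v, β, h₁, h₂, h₃⟩
    · by_cases hp : p.1 = a
      · right
        refine ⟨k, by simp, p.2, [], hp ▸ hk, ?_, ?_⟩
        · simp only [List.filter_cons, hp, h₁]
          simp [← hp]
        · intro j hj hkj
          rcases List.mem_cons.1 hj with rfl | hj
          · omega
          · exact h₂ j hj
      · left
        constructor
        · simp [hp, h₁]
        · intro j hj v
          rcases List.mem_cons.1 hj with rfl | hj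
          · rw [hk]; simp [hp]
          · exact h₂ j hj v
    · right
      refine ⟨k', by simp [hk'], v, ?_⟩
      have h₃' : ∀ j ∈ k :: ks, k' < j → ∀ v', f j ≠ some (.st a v') := by
        intro j hj hkj
        rcases List.mem_cons.1 hj with rfl | hj
        · have := hs.1 _ hk'
          omega
        · exact h₃ j hj hkj
      by_cases hp : p.1 = a
      · exact ⟨p :: β, h₁, by simp [hp, h₂], h₃'⟩
      · exact ⟨β, h₁, by simp [hp, h₂], h₃'⟩

theorem Rep.pend_eq_nil_iff (h : Rep P ω s G) (t : T) : G.pend t = [] ↔ s.buf t = [] := by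
  have := (h.buf t).length_eq
  rw [← List.length_eq_zero_iff, this, List.length_eq_zero_iff]

/-- The source `o` of a load is the newest pending store of the thread to the address if there is
one, and otherwise the last executed store. Both choices make the new event a sink. -/
theorem Rep.step_instr (h : Rep P ω s G) (hG : G.Valid P) {t : T} {i : LInstr D R L}
    {b : Act D T} {s' : State D R L T} (hst : InstrStep P t i s b s') :
    ∃ e o, (G.push t e o).Valid P ∧ Rep P (ω ++ [b]) s' (G.push t e o) ∧
      (∀ n, ¬ (G.push t e o).HB (t, (G.ev t).length) n) ∧ b = e.act t true ∧
      ∃ ρ, s' = s.exec t e i.dst ρ := by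
  obtain ⟨e, ρ, hi, hpc, heff, hen, rfl, rfl⟩ := instrStep_iff.1 hst
  have hrun : ∃ pc ρ, LRun P t (G.ev t ++ [e]) pc ρ := by
    have := h.loc t
    rw [hpc] at this
    exact ⟨_, _, .snoc _ _ i e ρ this hi heff⟩
  suffices H : ∃ o : Option (T × ℕ), (∀ m, o = some m → ∃ a v, e = .ld a v ∧
      G.lab m = some (.st a v) ∧
      ((m.2 ∉ G.pend m.1 ∧ ∀ j v', G.lab (t, j) = some (.st a v') → j ∉ G.pend t) ∨
       (m.1 = t ∧ m.2 ∈ G.pend t ∧ ∀ j v', m.2 < j → G.lab (t, j) ≠ some (.st a v')))) ∧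
      (o = none → ∀ a v, e = .ld a v →
        v = 0 ∧ ∀ j v', G.lab (t, j) = some (.st a v') → j ∉ G.pend t) ∧
      ∀ a v, e = .ld a v → (∃ m, o = some m ∧ m.2 ∈ G.pend m.1) ∨ o = (G.stores a).getLast? by
    obtain ⟨o, h₁, h₂, h₃⟩ := H
    refine ⟨e, o, hG.push hrun ?_ h₁ h₂, h.push hG hi hpc heff hen h₃ ?_,
      hG.push_sink ?_ h₃, rfl, ρ, rfl⟩
    · rintro rfl
      exact (h.pend_eq_nil_iff t).2 hen
    · intro he
      by_contra hc
      obtain ⟨m, hm⟩ := Option.ne_none_iff_exists'.1 hc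
      obtain ⟨a, v, h', -⟩ := h₁ m hm
      exact he a v h'
    · intro m hm
      obtain ⟨a, v, -, h', -⟩ := h₁ m hm
      simp [h']
  by_cases he : ∃ a v, e = .ld a v
  · obtain ⟨a, v, rfl⟩ := he
    rcases filter_buf (f := fun k => G.lab (t, k)) (h.buf t) (hG.sorted t) a with
      ⟨h₁, h₂⟩ | ⟨k, hk, w, β, h₁, h₂, h₃⟩
    · have hv : v = s.mem a := by
        rcases hen with ⟨β, hβ⟩ | ⟨-, hv⟩
        · simp [h₁] at hβ
        · exact hv
      have hnp : ∀ j v', G.lab (t, j) = some (.st a v') → j ∉ G.pend t :=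
        fun j v' hj hp => h₂ j hp v' hj
      refine ⟨(G.stores a).getLast?, ?_, ?_, fun b w hb => ?_⟩
      · intro m hm
        refine ⟨a, v, rfl, ?_, .inl ⟨?_, hnp⟩⟩
        · rcases h.mem a with ⟨h', -⟩ | ⟨m', hm', hl⟩
          · simp [h'] at hm
          · obtain rfl : m' = m := by rw [hm'] at hm; simpa using hm
            rw [hv, hl]
        · exact ((hG.mem_stores a m.1 m.2).1 (List.mem_of_getLast? hm)).2
      · intro hn b w hb
        obtain ⟨rfl, rfl⟩ : a = b ∧ v = w := by simpa using hb
        refine ⟨?_, hnp⟩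
        rcases h.mem a with ⟨-, h'⟩ | ⟨m', hm', -⟩
        · rw [hv, h']
        · simp [hm'] at hn
      · obtain ⟨rfl, rfl⟩ : a = b ∧ v = w := by simpa using hb
        exact .inr rfl
    · have hv : v = w := by
        rcases hen with ⟨γ, hγ⟩ | ⟨hγ, -⟩
        · rw [h₂] at hγ
          have := (List.append_inj' hγ rfl).2
          simpa using this.symm
        · simp [h₂] at hγ
      subst hv
      refine ⟨some (t, k), ?_, by simp, fun _ _ _ => .inl ⟨_, rfl, hk⟩⟩
      rintro m hm
      obtain rfl : (t, k) = m := by simpa using hm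
      refine ⟨a, v, rfl, h₁, .inr ⟨rfl, hk, ?_⟩⟩
      intro j v' hkj hj
      -- A later store to `a` is not pending by the choice of `k`, and not executed because of FIFO
      -- order.
      by_cases hjp : j ∈ G.pend t
      · exact h₃ j hjp hkj v' hj
      · have := hG.fifo t j k a v' hk hj hjp
        simp only at hkj
        omega
  · push Not at he
    exact ⟨none, by simp, fun _ a v h => (he a v h).elim, fun a v h => (he a v h).elim⟩

theorem Rep.step (h : Rep P ω s G) (hG : G.Valid P) {b : Act D T} {s' : State D R L T}
    (hst : Step P s b s') :
    ∃ G' : Graph D T, G'.Valid P ∧ Rep P (ω ++ [b]) s' G' ∧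
      ((∃ t e o, G' = G.push t e o ∧ ∀ n, ¬ (G.push t e o).HB (t, (G.ev t).length) n) ∨
        ∃ t p β a v, b = .st t a v ∧ G.pend t = p :: β ∧ G.lab (t, p) = some (.st a v) ∧
          G' = G.flush t p a) := by
  cases hst with
  | instr t i _ _ _ hst =>
    obtain ⟨e, o, h₁, h₂, h₃, -⟩ := h.step_instr hG hst
    exact ⟨_, h₁, h₂, .inl ⟨t, e, o, rfl, h₃⟩⟩
  | flush _ t a v β hb =>
    obtain ⟨p, γ, hp, hl⟩ := h.pend_eq hb
    have := (h.flush hG hp hl).2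
    simp only [State.flush, hb, List.tail_cons] at this
    exact ⟨_, hG.flush hp hl, this, .inr ⟨t, p, γ, a, v, rfl, hp, hl, rfl⟩⟩

theorem Run.exists_rep (h : Run P P.initState ω s) : ∃ G : Graph D T, G.Valid P ∧ Rep P ω s G := by
  induction ω using List.reverseRecOn generalizing s with
  | nil =>
    rw [h.nil_inv]
    exact ⟨_, Graph.valid_empty, Graph.rep_empty⟩
  | append_singleton w b ih =>
    obtain ⟨s', h₁, h₂⟩ := h.append_inv
    obtain ⟨G, hG, hR⟩ := ih h₁
    obtain ⟨s'', hst, h₃⟩ := h₂.cons_inv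
    rw [h₃.nil_inv]
    obtain ⟨G', h₄, h₅, -⟩ := hR.step hG hst
    exact ⟨G', h₄, h₅⟩

/-- The first cycle of the happens-before relation arises when a store is executed. -/
theorem Run.exists_acyclic_or_violation (h : Run P P.initState ω s) :
    (∃ G : Graph D T, G.Valid P ∧ Rep P ω s G ∧ G.Acyclic) ∨
      ∃ (G : Graph D T) (t : T) (p : ℕ) (a : D), G.Violation P t p a := by
  induction ω using List.reverseRecOn generalizing s with
  | nil =>
    rw [h.nil_inv]
    exact .inl ⟨_, Graph.valid_empty, Graph.rep_empty, Graph.acyclic_empty⟩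
  | append_singleton w b ih =>
    obtain ⟨s', h₁, h₂⟩ := h.append_inv
    rcases ih h₁ with ⟨G, hG, hR, hac⟩ | hv
    · obtain ⟨s'', hst, h₃⟩ := h₂.cons_inv
      rw [h₃.nil_inv]
      obtain ⟨G', h₄, h₅, ⟨t, e, o, rfl, hs⟩ | ⟨t, p, β, a, v, -, hp, hl, rfl⟩⟩ := hR.step hG hst
      · exact .inl ⟨_, h₄, h₅, hac.push hs⟩
      · by_cases hf : (G.flush t p a).Acyclic
        · exact .inl ⟨_, h₄, h₅, hf⟩
        · exact .inr ⟨G, t, p, a, hG, hac, ⟨β, hp⟩, ⟨v, hl⟩,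
            hG.path_of_flush_cycle hac (by simp [hp]) hl hf⟩
    · exact .inr hv

/-- The SC state that belongs to a TSO state. -/
def State.toSC (s : State D R L T) : SCState D R L T := ⟨s.pc, s.mem, s.reg⟩

/-- Under SC the store is executed right after its issue, when its node is still a sink; executing
it closes no cycle. -/
theorem Rep.sc_step (h : Rep P ω s G) (hG : G.Valid P) (hac : G.Acyclic)
    (hb : ∀ t, s.buf t = []) {t : T} {i : LInstr D R L} {u : List (Act D T)}
    {σ : SCState D R L T} (hst : SCStep P t i s.toSC u σ) :
    ∃ (s' : State D R L T) (G' : Graph D T), Rep P (ω ++ u) s' G' ∧ G'.Valid P ∧ G'.Acyclic ∧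
      (∀ t, s'.buf t = []) ∧ s'.toSC = σ := by
  have key : ∀ {b : Act D T} {s' : State D R L T}, InstrStep P t i s b s' →
      (∀ t, s'.buf t = []) → ∃ (s'' : State D R L T) (G' : Graph D T), Rep P (ω ++ [b]) s'' G' ∧
        G'.Valid P ∧ G'.Acyclic ∧ (∀ t, s''.buf t = []) ∧ s''.toSC = s'.toSC := by
    intro b s' hst hb'
    obtain ⟨e, o, h₁, h₂, h₃, -⟩ := h.step_instr hG hst
    exact ⟨s', _, h₂, h₁, hac.push h₃, hb', rfl⟩
  cases hst with
  | load r e a v h₁ h₂ h₃ h₄ h₅ =>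
    exact key (.loadMem s r e a v h₁ h₂ h₃ h₄ (by simp [hb]) h₅) hb
  | store e₁ e₂ a v h₁ h₂ h₃ h₄ h₅ =>
    obtain ⟨e, o, hV, hR, hs, he, ρ, hex⟩ :=
      h.step_instr hG (.store s e₁ e₂ a v h₁ h₂ h₃ h₄ h₅)
    have hbt : (s.exec t e i.dst ρ).buf t = (a, v) :: [] := by
      rw [← hex]; simp [hb]
    rw [hex] at hR
    obtain ⟨p, γ, hp, hl⟩ := hR.pend_eq hbt
    obtain ⟨-, hR'⟩ := hR.flush hV hp hl
    -- All buffers were empty, so the new event is the only pending store.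
    have hpt : p = (G.ev t).length := by
      have : p ∈ (G.push t e o).pend t := by simp [hp]
      rw [Graph.mem_pend_push, (h.pend_eq_nil_iff t).2 (hb t)] at this
      simpa using (this.resolve_left (by simp)).2.1
    refine ⟨_, _, by simpa using hR', hV.flush hp hl, ?_, ?_, ?_⟩
    · by_contra hc
      obtain ⟨y, -, hy⟩ := hV.path_of_flush_cycle (hac.push hs) (by simp [hp]) hl hc
      obtain ⟨z, hz, -⟩ := Relation.TransGen.head'_iff.1 hy
      exact hs z (hpt ▸ hz)
    · intro u
      rw [← hex]
      by_cases hu : u = t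
      · subst hu; simp [State.flush, hb]
      · simp [State.flush, hu, hb]
    · rw [← hex]; rfl
  | mfence h₁ h₂ h₃ => exact key (.mfence s h₁ h₂ h₃ (hb t)) hb
  | assign r e h₁ h₂ h₃ => exact key (.assign s r e h₁ h₂ h₃) hb
  | assertion e h₁ h₂ h₃ h₄ => exact key (.assertion s e h₁ h₂ h₃ h₄) hb

theorem SCRun.exists_rep {σ σ' : SCState D R L T} {u : List (Act D T)} (h : SCRun P σ u σ')
    (hR : Rep P ω s G) (hG : G.Valid P) (hac : G.Acyclic) (hb : ∀ t, s.buf t = [])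
    (hs : s.toSC = σ) :
    ∃ (s' : State D R L T) (G' : Graph D T), Rep P (ω ++ u) s' G' ∧ G'.Valid P ∧ G'.Acyclic ∧
      (∀ t, s'.buf t = []) ∧ s'.toSC = σ' := by
  induction h generalizing ω s G with
  | nil => exact ⟨s, G, by simpa using hR, hG, hac, hb, hs⟩
  | cons t i σ₁ σ₂ σ₃ u w hst _ ih =>
    subst hs
    obtain ⟨s', G', h₁, h₂, h₃, h₄, h₅⟩ := hR.sc_step hG hac hb hst
    rw [← List.append_assoc]
    exact ih h₁ h₂ h₃ h₄ h₅

theorem exists_rep_of_sc (h : ω ∈ P.scComputations) :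
    ∃ (s : State D R L T) (G : Graph D T), Rep P ω s G ∧ G.Valid P ∧ G.Acyclic ∧
      ∀ t, s.buf t = [] := by
  obtain ⟨σ, hσ⟩ := h
  obtain ⟨s', G', h₁, h₂, h₃, h₄, -⟩ := hσ.exists_rep Graph.rep_empty Graph.valid_empty
    Graph.acyclic_empty (fun _ => rfl) rfl
  exact ⟨s', G', h₁, h₂, h₃, h₄⟩

theorem sc_subset_tso : P.scComputations ⊆ P.tsoComputations := by
  intro ω h
  obtain ⟨s, G, h₁, -, -, h₂⟩ := exists_rep_of_sc h
  exact ⟨s, h₁.run, h₂⟩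

/-- With empty buffers no source is pending, so trace and graph have the same source relation, and
every edge carries over. -/
theorem Rep.hb_iff (h : Rep P ω s G) (hp : ∀ t, G.pend t = []) {m n : T × ℕ} :
    (traceOf ω).HB m n ↔ G.HB m n := by
  have hsrc : ∀ n, (traceOf ω).source n = G.src n := fun n => h.source n (by simp [hp])
  constructor
  · intro h'
    cases h' with
    | programOrder t j k hjk hk =>
      refine .po t j k hjk ?_
      rw [h.length_events] at hk
      rw [Option.isSome_iff_ne_none, Ne, Graph.lab_eq_none_iff]
      omega
    | storeOrder a _ _ h' => exact .so a _ _ (h.stores ▸ h')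
    | source _ _ h' => exact .src _ _ (hsrc _ ▸ h')
    | conflict t k a v m n h₁ h₂ h₃ =>
      rw [h.events, Graph.acts_getElem?_eq_ld] at h₁
      exact .cf _ a v m _ h₁ (hsrc _ ▸ h₂) (h.stores ▸ h₃)
    | conflictInit t k a v n h₁ h₂ h₃ =>
      rw [h.events, Graph.acts_getElem?_eq_ld] at h₁
      exact .cfi _ a v _ h₁ (hsrc _ ▸ h₂) (h.stores ▸ h₃)
  · intro h'
    cases h' with
    | po t j k hjk hk =>
      refine .programOrder t j k hjk ?_
      rw [h.length_events]
      rw [Option.isSome_iff_ne_none, Ne, Graph.lab_eq_none_iff] at hk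
      omega
    | so a _ _ h' => exact .storeOrder a _ _ (h.stores ▸ h')
    | src _ _ h' => exact .source _ _ ((hsrc _).trans h')
    | cf _ a v m' _ h₁ h₂ h₃ =>
      exact .conflict m.1 m.2 a v m' _ (by rw [h.events, Graph.acts_getElem?_eq_ld]; exact h₁)
        ((hsrc _).trans h₂) (h.stores ▸ h₃)
    | cfi _ a v _ h₁ h₂ h₃ =>
      exact .conflictInit m.1 m.2 a v _ (by rw [h.events, Graph.acts_getElem?_eq_ld]; exact h₁)
        ((hsrc _).trans h₂) (h.stores ▸ h₃)

/-- Happens-before is acyclic in the traces of SC computations. -/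
theorem sc_trace_acyclic (h : ω ∈ P.scComputations) (n : T × ℕ) :
    ¬ Relation.TransGen (traceOf ω).HB n n := by
  obtain ⟨s, G, h₁, -, h₂, h₃⟩ := exists_rep_of_sc h
  intro hc
  exact h₂ n (Relation.TransGen.mono
    (fun _ _ => (h₁.hb_iff fun t => (h₁.pend_eq_nil_iff t).2 (h₃ t)).1) _ _ hc)

end
end TSO

/-! ### Computations without delays, and undoing the last event of a graph -/

namespace TSO

section Tight
variable {D T : Type*} [DecidableEq T]

/-- No store is delayed, not even by other threads. -/
def Tight (ω : List (Act D T)) : Prop :=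
  ∀ t α β γ a v, IssueStorePair ω t α β γ a v → β = []

theorem tight_nil : Tight ([] : List (Act D T)) := by
  intro t α β γ a v h
  have := h.1
  simp at this

theorem IssueStorePair.append_singleton_inv {ω : List (Act D T)} {b : Act D T} {t : T}
    {α β γ : List (Act D T)} {a v : D} (h : IssueStorePair (ω ++ [b]) t α β γ a v) :
    (∃ γ', γ = γ' ++ [b] ∧ IssueStorePair ω t α β γ' a v) ∨
      (γ = [] ∧ b = .st t a v ∧ ω = α ++ .isu t :: β ∧
        issueCount t α = storeCount t (α ++ β)) := by
  obtain ⟨h₁, h₂⟩ := h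
  rcases List.eq_nil_or_concat γ with rfl | ⟨γ', c, rfl⟩
  · right
    have : ω ++ [b] = (α ++ .isu t :: β) ++ [.st t a v] := by simpa using h₁
    obtain ⟨rfl, h⟩ := List.append_inj' this rfl
    exact ⟨rfl, by simpa using h, rfl, h₂⟩
  · left
    have : ω ++ [b] = (α ++ .isu t :: (β ++ .st t a v :: γ')) ++ [c] := by simpa using h₁
    obtain ⟨rfl, h⟩ := List.append_inj' this rfl
    obtain rfl : b = c := by simpa using h
    exact ⟨γ', by simp, rfl, h₂⟩

theorem Tight.append_singleton {ω : List (Act D T)} (h : Tight ω) {b : Act D T}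
    (hb : ∀ t a v, b ≠ .st t a v) : Tight (ω ++ [b]) := by
  intro t α β γ a v h'
  rcases h'.append_singleton_inv with ⟨γ', -, h'⟩ | ⟨-, h', -⟩
  · exact h _ _ _ _ _ _ h'
  · exact (hb _ _ _ h').elim

/-- By `hc` no store of `t` is pending. An earlier issue matched with the new store would be
preceded by at least as many stores as there are issues in `ω`, more than the issues before it. -/
theorem Tight.append_store {ω : List (Act D T)} (h : Tight ω) {t : T}
    (hc : issueCount t ω = storeCount t ω) (a v : D) :
    Tight (ω ++ [.isu t, .st t a v]) := by
  intro u α β γ b w h'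
  have he : ω ++ [.isu t, .st t a v] = (ω ++ [.isu t]) ++ [.st t a v] := by simp
  rw [he] at h'
  rcases h'.append_singleton_inv with ⟨γ', -, h'⟩ | ⟨-, h₁, h₂, h₃⟩
  · exact (h.append_singleton (by simp)) _ _ _ _ _ _ h'
  · obtain ⟨rfl, rfl, rfl⟩ : t = u ∧ a = b ∧ v = w := by simpa using h₁
    rcases List.eq_nil_or_concat β with rfl | ⟨β', c, rfl⟩
    · rfl
    · exfalso
      have : ω ++ [.isu t] = (α ++ .isu t :: β') ++ [c] := by simpa using h₂
      obtain ⟨rfl, hc'⟩ := List.append_inj' this rfl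
      obtain rfl : c = .isu t := by simpa using hc'.symm
      have e₁ : issueCount t [Act.isu t (D := D)] = 1 := by
        simp [issueCount, Act.isIssue, Act.thread]
      have e₂ : storeCount t [Act.isu t (D := D)] = 0 := by
        simp [storeCount, Act.isStore]
      rw [show α ++ Act.isu t :: β' = α ++ ([.isu t] ++ β') by simp] at hc
      simp only [issueCount_append, storeCount_append, List.concat_eq_append, e₁, e₂] at hc h₃
      omega

end Tight

section
variable {D R L T : Type*} [Zero D] [DecidableEq D] [DecidableEq R] [DecidableEq T]
  {P : Program D R L T} {G : Graph D T} {ω : List (Act D T)} {s : State D R L T}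

namespace Graph

theorem ev_dropLast_append {t : T} {k : ℕ} {e : LEv D}
    (hk : (G.ev t).length = k + 1) (he : G.lab (t, k) = some e) :
    (G.ev t).dropLast ++ [e] = G.ev t := by
  apply List.ext_getElem?
  intro j
  have : (G.ev t)[k]? = some e := he
  grind

theorem Valid.push_pop_eq (hG : G.Valid P) {t : T} {k : ℕ} {e : LEv D}
    (hk : (G.ev t).length = k + 1) (he : G.lab (t, k) = some e)
    (hst : ∀ a v, e = .st a v → k ∈ G.pend t) :
    (G.pop t).push t e (G.src (t, k)) = G := by
  have hns : ∀ a, (t, k) ∉ G.stores a := by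
    intro a h
    obtain ⟨⟨v, h₁⟩, h₂⟩ := (hG.mem_stores a t k).1 h
    rw [he] at h₁
    exact h₂ (hst a v (by simpa using h₁))
  have hlen : ((G.pop t).ev t).length = k := by simp [Graph.pop, hk]
  ext1
  · funext u
    by_cases hu : u = t
    · subst hu
      simpa [Graph.push, Graph.pop] using ev_dropLast_append hk he
    · simp [Graph.push, Graph.pop, hu]
  · have hfil : ((∃ a v, e = .st a v) ∧ (G.pend t).filter (fun j => decide (j ≠ k)) ++ [k] = G.pend t) ∨
        (¬ (∃ a v, e = .st a v) ∧ (G.pend t).filter (fun j => decide (j ≠ k)) = G.pend t) := by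
      by_cases hc : ∃ a v, e = .st a v
      · obtain ⟨a, v, rfl⟩ := hc
        refine .inl ⟨⟨a, v, rfl⟩, ?_⟩
        have hm := hst a v rfl
        have hs := hG.sorted t
        have hmax : ∀ j ∈ G.pend t, j ≤ k := fun j hj => by
          have := hG.pend_lt hj
          omega
        generalize G.pend t = l at hm hs hmax
        obtain ⟨l₁, l₂, rfl⟩ := List.append_of_mem hm
        rcases l₂ with _ | ⟨x, l₂⟩
        · rw [List.pairwise_append] at hs
          have : ∀ j ∈ l₁, j ≠ k := fun j hj => (hs.2.2 j hj k (by simp)).ne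
          rw [List.filter_append, List.filter_eq_self.2 (by simpa using this)]
          simp
        · rw [List.pairwise_append, List.pairwise_cons] at hs
          have := hs.2.1.1 x (by simp)
          have := hmax x (by simp)
          omega
      · refine .inr ⟨hc, List.filter_eq_self.2 ?_⟩
        intro j hj
        obtain ⟨a, v, h⟩ := hG.pend_st t j hj
        rw [decide_eq_true_iff]
        rintro rfl
        rw [he] at h
        exact hc ⟨a, v, by simpa using h⟩
    funext u
    by_cases hu : u = t
    · subst hu
      rcases hfil with ⟨⟨a, v, rfl⟩, h⟩ | ⟨h', h⟩
      · simpa [Graph.push, Graph.pop, hk] using h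
      · cases e <;> simp [Graph.push, Graph.pop, hk] at h h' ⊢ <;> exact h
    · cases e <;> simp [Graph.push, Graph.pop, hu]
  · funext a
    rw [push_stores, pop_stores hk, List.filter_eq_self]
    intro n hn
    rw [decide_eq_true_iff]
    rintro rfl
    exact hns a hn
  · change Function.update (G.pop t).src (t, ((G.pop t).ev t).length) _ = _
    rw [hlen, pop_src hk]
    simp

/-- FIFO order leaves no pending store in `t`, since an executed store is its last event. Without
successors, this store is also the last in its store order, where `flush` puts it back. -/
theorem Valid.flush_push_pop_eq (hG : G.Valid P) {t : T} {k : ℕ} {a v : D}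
    (hk : (G.ev t).length = k + 1) (he : G.lab (t, k) = some (.st a v)) (hp : k ∉ G.pend t)
    (hmax : ∀ n, ¬ G.HB (t, k) n) :
    G.pend t = [] ∧ ((G.pop t).push t (.st a v) (G.src (t, k))).flush t k a = G := by
  have hpt : G.pend t = [] := by
    by_contra hc
    obtain ⟨q, hq⟩ := List.exists_mem_of_ne_nil _ hc
    have := hG.fifo t k q a v hq he hp
    have := hG.pend_lt hq
    omega
  refine ⟨hpt, ?_⟩
  have hlen : ((G.pop t).ev t).length = k := by simp [Graph.pop, hk]
  ext1
  · funext u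
    by_cases hu : u = t
    · subst hu
      simpa [Graph.push, Graph.pop] using ev_dropLast_append hk he
    · simp [Graph.push, Graph.pop, hu]
  · funext u
    by_cases hu : u = t
    · subst hu
      simp [Graph.flush, Graph.push, Graph.pop, hpt]
    · simp [Graph.flush, Graph.push, Graph.pop, hu]
  · funext b
    change Function.update (G.pop t).stores a ((G.pop t).stores a ++ [(t, k)]) b = _
    by_cases hb : b = a
    · subst hb
      rw [Function.update_self, pop_stores hk]
      have hm : (t, k) ∈ G.stores b := (hG.mem_stores b t k).2 ⟨⟨v, he⟩, hp⟩
      have hnd := hG.nodup b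
      have hmax' : ∀ n, ¬ [(t, k), n].Sublist (G.stores b) := fun n hn => hmax n (.so b _ _ hn)
      generalize G.stores b = l at hm hnd hmax'
      obtain ⟨l₁, l₂, rfl⟩ := List.append_of_mem hm
      rcases l₂ with _ | ⟨x, l₂⟩
      · rw [List.nodup_append] at hnd
        have : ∀ n ∈ l₁, n ≠ (t, k) := fun n hn => hnd.2.2 n hn _ (by simp)
        rw [List.filter_append, List.filter_eq_self.2 (by simpa using this)]
        simp
      · exfalso
        apply hmax' x
        refine List.Sublist.trans ?_ (List.sublist_append_right l₁ _)
        simp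
    · rw [Function.update_of_ne hb, pop_stores hk, List.filter_eq_self]
      intro n hn
      rw [decide_eq_true_iff]
      rintro rfl
      obtain ⟨w, hw⟩ := hG.lab_of_mem hn
      rw [he] at hw
      simp only [Option.some.injEq, LEv.st.injEq] at hw
      exact hb hw.1.symm
  · change Function.update (G.pop t).src (t, ((G.pop t).ev t).length) _ = _
    rw [hlen, pop_src hk]
    simp

/-- A load without successors can be executed last. -/
theorem Valid.enabled_of_maximal (hG : G.Valid P) {t : T} {k : ℕ} {e : LEv D}
    (hk : (G.ev t).length = k + 1) (he : G.lab (t, k) = some e) (hmax : ∀ n, ¬ G.HB (t, k) n)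
    (hR : Rep P ω s (G.pop t)) : s.Enabled t e ∧ ∀ a v, e = .ld a v →
      (∃ m, G.src (t, k) = some m ∧ m.2 ∈ (G.pop t).pend m.1) ∨
        G.src (t, k) = ((G.pop t).stores a).getLast? := by
  have hpop := hG.pop hk fun n hn => hmax n (.src _ _ hn)
  have hmem : ∀ u j, j ∈ (G.pop t).pend u ↔ j ∈ G.pend u ∧ ¬ (u = t ∧ j = k) := by
    intro u j
    by_cases hu : u = t
    · subst hu
      simp [Graph.pop, hk]
    · simp [Graph.pop, hu]
  cases e with
  | st a v => exact ⟨trivial, by simp⟩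
  | loc => exact ⟨trivial, by simp⟩
  | fence =>
    refine ⟨(hR.pend_eq_nil_iff t).1 ?_, by simp⟩
    by_contra hc
    obtain ⟨q, hq⟩ := List.exists_mem_of_ne_nil _ hc
    rw [hmem] at hq
    have := hG.fence t k q he hq.1
    have := hG.pend_lt hq.1
    omega
  | ld a v =>
    have hst : (G.pop t).stores a = G.stores a := by
      rw [pop_stores hk, List.filter_eq_self]
      intro n hn
      rw [decide_eq_true_iff]
      rintro rfl
      obtain ⟨w, hw⟩ := hG.lab_of_mem hn
      simp [he] at hw
    have hlab : ∀ j, j ∈ (G.pop t).pend t → (G.pop t).lab (t, j) = G.lab (t, j) := by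
      intro j hj
      rw [hmem] at hj
      rw [lab_pop hk, Function.update_of_ne (by simpa using hj.2)]
    have hfb := filter_buf (f := fun j => (G.pop t).lab (t, j)) (hR.buf t) (hpop.sorted t) a
    have hno : (∀ j v', j < k → G.lab (t, j) = some (.st a v') → j ∉ G.pend t) →
        (s.buf t).filter (fun p => decide (p.1 = a)) = [] := by
      intro hno
      rcases hfb with ⟨h, -⟩ | ⟨j, hj, w, β, h₁, -, -⟩
      · exact h
      · rw [hlab j hj] at h₁
        have hj' := (hmem _ _).1 hj
        have := hpop.pend_lt hj
        simp only [Graph.pop, Function.update_self, List.length_dropLast, hk] at this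
        exact (hno j w (by omega) h₁ hj'.1).elim
    rcases hsr : G.src (t, k) with _ | m
    · obtain ⟨h₁, h₂⟩ := hG.src_none t k a v he hsr
      -- Any store to `a` would be a conflict successor of a load of the initial value.
      have hnil : G.stores a = [] := by
        rw [List.eq_nil_iff_forall_not_mem]
        exact fun n hn => hmax n (.cfi _ a v _ he hsr hn)
      refine ⟨.inr ⟨hno h₂, ?_⟩, ?_⟩
      · rcases hR.mem a with ⟨-, h⟩ | ⟨m, hm, -⟩
        · rw [h, h₁]
        · simp [hst, hnil] at hm
      · intro b w hb
        obtain ⟨rfl, rfl⟩ : a = b ∧ v = w := by simpa using hb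
        simp [hst, hnil]
    · obtain ⟨h₁, ⟨h₂, h₃⟩ | ⟨h₂, h₃, h₄, h₅⟩⟩ := hG.src_some t k a v m he hsr
      · have hm : m ∈ G.stores a := (hG.mem_stores a m.1 m.2).2 ⟨⟨v, h₁⟩, h₂⟩
        -- A store after the source in store order would be a conflict successor of the load.
        have hlast : (G.stores a).getLast? = some m := by
          have hne : G.stores a ≠ [] := by rintro h; simp [h] at hm
          rw [List.getLast?_eq_some_getLast hne]
          by_contra hc
          have hsub : [m, (G.stores a).getLast hne].Sublist (G.stores a) := by
            have := List.dropLast_append_getLast hne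
            have hm' : m ∈ (G.stores a).dropLast := by
              rw [← this, List.mem_append] at hm
              refine hm.resolve_right fun h => hc ?_
              rw [List.mem_singleton.1 h]
            have h := sublist_pair_append (x := (G.stores a).getLast hne) hm'
            rwa [this] at h
          exact hmax _ (.cf _ a v m _ he hsr hsub)
        refine ⟨.inr ⟨hno h₃, ?_⟩, ?_⟩
        · rcases hR.mem a with ⟨h, -⟩ | ⟨m', hm', hl⟩
          · rw [hst] at h
            simp [h] at hm
          · rw [hst, hlast] at hm'
            obtain rfl : m = m' := by simpa using hm'
            have hne : m ≠ (t, k) := by rintro rfl; simp [he] at h₁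
            rw [lab_pop hk, Function.update_of_ne hne, h₁] at hl
            simpa using hl
        · intro b w hb
          obtain ⟨rfl, rfl⟩ : a = b ∧ v = w := by simpa using hb
          exact .inr (by rw [hst, hlast])
      · obtain ⟨u, l⟩ := m
        simp only at h₂ h₃ h₄ h₅
        subst h₂
        have hl : l ∈ (G.pop u).pend u := (hmem _ _).2 ⟨h₃, by simp; omega⟩
        refine ⟨.inl ?_, fun _ _ _ => .inl ⟨_, rfl, hl⟩⟩
        -- The newest buffer entry for `a` is the source `l`: an older one is excluded by `h₈`, a
        -- newer one by `h₅`.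
        rcases hfb with ⟨-, h⟩ | ⟨j, hj, w, β, h₆, h₇, h₈⟩
        · exact (h l hl v (by rw [hlab l hl, h₁])).elim
        · rw [hlab j hj] at h₆
          have hjk : j < k := by
            have := hpop.pend_lt hj
            simp only [Graph.pop, Function.update_self, List.length_dropLast, hk] at this
            omega
          rcases lt_trichotomy j l with hjl | rfl | hjl
          · exact (h₈ l hl hjl v (by rw [hlab l hl, h₁])).elim
          · rw [h₁] at h₆
            simp only [Option.some.injEq, LEv.st.injEq, true_and] at h₆
            exact ⟨β, h₆ ▸ h₇⟩
          · exact (h₅ j w hjl hjk h₆).elim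

end Graph

end
end TSO

/-! ### From acyclic event graphs back to computations -/

namespace TSO
section
variable {D R L T : Type*} [Zero D] [DecidableEq D] [DecidableEq R] [DecidableEq T]
  {P : Program D R L T} {G : Graph D T} {ω : List (Act D T)} {s : State D R L T}

/-- With empty buffers, all events but stores are SC transitions. -/
theorem scStep_exec {t : T} {i : LInstr D R L} {e : LEv D} {ρ : R → D}
    (hi : i ∈ (P.thread t).code) (hpc : s.pc t = i.src) (heff : i.instr.Eff (s.reg t) e ρ)
    (hen : s.Enabled t e) (hb : s.buf t = []) (he : ∀ a v, e ≠ .st a v) :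
    SCStep P t i s.toSC [e.act t true] (s.exec t e i.dst ρ).toSC := by
  generalize hin : i.instr = ins at heff
  generalize hr : s.reg t = reg at heff
  have hpc' : s.toSC.pc t = i.src := hpc
  cases heff with
  | load r e ρ v =>
    subst hr
    refine .load s.toSC r e _ v hi hpc' hin rfl ?_
    rcases hen with ⟨β, h⟩ | ⟨-, h⟩
    · simp [hb] at h
    · exact h
  | store e₁ e₂ ρ => exact (he _ _ rfl).elim
  | mfence ρ =>
    have := SCStep.mfence s.toSC hi hpc' hin
    subst hr
    simpa [State.exec, State.toSC, LEv.act] using this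
  | assign r e ρ =>
    subst hr
    exact .assign s.toSC r e hi hpc' hin
  | assertion e ρ h =>
    subst hr
    have := SCStep.assertion s.toSC e hi hpc' hin h
    simpa [State.exec, State.toSC, LEv.act] using this

/-- `w` executes the last event `(t, k)` of `G`, writing a store to memory at once unless it is
pending in `G`. -/
structure Ext (P : Program D R L T) (G : Graph D T) (t : T) (k : ℕ) (ω : List (Act D T))
    (s : State D R L T) (w : List (Act D T)) (s' : State D R L T) : Prop where
  rep : Rep P (ω ++ w) s' G
  tight : Tight ω → Tight (ω ++ w)
  run : Run P s w s'
  thread : ∀ b ∈ w, b.thread = t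
  next : ∀ α b γ, w = α ++ b :: γ → (traceOf (ω ++ α)).next b = (t, k)
  sc : (∀ u, G.pend u = []) → SCRun P s.toSC w s'.toSC
  load : ∀ x v, G.lab (t, k) = some (.ld x v) → w = [.ld t x v]

/-- Several instructions may share a label, so the events do not determine the label a thread has
reached. The labels and registers before the last event are therefore read off from the local run
and fixed before the word `ω` is known; the induction over the graph then provides a word that ends
with exactly these. -/
theorem Graph.Valid.extend (hG : G.Valid P) {t : T} {k : ℕ} (hk : (G.ev t).length = k + 1)
    (hmax : ∀ n, ¬ G.HB (t, k) n) {pc : T → L} {reg : T → R → D}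
    (hloc : ∀ u, LRun P u (G.ev u) (pc u) (reg u)) :
    ∃ (pc' : T → L) (reg' : T → R → D), (∀ u, LRun P u ((G.pop t).ev u) (pc' u) (reg' u)) ∧
      ∀ ω s, Rep P ω s (G.pop t) → s.pc = pc' → s.reg = reg' →
        ∃ w s', Ext P G t k ω s w s' ∧ s'.pc = pc ∧ s'.reg = reg := by
  obtain ⟨e, he⟩ : ∃ e, G.lab (t, k) = some e := by
    rw [← Option.ne_none_iff_exists', Ne, Graph.lab_eq_none_iff]
    omega
  have hev := Graph.ev_dropLast_append hk he
  have hpop := hG.pop hk fun n hn => hmax n (.src _ _ hn)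
  have ht := hloc t
  rw [← hev] at ht
  obtain ⟨ρ, i, h₁, h₂, h₃, h₄⟩ := ht.snoc_inv
  refine ⟨Function.update pc t i.src, Function.update reg t ρ, ?_, ?_⟩
  · intro u
    by_cases hu : u = t
    · subst hu; simpa [Graph.pop] using h₁
    · simpa [Graph.pop, hu] using hloc u
  intro ω s hR hpc hreg
  obtain ⟨hen, hld⟩ := hG.enabled_of_maximal hk he hmax hR
  have hpct : s.pc t = i.src := by simp [hpc]
  have hregt : s.reg t = ρ := by simp [hreg]
  rw [← hregt] at h₃
  have hsrc : (∀ a v, e ≠ .ld a v) → G.src (t, k) = none := by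
    intro hne
    by_contra hc
    obtain ⟨m, hm⟩ := Option.ne_none_iff_exists'.1 hc
    obtain ⟨a, v, h⟩ := hG.src_load _ _ hm
    rw [he] at h
    exact hne a v (by simpa using h)
  have hpush := hR.push hpop h₂ hpct h₃ hen hld hsrc
  have hlen : ((G.pop t).ev t).length = k := by simp [Graph.pop, hk]
  have hnext := hR.next_act t e
  rw [hlen] at hnext
  have hst : Step P s (e.act t true) (s.exec t e i.dst (reg t)) :=
    .instr t i _ _ _ (instrStep_iff.2 ⟨e, _, h₂, hpct, h₃, hen, rfl, rfl⟩)
  have hpc' : (s.exec t e i.dst (reg t)).pc = pc := by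
    simp [State.exec, hpc, ← h₄]
  have hreg' : (s.exec t e i.dst (reg t)).reg = reg := by
    simp [State.exec, hreg]
  -- A store that is executed in `G` needs two actions, issue and store in direct succession; any
  -- other event needs one.
  by_cases hf : ∃ a v, e = .st a v ∧ k ∉ G.pend t
  · obtain ⟨a, v, rfl, hkp⟩ := hf
    obtain ⟨hpt, hfl⟩ := hG.flush_push_pop_eq hk he hkp hmax
    have hbt : s.buf t = [] := (hR.pend_eq_nil_iff t).1 (by simp [Graph.pop, hpt])
    have hV : ((G.pop t).push t (.st a v) (G.src (t, k))).Valid P := by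
      refine hpop.push ⟨_, _, .snoc _ _ i _ _ (hpct ▸ hR.loc t) h₂ h₃⟩ (by simp) ?_ (by simp)
      rw [hsrc (by simp)]
      simp
    have hp : ((G.pop t).push t (.st a v) (G.src (t, k))).pend t = [k] := by
      simp [Graph.push, hlen]
      simp [Graph.pop, hpt]
    have hl : ((G.pop t).push t (.st a v) (G.src (t, k))).lab (t, k) = some (.st a v) := by
      rw [Graph.lab_push, hlen, Function.update_self]
    obtain ⟨hst', hR'⟩ := hpush.flush hV hp hl
    rw [hfl] at hR'
    refine ⟨[.isu t, .st t a v], (s.exec t (.st a v) i.dst (reg t)).flush t a v,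
      ⟨by simpa [LEv.act] using hR', fun h => ?_, ?_, ?_, ?_, ?_, ?_⟩,
      hpc', hreg'⟩
    · refine h.append_store ?_ a v
      have := hR.cnt t
      simpa [hbt] using this
    · exact .cons _ _ _ _ _ hst (.single hst')
    · simp [Act.thread]
    · intro α b γ hw
      rcases α with _ | ⟨b', _ | ⟨b'', α⟩⟩
      · obtain ⟨rfl, -⟩ : .isu t = b ∧ _ := by simpa using hw
        simpa [LEv.act] using hnext
      · obtain ⟨rfl, rfl, -⟩ : .isu t = b' ∧ .st t a v = b ∧ _ := by simpa using hw
        exact hpush.next_st hV hp a v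
      · simp at hw
    · intro hpe
      obtain ⟨ins, hins⟩ : ∃ ins, i.instr = ins := ⟨_, rfl⟩
      generalize hr : s.reg t = r at h₃
      generalize hr' : reg t = r' at h₃
      generalize hee : LEv.st a v = ee at h₃
      rw [hins] at h₃
      cases h₃ with
      | store e₁ e₂ _ =>
        simp only [LEv.st.injEq] at hee
        subst hr
        have h := SCRun.single (SCStep.store s.toSC e₁ e₂ a v h₂ hpct hins hee.1 hee.2)
        simpa [State.exec, State.flush, State.toSC] using h
      | _ => simp at hee
    · intro x w hx
      rw [he] at hx
      simp at hx
  · have hpe : ∀ a v, e = .st a v → k ∈ G.pend t := by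
      intro a v h
      by_contra hc
      exact hf ⟨a, v, h, hc⟩
    rw [hG.push_pop_eq hk he hpe] at hpush
    refine ⟨[e.act t true], _, ⟨hpush, fun h => h.append_singleton ?_, .single hst, ?_, ?_, ?_, ?_⟩,
      hpc', hreg'⟩
    · intro u a v
      cases e <;> simp [LEv.act]
    · simp
    · intro α b γ hw
      rcases α with _ | ⟨b', α⟩
      · obtain ⟨rfl, -⟩ : e.act t true = b ∧ _ := by simpa using hw
        simpa using hnext
      · simp at hw
    · intro hpe'
      refine .single (scStep_exec h₂ hpct h₃ hen ((hR.pend_eq_nil_iff t).1 ?_) ?_)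
      · simp [Graph.pop, hpe']
      · rintro a v rfl
        have := hpe a v rfl
        simp [hpe'] at this
    · intro x v hx
      rw [he] at hx
      obtain rfl : e = .ld x v := by simpa using hx
      rfl

/-- An acyclic event graph is executed by a computation that only delays the stores which are pending
at the end. -/
theorem Graph.Valid.exists_tight [Fintype T] (hG : G.Valid P) (hac : G.Acyclic) {pc : T → L}
    {reg : T → R → D} (hloc : ∀ u, LRun P u (G.ev u) (pc u) (reg u)) :
    ∃ ω s, Rep P ω s G ∧ s.pc = pc ∧ s.reg = reg ∧ Tight ω ∧
      ((∀ u, G.pend u = []) → SCRun P P.initSCState ω s.toSC) := by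
  induction hN : G.size using Nat.strong_induction_on generalizing G pc reg with
  | _ N ih =>
  by_cases hem : ∀ u, G.ev u = []
  · have hlab : ∀ n, G.lab n = none := fun n => by simp [Graph.lab, hem]
    have hGe : G = Graph.empty D T := by
      ext1
      · funext u; exact hem u
      · funext u
        refine List.eq_nil_iff_forall_not_mem.2 fun k hk => ?_
        have := hG.pend_lt hk
        simp [hem] at this
      · funext a
        refine List.eq_nil_iff_forall_not_mem.2 fun n hn => ?_
        obtain ⟨v, h⟩ := hG.lab_of_mem hn
        simp [hlab] at h
      · funext n
        by_contra hc
        obtain ⟨m, hm⟩ := Option.ne_none_iff_exists'.1 hc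
        obtain ⟨a, v, h⟩ := hG.src_load _ _ hm
        simp [hlab] at h
    have hinit : ∀ u, pc u = (P.thread u).entry ∧ reg u = fun _ => 0 := by
      intro u
      have := hloc u
      rw [hem] at this
      generalize hl : ([] : List (LEv D)) = l at this
      generalize hp : pc u = p at this
      generalize hr : reg u = r at this
      cases this with
      | nil => exact ⟨rfl, rfl⟩
      | snoc => simp at hl
    refine ⟨[], P.initState, hGe ▸ Graph.rep_empty, ?_, ?_, tight_nil, fun _ => .nil _⟩
    · funext u; exact (hinit u).1.symm
    · funext u; exact (hinit u).2.symm
  · push Not at hem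
    obtain ⟨u, hu⟩ := hem
    -- A maximal node is the last event of its thread by program order. It is removed and executed
    -- after everything else.
    obtain ⟨⟨t, k⟩, hn, hmax⟩ := hac.exists_maximal {n | (G.lab n).isSome}
      ⟨(u, 0), by
        have := List.length_pos_iff.2 hu
        simp [Graph.lab, this]⟩ fun _ h => h
    have hmax' : ∀ n, ¬ G.HB (t, k) n := fun n hn => hmax n hn (hG.isSome_of_hb hn).2
    have hk := Graph.length_of_maximal hn fun h => hmax' _ (.po t k (k + 1) (by omega) h)
    obtain ⟨pc', reg', hloc', hext⟩ := hG.extend hk hmax' hloc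
    obtain ⟨ω, s, hR, h₁, h₂, h₃, h₄⟩ := ih _ (hN ▸ Graph.size_pop_lt hk)
      (hG.pop hk fun n hn => hmax' n (.src _ _ hn)) (hac.pop hk) hloc' rfl
    obtain ⟨w, s', hE, h₅, h₆⟩ := hext ω s hR h₁ h₂
    refine ⟨ω ++ w, s', hE.rep, h₅, h₆, hE.tight h₃, fun hp => (h₄ fun v => ?_).append (hE.sc hp)⟩
    by_cases hv : v = t
    · subst hv; simp [Graph.pop, hp]
    · simp [Graph.pop, hv, hp]

/-- If no violation exists, all TSO traces are SC traces. -/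
theorem robust_of_no_violation [Fintype T]
    (h : ∀ (G : Graph D T) (t : T) (p : ℕ) (a : D), ¬ G.Violation P t p a) : P.Robust := by
  apply Set.Subset.antisymm
  · rintro _ ⟨τ, ⟨s, hrun, hb⟩, rfl⟩
    rcases hrun.exists_acyclic_or_violation with ⟨G, hG, hR, hac⟩ | ⟨G, t, p, a, hv⟩
    · have hp : ∀ t, G.pend t = [] := fun t => (hR.pend_eq_nil_iff t).2 (hb t)
      -- Both words represent the same graph without pending stores, which determines the trace.
      obtain ⟨ω, s', hR', -, -, -, hsc⟩ := hG.exists_tight hac hR.loc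
      refine ⟨ω, ⟨_, hsc hp⟩, ?_⟩
      ext1
      · rw [hR.events, hR'.events]
      · rw [hR.stores, hR'.stores]
      · funext n
        rw [hR.source n (by simp [hp]), hR'.source n (by simp [hp])]
    · exact (h G t p a hv).elim
  · exact Set.image_mono sc_subset_tso

end
end TSO

/-! ### Robustness is the absence of feasible attacks -/

namespace TSO
section
variable {D T : Type*} [DecidableEq T]

theorem List.exists_split_of_lt_countP {α : Type*} (q : α → Bool) {n : ℕ} {l : List α}
    (h : n < l.countP q) : ∃ l₁ b l₂, l = l₁ ++ b :: l₂ ∧ q b = true ∧ l₁.countP q = n := by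
  induction l generalizing n with
  | nil => simp at h
  | cons c l ih =>
    by_cases hc : q c = true
    · cases n with
      | zero => exact ⟨[], c, l, rfl, hc, rfl⟩
      | succ n =>
        rw [List.countP_cons_of_pos hc] at h
        obtain ⟨l₁, b, l₂, rfl, h₂, h₃⟩ := ih (n := n) (by omega)
        exact ⟨c :: l₁, b, l₂, rfl, h₂, by rw [List.countP_cons_of_pos hc, h₃]⟩
    · rw [List.countP_cons_of_neg hc] at h
      obtain ⟨l₁, b, l₂, rfl, h₂, h₃⟩ := ih h
      exact ⟨c :: l₁, b, l₂, rfl, h₂, by rw [List.countP_cons_of_neg hc, h₃]⟩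

theorem exists_issue_of_lt {t : T} {n : ℕ} {ω : List (Act D T)} (h : n < issueCount t ω) :
    ∃ τ₁ τ₂, ω = τ₁ ++ .isu t :: τ₂ ∧ issueCount t τ₁ = n := by
  obtain ⟨l₁, b, l₂, rfl, h₂, h₃⟩ := List.exists_split_of_lt_countP _ h
  cases b <;> simp [Act.isIssue, Act.thread] at h₂
  obtain rfl := of_decide_eq_true h₂
  exact ⟨l₁, l₂, rfl, h₃⟩

theorem issueCount_eq_zero {t : T} {w : List (Act D T)} (h : ∀ b ∈ w, b.thread ≠ t) :
    issueCount t w = 0 := by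
  simp only [issueCount, List.countP_eq_zero]
  intro b hb
  simp [h b hb]

theorem storeCount_eq_zero {t : T} {w : List (Act D T)} (h : ∀ b ∈ w, b.thread ≠ t) :
    storeCount t w = 0 := by
  simp only [storeCount, List.countP_eq_zero]
  intro b hb
  simp [h b hb]

@[simp] theorem issueCount_cons_isu (t : T) (w : List (Act D T)) :
    issueCount t (.isu t :: w) = issueCount t w + 1 := by
  simp [issueCount, Act.isIssue, Act.thread]

@[simp] theorem issueCount_cons_ld (t u : T) (a v : D) (w : List (Act D T)) :
    issueCount t (.ld u a v :: w) = issueCount t w := by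
  simp [issueCount, Act.isIssue, Act.thread]

@[simp] theorem storeCount_cons_isu (t u : T) (w : List (Act D T)) :
    storeCount t (.isu u :: w) = storeCount t w := by
  simp [storeCount, Act.isStore, Act.thread]

@[simp] theorem storeCount_cons_ld (t u : T) (a v : D) (w : List (Act D T)) :
    storeCount t (.ld u a v :: w) = storeCount t w := by
  simp [storeCount, Act.isStore, Act.thread]

/-- This confines a pair to the prefix `ω` once its store is known not to lie in `w`. -/
theorem IssueStorePair.of_append {ω w : List (Act D T)} {u : T} {α β γ : List (Act D T)} {a v : D}
    (h : IssueStorePair (ω ++ w) u α β γ a v)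
    (hw : ∀ w₁ w₂, w = w₁ ++ .st u a v :: w₂ → ω ++ w₁ = α ++ .isu u :: β →
      issueCount u α = storeCount u (α ++ β) → False) :
    ∃ γ', IssueStorePair ω u α β γ' a v := by
  induction w using List.reverseRecOn generalizing γ with
  | nil => exact ⟨γ, by simpa using h⟩
  | append_singleton w b ih =>
    rw [← List.append_assoc] at h
    rcases h.append_singleton_inv with ⟨γ', -, h⟩ | ⟨-, rfl, h₁, h₂⟩
    · refine ih h fun w₁ w₂ h₁ => hw w₁ (w₂ ++ [b]) (by simp [h₁])
    · exact (hw w [] rfl h₁ h₂).elim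

end

section
open Relation
variable {D R L T : Type*} [Zero D] [DecidableEq D] [DecidableEq R] [DecidableEq T]
  {P : Program D R L T} {G : Graph D T} {ω : List (Act D T)} {s : State D R L T}

/-- Emptying the buffer of a thread. -/
theorem Rep.flush_all (hR : Rep P ω s G) (hG : G.Valid P) (t : T) :
    ∃ (s' : State D R L T) (G' : Graph D T),
      Rep P (ω ++ (s.buf t).map fun p => .st t p.1 p.2) s' G' ∧
      Run P s ((s.buf t).map fun p => .st t p.1 p.2) s' ∧ s'.buf t = [] ∧
      (∀ u, u ≠ t → s'.buf u = s.buf u) ∧ ∀ m n, G.HB m n → G'.HB m n := by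
  generalize hb : s.buf t = bf
  induction bf generalizing ω s G with
  | nil => exact ⟨s, G, by simpa using hR, .nil _, hb, fun _ _ => rfl, fun _ _ h => h⟩
  | cons p bf ih =>
    obtain ⟨a, v⟩ := p
    obtain ⟨p, γ, hp, hl⟩ := hR.pend_eq hb
    obtain ⟨hst, hR'⟩ := hR.flush hG hp hl
    obtain ⟨s', G', h₁, h₂, h₃, h₄, h₅⟩ := ih hR' (hG.flush hp hl) (by simp [State.flush, hb])
    refine ⟨s', G', by simpa using h₁, .cons _ _ _ _ _ hst h₂, h₃, fun u hu => ?_,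
      fun m n h => h₅ _ _ (h.flush _ _ _)⟩
    rw [h₄ u hu]
    simp [State.flush, hu]

/-- An acyclic event graph is executed by a computation in which the last event `ld` of `t` is only
followed by events of other threads that depend on it. -/
theorem Graph.Valid.exists_peeled [Fintype T] (hG : G.Valid P) (hac : G.Acyclic) {t : T} {K : ℕ}
    {x v : D} (hK : (G.ev t).length = K + 1) (hl : G.lab (t, K) = some (.ld x v)) {pc : T → L}
    {reg : T → R → D} (hloc : ∀ u, LRun P u (G.ev u) (pc u) (reg u)) :
    ∃ ω₀ s₀ s₁ τ₃ s, Run P P.initState ω₀ s₀ ∧ Run P s₀ [.ld t x v] s₁ ∧ Run P s₁ τ₃ s ∧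
      Rep P (ω₀ ++ .ld t x v :: τ₃) s G ∧ s.pc = pc ∧ s.reg = reg ∧
      Tight (ω₀ ++ .ld t x v :: τ₃) ∧ (∀ b ∈ τ₃, b.thread ≠ t) ∧
      (traceOf ω₀).next (.ld t x v) = (t, K) ∧
      ∀ α b γ, τ₃ = α ++ b :: γ →
        TransGen G.HB (t, K) ((traceOf (ω₀ ++ .ld t x v :: α)).next b) := by
  induction hN : G.size using Nat.strong_induction_on generalizing G pc reg with
  | _ N ih =>
  -- A maximal successor of `(t, K)` is maximal in the whole graph, so it can be executed last. When
  -- no successor is left, `(t, K)` is itself maximal and all remaining events are executed before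
  -- it.
  by_cases hS : ∃ n, TransGen G.HB (t, K) n
  · obtain ⟨⟨u, k⟩, hn, hmax⟩ := hac.exists_maximal {n | TransGen G.HB (t, K) n} hS
      fun n hn => (hG.isSome_of_transGen hn).2
    have hmax' : ∀ n, ¬ G.HB (u, k) n := fun n h => hmax n h (TransGen.tail hn h)
    have hsome := (hG.isSome_of_transGen hn).2
    have hk := Graph.length_of_maximal hsome fun h => hmax' _ (.po u k (k + 1) (by omega) h)
    -- In `t` the only event without a program order successor is `(t, K)`, which would then lie on
    -- a cycle.
    have hut : u ≠ t := by
      rintro rfl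
      obtain rfl : k = K := by omega
      exact hac _ hn
    obtain ⟨pc', reg', hloc', hext⟩ := hG.extend hk hmax' hloc
    obtain ⟨ω₀, s₀, s₁, τ₃, s, h₁, h₂, h₃, h₄, h₅, h₆, h₇, h₈, h₉, h₁₀⟩ :=
      ih _ (hN ▸ Graph.size_pop_lt hk) (hG.pop hk fun n hn => hmax' n (.src _ _ hn)) (hac.pop hk)
        (by simpa [Graph.pop, hut.symm] using hK)
        (by rw [Graph.lab_pop hk, Function.update_of_ne (by simp [hut.symm]), hl]) hloc' rfl
    obtain ⟨w, s', hE, h₁₁, h₁₂⟩ := hext _ s h₄ h₅ h₆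
    refine ⟨ω₀, s₀, s₁, τ₃ ++ w, s', h₁, h₂, h₃.append hE.run, by simpa using hE.rep, h₁₁, h₁₂,
      by simpa using hE.tight h₇, ?_, h₉, ?_⟩
    · intro b hb
      rcases List.mem_append.1 hb with hb | hb
      · exact h₈ b hb
      · rw [hE.thread b hb]; exact hut
    · intro α b γ hw
      -- The action `b` belongs either to the newly appended `w`, whose node is the removed
      -- successor, or to the old `τ₃`, whose paths exist already in the smaller graph.
      rcases List.append_eq_append_iff.1 hw with ⟨α', rfl, hw'⟩ | ⟨bs, h, hw'⟩
      · have := hE.next α' b γ hw'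
        rw [show ω₀ ++ Act.ld t x v :: (τ₃ ++ α') = ω₀ ++ Act.ld t x v :: τ₃ ++ α' by simp, this]
        exact hn
      · rcases bs with _ | ⟨b', bs⟩
        · obtain rfl : τ₃ = α := by simpa using h
          have := hE.next [] b γ (by simpa using hw'.symm)
          rw [List.append_nil] at this
          rw [this]
          exact hn
        · obtain ⟨rfl, -⟩ : b = b' ∧ _ := by simpa using hw'
          exact TransGen.mono (fun _ _ => Graph.hb_of_hb_pop hk) _ _ (h₁₀ α b bs h)
  · have hmax' : ∀ n, ¬ G.HB (t, K) n := fun n h => hS ⟨n, .single h⟩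
    obtain ⟨pc', reg', hloc', hext⟩ := hG.extend hK hmax' hloc
    obtain ⟨ω₀, s₀, hR, h₁, h₂, h₃, -⟩ :=
      (hG.pop hK fun n hn => hmax' n (.src _ _ hn)).exists_tight (hac.pop hK) hloc'
    obtain ⟨w, s, hE, h₄, h₅⟩ := hext _ _ hR h₁ h₂
    obtain rfl := hE.load x v hl
    refine ⟨ω₀, s₀, s, [], s, hR.run, hE.run, .nil _, hE.rep, h₄, h₅, hE.tight h₃, by simp, ?_, ?_⟩
    · simpa using hE.next [] _ [] rfl
    · intro α b γ h
      simp at h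

theorem Step.exists_instrStep {s' : State D R L T} {t : T} {b : Act D T} (h : Step P s b s')
    (hb : b.isStore = false) (ht : b.thread = t) : ∃ i, InstrStep P t i s b s' := by
  cases h with
  | instr u i _ _ _ h =>
    obtain ⟨e, ρ, -, -, -, -, rfl, -⟩ := instrStep_iff.1 h
    rw [LEv.act_thread] at ht
    exact ⟨i, ht ▸ h⟩
  | flush => simp [Act.isStore] at hb

theorem InstrStep.mem_code {t : T} {i : LInstr D R L} {b : Act D T} {s' : State D R L T}
    (h : InstrStep P t i s b s') : i ∈ (P.thread t).code := by
  cases h <;> assumption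

theorem InstrStep.exists_store {t : T} {i : LInstr D R L} {s' : State D R L T}
    (h : InstrStep P t i s (.isu t) s') : ∃ e₁ e₂, i.instr = .store e₁ e₂ := by
  cases h
  exact ⟨_, _, by assumption⟩

theorem InstrStep.exists_load {t : T} {i : LInstr D R L} {a v : D} {s' : State D R L T}
    (h : InstrStep P t i s (.ld t a v) s') : ∃ r e, i.instr = .load r e := by
  cases h <;> exact ⟨_, _, by assumption⟩

/-- The peeled computation of the graph provides `τ₁ · isu · τ₂ · ld · τ₃`. It delays only the
stores that are pending at the end, all of them stores of `t`; emptying the buffer appends `st · τ₄`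
and closes the cycle through `ld`. -/
theorem Graph.AttackGraph.exists_feasible [Fintype T] {t : T} {p K : ℕ} {a x v : D}
    (h : G.AttackGraph P t p K a x v) : ∃ A, P.Feasible A := by
  obtain ⟨hG, hac, ⟨β, hβ⟩, hpend, ⟨w, hw⟩, hK, hl, hne, ⟨y, hy, hpath⟩, hpK⟩ := h
  choose pc reg hloc using hG.run
  obtain ⟨ω₀, s₀, s₁, τ₃, s, hr₁, hr₂, hr₃, hR, -, -, htight, hτ₃, hnext, hnexts⟩ :=
    hG.exists_peeled hac hK hl hloc
  have hbuf := hR.buf_eq hβ hw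
  have hcnt := hR.cnt t
  simp only [issueCount_append, storeCount_append, issueCount_cons_ld, storeCount_cons_ld,
    issueCount_eq_zero hτ₃, storeCount_eq_zero hτ₃] at hcnt
  have hpos : 0 < (s.buf t).length := by rw [hbuf]; simp
  -- By FIFO order, the issue of the oldest pending store is preceded by as many issues of `t` as
  -- stores of `t` have been executed; `ld · τ₃` contains none.
  obtain ⟨τ₁, τ₂, rfl, hτ₁⟩ := exists_issue_of_lt (t := t) (n := storeCount t ω₀) (ω := ω₀)
    (by omega)
  obtain ⟨σ₁, hs₁, hr₁'⟩ := hr₁.append_inv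
  obtain ⟨σ₂, hs₂, hs₃⟩ := hr₁'.cons_inv
  obtain ⟨i, hi⟩ := hs₂.exists_instrStep rfl rfl
  obtain ⟨σ₄, hs₄, hs₅⟩ := hr₂.cons_inv
  obtain ⟨j, hj⟩ := hs₄.exists_instrStep rfl rfl
  obtain rfl := hs₅.nil_inv
  obtain ⟨hst, hR₁⟩ := hR.flush hG hβ hw
  obtain ⟨s₂, G₂, hR₂, hrun₂, hb₂, hb₂', hHB⟩ := hR₁.flush_all (hG.flush hβ hw) t
  have hb₁ : (s.flush t a w).buf t = (s.buf t).tail := by simp [State.flush]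
  rw [hb₁] at hR₂ hrun₂
  have hb : ∀ u, s₂.buf u = [] := by
    intro u
    by_cases hu : u = t
    · rw [hu, hb₂]
    · rw [hb₂' u hu]
      simpa [State.flush, hu] using (hR.pend_eq_nil_iff u).1 (hpend u hu)
  generalize hτ₄ : (s.buf t).tail.map (fun p => Act.st t p.1 p.2) = τ₄ at hR₂ hrun₂
  have hτ₄' : Act.st t a w :: τ₄ = (s.buf t).map (fun p => Act.st t p.1 p.2) := by
    rw [hbuf, ← hτ₄]; simp
  have hword : τ₁ ++ Act.isu t :: τ₂ ++ Act.ld t x v :: τ₃ ++ [Act.st t a w] ++ τ₄ =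
      τ₁ ++ .isu t :: (τ₂ ++ .ld t x v :: (τ₃ ++ .st t a w :: τ₄)) := by simp
  rw [hword] at hR₂
  have hmono : ∀ m n, G.HB m n →
      (traceOf (τ₁ ++ .isu t :: (τ₂ ++ .ld t x v :: (τ₃ ++ .st t a w :: τ₄)))).HB m n :=
    fun m n h => (hR₂.hb_iff fun u => (hR₂.pend_eq_nil_iff u).2 (hb u)).2
      (hHB _ _ (h.flush _ _ _))
  -- The load reaches an access `y` to the address of `st`, and executing `st` adds the edge from
  -- `y` to `(t, p)`.
  have hcyc : TransGen (traceOf (τ₁ ++ .isu t :: (τ₂ ++ .ld t x v :: (τ₃ ++ .st t a w :: τ₄)))).HB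
      (t, K) (t, p) := by
    refine TransGen.tail' (ReflTransGen.mono hmono _ _ hpath) ?_
    exact (hR₂.hb_iff fun u => (hR₂.pend_eq_nil_iff u).2 (hb u)).2 (hHB _ _ (hy.hb_flush t p))
  have hst₄ : ∀ u b d w₁ w₂, Act.st t a w :: τ₄ = w₁ ++ .st u b d :: w₂ → u = t := by
    intro u b d w₁ w₂ h
    have : Act.st u b d ∈ Act.st t a w :: τ₄ := by rw [h]; simp
    rw [hτ₄', List.mem_map] at this
    obtain ⟨q, -, hq⟩ := this
    simp only [Act.st.injEq] at hq
    exact hq.1.symm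
  have hassoc : τ₁ ++ Act.isu t :: (τ₂ ++ Act.ld t x v :: (τ₃ ++ Act.st t a w :: τ₄)) =
      (τ₁ ++ Act.isu t :: τ₂ ++ Act.ld t x v :: τ₃) ++ Act.st t a w :: τ₄ := by simp
  refine ⟨⟨t, i, j⟩, ⟨⟨hi.mem_code, hi.exists_store⟩, hj.mem_code, hj.exists_load⟩,
    τ₁, τ₂, τ₃, τ₄, x, v, a, w, _, ⟨rfl, ?_, ?_, ?_, ?_, hτ₃, ?_, ?_, ?_⟩⟩
  · exact ⟨σ₁, σ₂, s₀, _, s₂, hs₁, hi, hs₃, hj, hr₃.append (.cons _ _ _ _ _ hst hrun₂), hb⟩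
  · intro u hu α β γ b d hpair c hc
    simp only [hassoc] at hpair
    -- All stores in `st · τ₄` belong to `t`, so the pair lies in the tight prefix.
    obtain ⟨γ', hpair'⟩ := hpair.of_append fun w₁ w₂ h => (hu (hst₄ _ _ _ _ _ h)).elim
    rw [htight _ _ _ _ _ _ hpair'] at hc
    simp at hc
  · refine ⟨by simp, ?_⟩
    simp only [storeCount_append, storeCount_cons_isu, storeCount_cons_ld,
      storeCount_eq_zero hτ₃] at hτ₁ ⊢
    omega
  · intro α β γ b d hpair hlen c hc
    simp only [hassoc] at hpair
    -- If the store lay in `st · τ₄`, its issue would be preceded by at least as many issues as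
    -- there are stores before `st`, that is, as issues in `τ₁`; but the issue itself lies in `τ₁`.
    obtain ⟨γ', hpair'⟩ := hpair.of_append fun w₁ w₂ _ h₂ h₃ => by
      have h₄ : storeCount t (τ₁ ++ Act.isu t :: τ₂ ++ Act.ld t x v :: τ₃ ++ w₁) =
          storeCount t (α ++ β) := by
        rw [h₂]; simp [storeCount_append]
      simp only [storeCount_append, storeCount_cons_isu, storeCount_cons_ld] at hτ₁ h₃ h₄
      have h₅ : ∃ δ, τ₁ = α ++ .isu t :: δ := by
        have h₂' : τ₁ ++ (Act.isu t :: τ₂ ++ Act.ld t x v :: τ₃ ++ w₁) = α ++ Act.isu t :: β := by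
          simpa using h₂
        rcases List.append_eq_append_iff.1 h₂' with ⟨δ, rfl, -⟩ | ⟨δ, rfl, h⟩
        · simp at hlen
        · rcases δ with _ | ⟨c', δ⟩
          · simp at hlen
          · obtain ⟨rfl, -⟩ : Act.isu t = c' ∧ _ := by simpa using h
            exact ⟨δ, rfl⟩
      obtain ⟨δ, rfl⟩ := h₅
      simp only [issueCount_append, issueCount_cons_isu, storeCount_append,
        storeCount_cons_isu] at hτ₁ h₄
      omega
    rw [htight _ _ _ _ _ _ hpair'] at hc
    simp at hc
  · intro α b γ h
    rw [hnext]
    rcases α with _ | ⟨b', α⟩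
    · obtain ⟨rfl, -⟩ : Act.ld t x v = b ∧ _ := by simpa using h
      rw [List.append_nil, hnext]
      -- For `b = ld` the path goes once around the cycle, returning from `st` by program order.
      refine hcyc.tail (hmono _ _ (.po t p K hpK ?_))
      simp [hl]
    · obtain ⟨rfl, h'⟩ : Act.ld t x v = b' ∧ τ₃ ++ [Act.st t a w] = α ++ b :: γ := by
        simpa using h
      rcases List.eq_nil_or_concat γ with rfl | ⟨γ', c, rfl⟩
      · obtain ⟨rfl, h⟩ := List.append_inj' h' rfl
        obtain rfl : Act.st t a w = b := by simpa using h
        have := hR.next_st hG hβ a w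
        simp only [List.append_assoc, List.cons_append] at this
        rwa [this]
      · have h' : τ₃ ++ [Act.st t a w] = (α ++ b :: γ') ++ [c] := by simpa using h'
        obtain ⟨h'', -⟩ := List.append_inj' h' rfl
        have := hnexts α b γ' h''
        simp only [List.append_assoc, List.cons_append] at this
        exact TransGen.mono hmono _ _ this
  · intro b hb'
    rw [← hτ₄, List.mem_map] at hb'
    obtain ⟨q, -, rfl⟩ := hb'
    exact ⟨_, _, rfl⟩
  · intro b d hbd hbx
    simp only at hbd
    rw [hτ₄', List.mem_map] at hbd
    obtain ⟨q, hq, hq'⟩ := hbd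
    simp only [Act.st.injEq, true_and] at hq'
    obtain ⟨n, hn, hn'⟩ := List.mem_iff_getElem.1 hq
    have hfa := List.forall₂_iff_get.1 (hR.buf t)
    have hlen : n < (G.pend t).length := by rw [hfa.1]; exact hn
    have := hfa.2 n hlen hn
    simp only [List.get_eq_getElem, hn'] at this
    rw [hq'.1, hbx] at this
    exact hne _ (List.getElem_mem _) _ this

theorem exists_feasible_of_not_robust [Fintype T] (h : ¬ P.Robust) : ∃ A, P.Feasible A := by
  by_contra hc
  refine h (robust_of_no_violation fun G t p a hv => hc ?_)
  obtain ⟨G', t', p', K, a', x, v, hA⟩ := hv.exists_attackGraph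
  exact hA.exists_feasible

/-- The position of a pending store in the buffer decreases with each store of the thread. -/
theorem Rep.track (hR : Rep P ω s G) (hG : G.Valid P) {w : List (Act D T)} {s' : State D R L T}
    (hrun : Run P s w s') {t : T} {i k : ℕ} (hk : (G.pend t)[i]? = some k)
    (hw : storeCount t w ≤ i) :
    ∃ G' : Graph D T, G'.Valid P ∧ Rep P (ω ++ w) s' G' ∧
      (G'.pend t)[i - storeCount t w]? = some k := by
  induction w generalizing ω s G i with
  | nil =>
    rw [hrun.nil_inv]
    exact ⟨G, hG, by simpa using hR, by simpa [storeCount] using hk⟩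
  | cons b w ih =>
    obtain ⟨s₁, hst, hrun⟩ := hrun.cons_inv
    have hsc : storeCount t (b :: w) = storeCount t [b] + storeCount t w :=
      storeCount_append t [b] w
    have key : ∃ G' : Graph D T, G'.Valid P ∧ Rep P (ω ++ [b]) s₁ G' ∧
        (G'.pend t)[i - storeCount t [b]]? = some k := by
      cases hst with
      | instr u j _ _ _ hst =>
        obtain ⟨e, o, h₁, h₂, -, rfl, -⟩ := hR.step_instr hG hst
        refine ⟨_, h₁, h₂, ?_⟩
        rw [storeCount_act, Nat.sub_zero]
        have hlt := (List.getElem?_eq_some_iff.1 hk).1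
        by_cases hu : t = u
        · subst hu
          cases e <;> simp [Graph.push, List.getElem?_append_left hlt, hk]
        · cases e <;> simp [Graph.push, hu, hk]
      | flush _ u a v γ hb =>
        obtain ⟨p, δ, hp, hl⟩ := hR.pend_eq hb
        have h := (hR.flush hG hp hl).2
        simp only [State.flush, hb, List.tail_cons] at h
        refine ⟨_, hG.flush hp hl, h, ?_⟩
        by_cases hu : t = u
        · subst hu
          have h₁ : storeCount t [Act.st t a v] = 1 := by
            simp [storeCount, Act.isStore, Act.thread]
          rw [h₁]
          simp only [Graph.flush, Function.update_self, hp, List.tail_cons]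
          rw [hp] at hk
          obtain ⟨i', rfl⟩ : ∃ i', i = i' + 1 := ⟨i - 1, by omega⟩
          simpa using hk
        · have h₁ : storeCount t [Act.st u a v] = 0 := by
            simp [storeCount, Act.isStore, Act.thread, Ne.symm hu]
          simp [h₁, Graph.flush, hu, hk]
    obtain ⟨G', h₁, h₂, h₃⟩ := key
    obtain ⟨G'', h₄, h₅, h₆⟩ := ih h₂ h₁ hrun h₃ (by omega)
    exact ⟨G'', h₄, by simpa using h₅, by rwa [hsc, ← Nat.sub_sub]⟩

/-- Since `st` was issued before `ld`, program order closes the path from `ld` to `st` to a cycle,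
and no SC trace has one. It has to be checked that the action `st` belongs to the node created by
`isu`; `Rep.track` follows this entry through the buffer. -/
theorem Program.Feasible.not_robust {A : Attack D R L T} (h : P.Feasible A) : ¬ P.Robust := by
  obtain ⟨-, τ₁, τ₂, τ₃, τ₄, x, v, y, w, τ, hW⟩ := h
  obtain ⟨s₁, s₂, s₃, s₄, s₅, hr₁, hi, hr₂, hj, hr₃, hb⟩ := hW.run
  set t := A.attacker with ht
  obtain ⟨G₁, hG₁, hR₁⟩ := hr₁.exists_rep
  obtain ⟨e, o, hG₂, hR₂, -, he, -⟩ := hR₁.step_instr hG₁ hi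
  have hp₂ : (G₁.push t e o).pend t = G₁.pend t ++ [(G₁.ev t).length] := by
    cases e <;> simp [LEv.act] at he
    simp [Graph.push]
  have hlen : (G₁.pend t).length = issueCount t τ₁ - storeCount t τ₁ := by
    have := hR₁.cnt t
    rw [(hR₁.buf t).length_eq]
    omega
  have hle : storeCount t τ₁ ≤ issueCount t τ₁ := by
    have := hR₁.cnt t
    omega
  have hpair := hW.pair.2
  simp only [← ht, storeCount_append, storeCount_cons_ld] at hpair
  obtain ⟨G₃, hG₃, hR₃, hp₃⟩ := hR₂.track hG₂ hr₂ (t := t) (i := (G₁.pend t).length)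
    (k := (G₁.ev t).length) (by simp [hp₂]) (by omega)
  obtain ⟨s₆, hr₄, hr₅⟩ := hr₃.append_inv
  obtain ⟨G₄, hG₄, hR₄, hp₄⟩ := hR₃.track hG₃ ((Run.single (.instr _ _ _ _ _ hj)).append hr₄)
    hp₃ (by simp; omega)
  have hlt : (G₁.ev t).length < (G₃.ev t).length := hG₃.pend_lt (List.mem_of_getElem? hp₃)
  -- The counts in `pair` say that all entries ahead of it have been written when `st` is due.
  obtain ⟨β, hβ⟩ : ∃ β, G₄.pend t = (G₁.ev t).length :: β := by
    have h0 : (G₁.pend t).length - storeCount t τ₂ -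
        storeCount t ([Act.ld t x v] ++ τ₃) = 0 := by
      simp; omega
    rw [h0] at hp₄
    generalize G₄.pend t = l at hp₄
    cases l with
    | nil => simp at hp₄
    | cons k l => exact ⟨l, by simpa using hp₄⟩
  have hpath := hW.path (.ld t x v :: τ₃) (.st t y w) [] (by simp [ht])
  have hn₁ : (traceOf (τ₁ ++ Act.isu t :: τ₂)).next (.ld t x v) = (t, (G₃.ev t).length) := by
    have := hR₃.next_act t (.ld x v)
    simpa [LEv.act] using this
  have hn₂ : (traceOf (τ₁ ++ Act.isu t :: (τ₂ ++ Act.ld t x v :: τ₃))).next (.st t y w) =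
      (t, (G₁.ev t).length) := by
    have := hR₄.next_st hG₄ hβ y w
    simpa using this
  rw [← ht, hn₁, hn₂] at hpath
  have hrun : Run P P.initState τ s₅ := by
    rw [hW.word]
    exact hr₁.append (.cons _ _ _ _ _ (.instr _ _ _ _ _ hi) (hr₂.append
      (.cons _ _ _ _ _ (.instr _ _ _ _ _ hj) hr₃)))
  obtain ⟨G, hG, hR⟩ := hrun.exists_rep
  have hiff := fun m n => hR.hb_iff (m := m) (n := n) fun u => (hR.pend_eq_nil_iff u).2 (hb u)
  have hpath' := TransGen.mono (fun m n => (hiff m n).1) _ _ hpath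
  have hcyc := hpath.tail ((hiff _ _).2 (.po _ _ _ hlt (hG.isSome_of_transGen hpath').1))
  intro hrob
  have hmem : traceOf τ ∈ traceOf '' P.scComputations := hrob ▸ ⟨τ, ⟨s₅, hrun, hb⟩, rfl⟩
  obtain ⟨σ, hσ, he⟩ := hmem
  exact sc_trace_acyclic hσ _ (he ▸ hcyc)

/-- A program is robust iff no attack is feasible. -/
theorem robust_iff [Fintype T] : P.Robust ↔ ∀ A, ¬ P.Feasible A := by
  constructor
  · intro h A hA
    exact hA.not_robust h
  · intro h
    by_contra hc
    obtain ⟨A, hA⟩ := exists_feasible_of_not_robust hc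
    exact h A hA

end
end TSO

/-! ### Erasing local actions from words -/

namespace TSO
section Erase
variable {D T : Type*}

/-- The second word results from the first one by erasing some local actions. -/
inductive Erase : List (Act D T) → List (Act D T) → Prop
  | nil : Erase [] []
  | keep (b : Act D T) (w w' : List (Act D T)) : Erase w w' → Erase (b :: w) (b :: w')
  | skip (t : T) (w w' : List (Act D T)) : Erase w w' → Erase (.loc t :: w) w'

theorem Erase.append {u u' w w' : List (Act D T)} (h : Erase u u') (h' : Erase w w') :
    Erase (u ++ w) (u' ++ w') := by
  induction h with
  | nil => exact h'
  | keep b _ _ _ ih => exact .keep b _ _ ih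
  | skip t _ _ _ ih => exact .skip t _ _ ih

theorem Erase.split_right {w u' v' : List (Act D T)} (h : Erase w (u' ++ v')) :
    ∃ u v, w = u ++ v ∧ Erase u u' ∧ Erase v v' := by
  generalize hx : u' ++ v' = x at h
  induction h generalizing u' with
  | nil =>
    obtain ⟨rfl, rfl⟩ := List.append_eq_nil_iff.1 hx
    exact ⟨[], [], rfl, .nil, .nil⟩
  | keep b w w' h ih =>
    rcases u' with _ | ⟨c, u'⟩
    · exact ⟨[], b :: w, rfl, .nil, by simp only [List.nil_append] at hx; exact hx ▸ .keep b _ _ h⟩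
    · obtain ⟨rfl, hx'⟩ : c = b ∧ u' ++ v' = w' := by simpa using hx
      obtain ⟨u, v, rfl, h₁, h₂⟩ := ih hx'
      exact ⟨c :: u, v, rfl, .keep _ _ _ h₁, h₂⟩
  | skip t w w' h ih =>
    obtain ⟨u, v, rfl, h₁, h₂⟩ := ih hx
    exact ⟨.loc t :: u, v, rfl, .skip _ _ _ h₁, h₂⟩

theorem Erase.cons_right {w v' : List (Act D T)} {b : Act D T} (h : Erase w (b :: v')) :
    ∃ u v, w = u ++ b :: v ∧ Erase u [] ∧ Erase v v' := by
  generalize hx : b :: v' = x at h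
  induction h with
  | nil => simp at hx
  | keep c w w' h ih =>
    obtain ⟨rfl, rfl⟩ : b = c ∧ v' = w' := by simpa using hx
    exact ⟨[], w, rfl, .nil, h⟩
  | skip t w w' h ih =>
    obtain ⟨u, v, rfl, h₁, h₂⟩ := ih hx
    exact ⟨.loc t :: u, v, rfl, .skip _ _ _ h₁, h₂⟩

theorem Erase.split_cons_right {w u' v' : List (Act D T)} {b : Act D T}
    (h : Erase w (u' ++ b :: v')) : ∃ u v, w = u ++ b :: v ∧ Erase u u' ∧ Erase v v' := by
  obtain ⟨u, v, rfl, h₁, h₂⟩ := h.split_right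
  obtain ⟨u₂, v, rfl, h₃, h₄⟩ := h₂.cons_right
  exact ⟨u ++ u₂, v, by simp, by simpa using h₁.append h₃, h₄⟩

theorem Erase.split_left {u v w' : List (Act D T)} (h : Erase (u ++ v) w') :
    ∃ u' v', w' = u' ++ v' ∧ Erase u u' ∧ Erase v v' := by
  induction u generalizing w' with
  | nil => exact ⟨[], w', rfl, .nil, h⟩
  | cons b u ih =>
    cases h with
    | keep _ _ w' h =>
      obtain ⟨u', v', rfl, h₁, h₂⟩ := ih h
      exact ⟨b :: u', v', rfl, .keep _ _ _ h₁, h₂⟩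
    | skip t _ _ h =>
      obtain ⟨u', v', rfl, h₁, h₂⟩ := ih h
      exact ⟨u', v', rfl, .skip _ _ _ h₁, h₂⟩

theorem Erase.cons_left {w w' : List (Act D T)} {b : Act D T} (h : Erase (b :: w) w')
    (hb : ∀ t, b ≠ .loc t) : ∃ v', w' = b :: v' ∧ Erase w v' := by
  cases h with
  | keep _ _ w' h => exact ⟨w', rfl, h⟩
  | skip t _ _ h => exact (hb t rfl).elim

theorem Erase.sublist {w w' : List (Act D T)} (h : Erase w w') : w'.Sublist w := by
  induction h with
  | nil => exact .slnil
  | keep b _ _ _ ih => exact ih.cons_cons b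
  | skip t _ _ _ ih => exact ih.cons _

theorem Erase.issueCount_eq [DecidableEq T] {w w' : List (Act D T)} (h : Erase w w') (t : T) :
    issueCount t w' = issueCount t w := by
  simp only [issueCount]
  induction h with
  | nil => rfl
  | keep b _ _ _ ih => simp only [List.countP_cons, ih]
  | skip t _ _ _ ih => rw [List.countP_cons_of_neg (by simp [Act.isIssue]), ih]

theorem Erase.storeCount_eq [DecidableEq T] {w w' : List (Act D T)} (h : Erase w w') (t : T) :
    storeCount t w' = storeCount t w := by
  simp only [storeCount]
  induction h with
  | nil => rfl
  | keep b _ _ _ ih => simp only [List.countP_cons, ih]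
  | skip t _ _ _ ih => rw [List.countP_cons_of_neg (by simp [Act.isStore]), ih]

end Erase

/-! ### Happens-before after erasing local events -/

section TraceErase
open Relation
variable {D T : Type*} [DecidableEq D] [DecidableEq T]

/-- The node map that belongs to maps of the positions in each thread. -/
def nodeMap (f : T → ℕ → ℕ) (n : T × ℕ) : T × ℕ := (n.1, f n.1 n.2)

/-- `θ'` results from `θ` by erasing local events; `f` maps the positions of the events of `θ'` to
their positions in `θ`. -/
structure TraceErase (f : T → ℕ → ℕ) (θ θ' : Trace D T) : Prop where
  mono : ∀ t j k, j < k → k < (θ'.events t).length → f t j < f t k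
  lt : ∀ t k, k < (θ'.events t).length → f t k < (θ.events t).length
  ev : ∀ t k, k < (θ'.events t).length → (θ.events t)[f t k]? = (θ'.events t)[k]?
  skip : ∀ t j, j < (θ.events t).length → (∀ k < (θ'.events t).length, f t k ≠ j) →
    (θ.events t)[j]? = some (.loc t)
  stores : ∀ a, θ.stores a = (θ'.stores a).map (nodeMap f)
  stores_lt : ∀ a, ∀ n ∈ θ'.stores a, n.2 < (θ'.events n.1).length
  source : ∀ n, n.2 < (θ'.events n.1).length →
    θ.source (nodeMap f n) = (θ'.source n).map (nodeMap f)
  source_lt : ∀ n m, θ'.source n = some m → m.2 < (θ'.events m.1).length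
  source_dom : ∀ n m, θ'.source n = some m → n.2 < (θ'.events n.1).length
  source_some : ∀ n m, θ.source n = some m →
    ∃ n', n'.2 < (θ'.events n'.1).length ∧ n = nodeMap f n'

variable {f : T → ℕ → ℕ} {θ θ' : Trace D T}

theorem TraceErase.lt_iff (h : TraceErase f θ θ') {t : T} {j k : ℕ}
    (hj : j < (θ'.events t).length) (hk : k < (θ'.events t).length) : f t j < f t k ↔ j < k := by
  constructor
  · intro hlt
    by_contra hc
    rcases (not_lt.1 hc).lt_or_eq with h' | rfl
    · exact lt_asymm hlt (h.mono t _ _ h' hj)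
    · exact lt_irrefl _ hlt
  · exact fun h' => h.mono t _ _ h' hk

theorem TraceErase.inj (h : TraceErase f θ θ') {t : T} {j k : ℕ}
    (hj : j < (θ'.events t).length) (hk : k < (θ'.events t).length) (he : f t j = f t k) :
    j = k := by
  rcases lt_trichotomy j k with h' | h' | h'
  · exact absurd he (h.mono t _ _ h' hk).ne
  · exact h'
  · exact absurd he (h.mono t _ _ h' hj).ne'

/-- Every happens-before edge is a program order edge or survives. -/
theorem TraceErase.hb_cases (h : TraceErase f θ θ') {m n : T × ℕ} (hmn : θ.HB m n) :
    (m.1 = n.1 ∧ m.2 < n.2 ∧ n.2 < (θ.events n.1).length) ∨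
    ∃ m' n', m'.2 < (θ'.events m'.1).length ∧ n'.2 < (θ'.events n'.1).length ∧
      m = nodeMap f m' ∧ n = nodeMap f n' ∧ θ'.HB m' n' := by
  have hsub : ∀ a m n, [m, n].Sublist (θ.stores a) → ∃ m' n', m = nodeMap f m' ∧ n = nodeMap f n' ∧
      [m', n'].Sublist (θ'.stores a) := by
    intro a m n hs
    rw [h.stores, List.sublist_map_iff] at hs
    obtain ⟨l, hl, he⟩ := hs
    rcases l with _ | ⟨m', _ | ⟨n', _ | ⟨_, _⟩⟩⟩ <;> simp at he
    exact ⟨m', n', he.1, he.2, hl⟩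
  have hld : ∀ t k a v, (θ.events t)[k]? = some (.ld t a v) →
      ∃ k', k' < (θ'.events t).length ∧ k = f t k' ∧ (θ'.events t)[k']? = some (.ld t a v) := by
    intro t k a v hk
    by_contra hc
    have h1 := h.skip t k (List.getElem?_eq_some_iff.1 hk).1 fun k' hk' he =>
      hc ⟨k', hk', he.symm, by rw [← h.ev t k' hk', he, hk]⟩
    rw [hk] at h1
    simp at h1
  have hso : ∀ t k m, k < (θ'.events t).length → θ.source (t, f t k) = some m →
      ∃ m', θ'.source (t, k) = some m' ∧ m = nodeMap f m' := by
    intro t k m hk hm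
    have := h.source (t, k) hk
    simp only [nodeMap] at this
    rw [hm] at this
    obtain ⟨m', h₁, h₂⟩ := Option.map_eq_some_iff.1 this.symm
    exact ⟨m', h₁, h₂.symm⟩
  have hinj : ∀ m' n', m'.2 < (θ'.events m'.1).length → n'.2 < (θ'.events n'.1).length →
      nodeMap f m' = nodeMap f n' → m' = n' := by
    rintro ⟨t, j⟩ ⟨u, k⟩ hj hk he
    simp only [nodeMap, Prod.mk.injEq] at he
    obtain ⟨rfl, he⟩ := he
    exact Prod.ext rfl (h.inj hj hk he)
  cases hmn with
  | programOrder t j k hjk hk => exact .inl ⟨rfl, hjk, hk⟩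
  | storeOrder a _ _ hs =>
    obtain ⟨m', n', rfl, rfl, hs'⟩ := hsub a _ _ hs
    exact .inr ⟨m', n', h.stores_lt a _ (hs'.subset (by simp)),
      h.stores_lt a _ (hs'.subset (by simp)), rfl, rfl, .storeOrder a _ _ hs'⟩
  | source _ _ hs =>
    obtain ⟨n', hn', rfl⟩ := h.source_some _ _ hs
    obtain ⟨m', hm', rfl⟩ := hso n'.1 n'.2 m hn' hs
    exact .inr ⟨m', n', h.source_lt _ _ hm', hn', rfl, rfl, .source _ _ hm'⟩
  | conflict t k a v m _ h₁ h₂ h₃ =>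
    obtain ⟨k', hk', rfl, h₁'⟩ := hld t k a v h₁
    obtain ⟨m', hm', rfl⟩ := hso t k' m hk' h₂
    obtain ⟨m'', n', he, rfl, hs'⟩ := hsub a _ _ h₃
    obtain rfl := hinj m' m'' (h.source_lt _ _ hm') (h.stores_lt a _ (hs'.subset (by simp))) he
    exact .inr ⟨(t, k'), n', hk', h.stores_lt a _ (hs'.subset (by simp)), rfl, rfl,
      .conflict t k' a v m' n' h₁' hm' hs'⟩
  | conflictInit t k a v _ h₁ h₂ h₃ =>
    obtain ⟨k', hk', rfl, h₁'⟩ := hld t k a v h₁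
    rw [h.stores, List.mem_map] at h₃
    obtain ⟨n', hn', rfl⟩ := h₃
    refine .inr ⟨(t, k'), n', hk', h.stores_lt a _ hn', rfl, rfl,
      .conflictInit t k' a v n' h₁' ?_ hn'⟩
    have := h.source (t, k') hk'
    simp only [nodeMap] at this
    rw [h₂] at this
    exact Option.map_eq_none_iff.1 this.symm

/-- Erased events have only program order edges. So whenever the path in `θ` is at a node `c`, some
remaining node of the same thread, not later than `c`, has been reached in `θ'` (or is `m` itself,
strictly before `c`). The next surviving edge is joined to it by program order. -/
theorem TraceErase.transGen (h : TraceErase f θ θ') {m n : T × ℕ}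
    (hm : m.2 < (θ'.events m.1).length) (hn : n.2 < (θ'.events n.1).length)
    (hmn : TransGen θ.HB (nodeMap f m) (nodeMap f n)) : TransGen θ'.HB m n := by
  have hpo : ∀ p q : T × ℕ, q.2 < (θ'.events q.1).length → p.1 = q.1 → p.2 < q.2 → θ'.HB p q := by
    rintro ⟨t, j⟩ ⟨u, k⟩ hk rfl hjk
    exact .programOrder t j k hjk hk
  have key : ∀ c, TransGen θ.HB (nodeMap f m) c → ∃ q : T × ℕ, q.2 < (θ'.events q.1).length ∧
      q.1 = c.1 ∧ ((TransGen θ'.HB m q ∧ f q.1 q.2 ≤ c.2) ∨ (q = m ∧ f q.1 q.2 < c.2)) := by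
    have himg : ∀ b' c' : T × ℕ, b'.2 < (θ'.events b'.1).length → θ'.HB b' c' →
        (∃ q : T × ℕ, q.2 < (θ'.events q.1).length ∧ q.1 = b'.1 ∧
          ((TransGen θ'.HB m q ∧ f q.1 q.2 ≤ f b'.1 b'.2) ∨
            (q = m ∧ f q.1 q.2 < f b'.1 b'.2))) → TransGen θ'.HB m c' := by
      rintro ⟨t, k⟩ c' hb hbc ⟨⟨u, j⟩, hq, rfl, ⟨h₁, h₂⟩ | ⟨rfl, h₂⟩⟩
      · rcases lt_trichotomy j k with hjk | rfl | hjk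
        · exact (h₁.tail (.programOrder u j k hjk hb)).tail hbc
        · exact h₁.tail hbc
        · exact absurd (h.mono u _ _ hjk hq) (not_lt.2 h₂)
      · exact (TransGen.single (hpo (u, j) (u, k) hb rfl ((h.lt_iff hq hb).1 h₂))).tail hbc
    intro c hc
    induction hc with
    | @single c hc =>
      rcases h.hb_cases hc with ⟨h₁, h₂, -⟩ | ⟨m', n', h₁, h₂, h₃, rfl, h₅⟩
      · exact ⟨m, hm, h₁, .inr ⟨rfl, h₂⟩⟩
      · have : m = m' := by
          obtain ⟨t, j⟩ := m
          obtain ⟨u, k⟩ := m'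
          simp only [nodeMap, Prod.mk.injEq] at h₃
          obtain ⟨rfl, he⟩ := h₃
          exact Prod.ext rfl (h.inj hm h₁ he)
        subst this
        exact ⟨n', h₂, rfl, .inl ⟨.single h₅, le_rfl⟩⟩
    | @tail b c _ hc ih =>
      rcases h.hb_cases hc with ⟨h₁, h₂, -⟩ | ⟨b', c', h₁, h₂, rfl, rfl, h₅⟩
      · obtain ⟨q, hq, hq', hq''⟩ := ih
        refine ⟨q, hq, hq'.trans h₁, hq''.imp (fun h => ⟨h.1, h.2.trans h₂.le⟩)
          fun h => ⟨h.1, h.2.trans h₂⟩⟩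
      · exact ⟨c', h₂, rfl, .inl ⟨himg b' c' h₁ h₅ ih, le_rfl⟩⟩
  obtain ⟨⟨u, j⟩, hq, hq', h'⟩ := key _ hmn
  obtain ⟨t, k⟩ := n
  simp only [nodeMap] at hq'
  subst hq'
  rcases h' with ⟨h₁, h₂⟩ | ⟨rfl, h₂⟩
  · rcases lt_trichotomy j k with hjk | rfl | hjk
    · exact h₁.tail (.programOrder u j k hjk hn)
    · exact h₁
    · exact absurd (h.mono u _ _ hjk hq) (not_lt.2 h₂)
  · exact .single (hpo _ _ hn rfl ((h.lt_iff hq hn).1 h₂))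

theorem TraceErase.congr (h : TraceErase f θ θ') {g : T → ℕ → ℕ}
    (hg : ∀ t k, k < (θ'.events t).length → g t k = f t k) : TraceErase g θ θ' := by
  have hn : ∀ n : T × ℕ, n.2 < (θ'.events n.1).length → nodeMap g n = nodeMap f n := by
    intro n hn
    simp only [nodeMap, hg _ _ hn]
  constructor
  · intro t j k hjk hk
    rw [hg t j (hjk.trans hk), hg t k hk]
    exact h.mono t j k hjk hk
  · intro t k hk
    rw [hg t k hk]
    exact h.lt t k hk
  · intro t k hk
    rw [hg t k hk]
    exact h.ev t k hk
  · intro t j hj hk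
    exact h.skip t j hj fun k hk' => by rw [← hg t k hk']; exact hk k hk'
  · intro a
    rw [h.stores]
    exact List.map_congr_left fun n hn' => (hn n (h.stores_lt a n hn')).symm
  · exact h.stores_lt
  · intro n hn'
    rw [hn n hn', h.source n hn']
    exact Option.map_congr fun m hm => (hn m (h.source_lt n m hm)).symm
  · exact h.source_lt
  · exact h.source_dom
  · intro n m hnm
    obtain ⟨n', h₁, h₂⟩ := h.source_some n m hnm
    exact ⟨n', h₁, by rw [hn n' h₁, h₂]⟩

end TraceErase
end TSO

/-! ### Erasing actions one by one -/

namespace TSO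
section
variable {D T : Type*} [DecidableEq D] [DecidableEq T] {f : T → ℕ → ℕ} {θ θ' : Trace D T}

theorem TraceErase.skip_loc (h : TraceErase f θ θ') (t : T) :
    TraceErase f (θ.append (.loc t)) θ' := by
  have hev : ∀ u, (θ.append (.loc t)).events u =
      θ.events u ++ if u = t then [.loc t] else [] := by
    intro u
    by_cases hu : u = t
    · subst hu; simp [Trace.append]
    · simp [Trace.append, hu]
  constructor
  · exact h.mono
  · intro u k hk
    rw [hev, List.length_append]
    have := h.lt u k hk
    omega
  · intro u k hk
    rw [hev, List.getElem?_append_left (h.lt u k hk), h.ev u k hk]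
  · intro u j hj hk
    rw [hev] at hj ⊢
    by_cases hj' : j < (θ.events u).length
    · rw [List.getElem?_append_left hj', h.skip u j hj' hk]
    · by_cases hu : u = t
      · subst hu
        simp only [if_true, List.length_append, List.length_singleton] at hj
        obtain rfl : j = (θ.events u).length := by omega
        simp
      · simp only [hu, if_false, List.append_nil] at hj
        exact (hj' hj).elim
  · exact h.stores
  · exact h.stores_lt
  · exact h.source
  · exact h.source_lt
  · exact h.source_dom
  · exact h.source_some

/-- Common to issues, local actions and loads: both traces gain a last event, matched by `f`. For
events other than loads, `o'` is `none`. -/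
theorem TraceErase.keep_event (h : TraceErase f θ θ') {t : T} {b : Act D T} {θ₁ θ₁' : Trace D T}
    {o' : Option (T × ℕ)} (hf : f t (θ'.events t).length = (θ.events t).length)
    (he : θ₁.events = Function.update θ.events t (θ.events t ++ [b]))
    (he' : θ₁'.events = Function.update θ'.events t (θ'.events t ++ [b]))
    (hs : θ₁.stores = θ.stores) (hs' : θ₁'.stores = θ'.stores)
    (ho : θ₁.source = Function.update θ.source (t, (θ.events t).length) (o'.map (nodeMap f)))
    (ho' : θ₁'.source = Function.update θ'.source (t, (θ'.events t).length) o')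
    (hlt : ∀ m, o' = some m → m.2 < (θ'.events m.1).length) :
    TraceErase f θ₁ θ₁' := by
  have hev : ∀ u, θ₁.events u = θ.events u ++ if u = t then [b] else [] := by
    intro u
    by_cases hu : u = t
    · subst hu; simp [he]
    · simp [he, hu]
  have hev' : ∀ u, θ₁'.events u = θ'.events u ++ if u = t then [b] else [] := by
    intro u
    by_cases hu : u = t
    · subst hu; simp [he']
    · simp [he', hu]
  have hlen : ∀ u k, k < (θ₁'.events u).length →
      k < (θ'.events u).length ∨ (u = t ∧ k = (θ'.events t).length) := by
    intro u k hk
    rw [hev', List.length_append] at hk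
    by_cases hu : u = t
    · subst hu
      rw [if_pos rfl, List.length_singleton] at hk
      rcases Nat.lt_or_ge k (θ'.events u).length with h' | h'
      · exact .inl h'
      · exact .inr ⟨rfl, by omega⟩
    · rw [if_neg hu] at hk
      exact .inl hk
  have hle : ∀ u, (θ'.events u).length ≤ (θ₁'.events u).length := by
    intro u
    rw [hev', List.length_append]
    omega
  constructor
  · intro u j k hjk hk
    rcases hlen u k hk with hk | ⟨rfl, rfl⟩
    · exact h.mono u j k hjk hk
    · rw [hf]
      exact h.lt u j hjk
  · intro u k hk
    rw [hev, List.length_append]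
    rcases hlen u k hk with hk | ⟨rfl, rfl⟩
    · have := h.lt u k hk
      omega
    · rw [hf]
      simp
  · intro u k hk
    rcases hlen u k hk with hk | ⟨rfl, rfl⟩
    · rw [hev, hev', List.getElem?_append_left (h.lt u k hk), List.getElem?_append_left hk,
        h.ev u k hk]
    · rw [hf, hev, hev']
      simp
  · intro u j hj hk
    have hk' : ∀ k < (θ'.events u).length, f u k ≠ j := fun k hk' => hk k (hk'.trans_le (hle u))
    rw [hev] at hj ⊢
    by_cases hj' : j < (θ.events u).length
    · rw [List.getElem?_append_left hj', h.skip u j hj' hk']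
    · exfalso
      by_cases hu : u = t
      · subst hu
        simp only [if_true, List.length_append, List.length_singleton] at hj
        obtain rfl : j = (θ.events u).length := by omega
        exact hk (θ'.events u).length (by simp [hev']) hf
      · simp only [hu, if_false, List.append_nil] at hj
        exact hj' hj
  · intro a
    rw [hs, hs', h.stores]
  · intro a n hn
    rw [hs'] at hn
    exact (h.stores_lt a n hn).trans_le (hle _)
  · rintro ⟨u, k⟩ hk
    rw [ho, ho']
    rcases hlen u k hk with hk | ⟨rfl, rfl⟩
    · have h₁ : nodeMap f (u, k) ≠ (t, (θ.events t).length) := by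
        intro he
        simp only [nodeMap, Prod.mk.injEq] at he
        obtain ⟨rfl, he⟩ := he
        have := h.lt u k hk
        omega
      have h₂ : (u, k) ≠ (t, (θ'.events t).length) := by
        intro he
        obtain ⟨rfl, rfl⟩ := Prod.mk.inj he
        omega
      rw [Function.update_of_ne h₁, Function.update_of_ne h₂, h.source (u, k) hk]
    · simp [nodeMap, hf]
  · intro n m hnm
    rw [ho', Function.update_apply] at hnm
    split_ifs at hnm
    · exact (hlt m hnm).trans_le (hle _)
    · exact (h.source_lt n m hnm).trans_le (hle _)
  · intro n m hnm
    rw [ho', Function.update_apply] at hnm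
    split_ifs at hnm with hn
    · subst hn
      simp [hev']
    · exact (h.source_dom n m hnm).trans_le (hle _)
  · intro n m hnm
    rw [ho, Function.update_apply] at hnm
    split_ifs at hnm with hn
    · exact ⟨(t, (θ'.events t).length), by simp [hev'], by rw [hn]; simp [nodeMap, hf]⟩
    · obtain ⟨n', h₁, h₂⟩ := h.source_some n m hnm
      exact ⟨n', h₁.trans_le (hle _), h₂⟩

theorem TraceErase.source_length (h : TraceErase f θ θ') (t : T) :
    θ.source (t, (θ.events t).length) = none ∧ θ'.source (t, (θ'.events t).length) = none := by
  constructor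
  · by_contra hc
    obtain ⟨m, hm⟩ := Option.ne_none_iff_exists'.1 hc
    obtain ⟨⟨u, k⟩, h₁, h₂⟩ := h.source_some _ _ hm
    simp only [nodeMap, Prod.mk.injEq] at h₁ h₂
    obtain ⟨rfl, he⟩ := h₂
    have := h.lt t k h₁
    omega
  · by_contra hc
    obtain ⟨m, hm⟩ := Option.ne_none_iff_exists'.1 hc
    exact absurd (h.source_dom _ _ hm) (lt_irrefl _)

theorem TraceErase.keep_isu (h : TraceErase f θ θ') {t : T}
    (hf : f t (θ'.events t).length = (θ.events t).length) :
    TraceErase f (θ.append (.isu t)) (θ'.append (.isu t)) := by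
  obtain ⟨h₁, h₂⟩ := h.source_length t
  refine h.keep_event (b := .isu t) (o' := none) hf rfl rfl rfl rfl ?_ ?_ (by simp)
  · rw [Option.map_none, ← h₁, Function.update_eq_self]
    rfl
  · rw [← h₂, Function.update_eq_self]
    rfl

theorem TraceErase.keep_loc (h : TraceErase f θ θ') {t : T}
    (hf : f t (θ'.events t).length = (θ.events t).length) :
    TraceErase f (θ.append (.loc t)) (θ'.append (.loc t)) := by
  obtain ⟨h₁, h₂⟩ := h.source_length t
  refine h.keep_event (b := .loc t) (o' := none) hf rfl rfl rfl rfl ?_ ?_ (by simp)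
  · rw [Option.map_none, ← h₁, Function.update_eq_self]
    rfl
  · rw [← h₂, Function.update_eq_self]
    rfl

theorem TraceErase.keep_ld (h : TraceErase f θ θ') {t : T} {a v : D}
    (hf : f t (θ'.events t).length = (θ.events t).length) :
    TraceErase f (θ.append (.ld t a v)) (θ'.append (.ld t a v)) := by
  refine h.keep_event (b := .ld t a v) (o' := (θ'.stores a).getLast?) hf rfl rfl rfl rfl ?_ ?_ ?_
  · simp [Trace.append, Trace.next, h.stores, List.getLast?_map]
  · simp [Trace.append, Trace.next]
  · exact fun m hm => h.stores_lt a m (List.mem_of_getLast? hm)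

/-- Erased events are no issues, so the first open issues of both traces correspond. Without an open
issue, `findIdx` would return the lengths of the two lists, which need not correspond; `Issued`
rules this out along a run. -/
theorem TraceErase.next_st (h : TraceErase f θ θ') {t : T} {a v : D}
    (hi : ∃ b ∈ θ.events t, b.isIssue = true) :
    (θ'.next (.st t a v)).2 < (θ'.events t).length ∧
      θ.next (.st t a v) = nodeMap f (θ'.next (.st t a v)) := by
  have hi' : ∃ b ∈ θ'.events t, b.isIssue = true := by
    obtain ⟨b, hb, hbi⟩ := hi
    obtain ⟨j, hj, rfl⟩ := List.mem_iff_getElem.1 hb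
    by_contra hc
    have hsk := h.skip t j hj ?_
    · rw [List.getElem?_eq_getElem hj] at hsk
      simp only [Option.some.injEq] at hsk
      rw [hsk] at hbi
      simp [Act.isIssue] at hbi
    · rintro k hk rfl
      have := h.ev t k hk
      rw [List.getElem?_eq_getElem hj, List.getElem?_eq_getElem hk] at this
      simp only [Option.some.injEq] at this
      exact hc ⟨_, List.getElem_mem hk, by rw [← this]; exact hbi⟩
  have hlt : (θ'.events t).findIdx Act.isIssue < (θ'.events t).length :=
    List.findIdx_lt_length_of_exists hi'
  refine ⟨hlt, ?_⟩
  simp only [Trace.next, nodeMap, Prod.mk.injEq, true_and]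
  have hl := h.lt t _ hlt
  rw [List.findIdx_eq hl]
  constructor
  · have := h.ev t _ hlt
    rw [List.getElem?_eq_getElem hl, List.getElem?_eq_getElem hlt] at this
    simp only [Option.some.injEq] at this
    rw [this]
    exact List.findIdx_getElem
  · intro j hj
    by_contra hc
    have hjl : j < (θ.events t).length := hj.trans hl
    by_cases hk : ∃ k < (θ'.events t).length, f t k = j
    · obtain ⟨k, hk, rfl⟩ := hk
      have hlt' := (h.lt_iff hk hlt).1 hj
      have := h.ev t k hk
      rw [List.getElem?_eq_getElem hjl, List.getElem?_eq_getElem hk] at this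
      simp only [Option.some.injEq] at this
      rw [this] at hc
      exact hc (by simpa using List.not_of_lt_findIdx hlt')
    · push Not at hk
      have := h.skip t j hjl hk
      rw [List.getElem?_eq_getElem hjl] at this
      simp only [Option.some.injEq] at this
      rw [this] at hc
      simp [Act.isIssue] at hc

theorem TraceErase.keep_st (h : TraceErase f θ θ') {t : T} {a v : D}
    (hi : ∃ b ∈ θ.events t, b.isIssue = true) :
    TraceErase f (θ.append (.st t a v)) (θ'.append (.st t a v)) := by
  classical
  obtain ⟨hlt, hnext⟩ := h.next_st (a := a) (v := v) hi
  obtain ⟨i, hn'⟩ : ∃ i, θ'.next (.st t a v) = (t, i) := ⟨_, rfl⟩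
  rw [hn'] at hlt hnext
  simp only [nodeMap] at hnext hlt
  have hev : ∀ u, (θ.append (.st t a v)).events u =
      if u = t then (θ.events t).set (f t i) (.st t a v) else θ.events u := by
    intro u
    by_cases hu : u = t
    · subst hu; simp [Trace.append, hnext]
    · simp [Trace.append, hu]
  have hev' : ∀ u, (θ'.append (.st t a v)).events u =
      if u = t then (θ'.events t).set i (.st t a v) else θ'.events u := by
    intro u
    by_cases hu : u = t
    · subst hu; simp [Trace.append, hn']
    · simp [Trace.append, hu]
  have hlen : ∀ u, ((θ.append (.st t a v)).events u).length = (θ.events u).length := by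
    intro u
    rw [hev]
    split_ifs with hu
    · subst hu; simp
    · rfl
  have hlen' : ∀ u, ((θ'.append (.st t a v)).events u).length = (θ'.events u).length := by
    intro u
    rw [hev']
    split_ifs with hu
    · subst hu; simp
    · rfl
  have hst : (θ.append (.st t a v)).stores =
      Function.update θ.stores a (θ.stores a ++ [(t, f t i)]) := by simp [Trace.append, hnext]
  have hst' : (θ'.append (.st t a v)).stores =
      Function.update θ'.stores a (θ'.stores a ++ [(t, i)]) := by simp [Trace.append, hn']
  have hso : ∀ n, (θ.append (.st t a v)).source n = if n.1 = t ∧ f t i < n.2 ∧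
      (θ.events t)[n.2]? = some (.ld t a v) then some (t, f t i) else θ.source n := by
    intro n
    simp only [Trace.append]
    rw [hnext]
  have hso' : ∀ n, (θ'.append (.st t a v)).source n = if n.1 = t ∧ i < n.2 ∧
      (θ'.events t)[n.2]? = some (.ld t a v) then some (t, i) else θ'.source n := by
    intro n
    simp only [Trace.append]
    rw [hn']
  constructor
  · intro u j k hjk hk
    rw [hlen'] at hk
    exact h.mono u j k hjk hk
  · intro u k hk
    rw [hlen'] at hk
    rw [hlen]
    exact h.lt u k hk
  · intro u k hk
    rw [hlen'] at hk
    rw [hev, hev']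
    by_cases hu : u = t
    · subst hu
      simp only [if_true, List.getElem?_set]
      by_cases hki : i = k
      · subst hki
        simp [hk, h.lt u i hk]
      · have : f u i ≠ f u k := fun he => hki (h.inj hlt hk he)
        simp only [hki, this, if_false]
        exact h.ev u k hk
    · simp only [hu, if_false]
      exact h.ev u k hk
  · intro u j hj hk
    rw [hlen] at hj
    simp only [hlen'] at hk
    rw [hev]
    by_cases hu : u = t
    · subst hu
      simp only [if_true, List.getElem?_set]
      rw [if_neg (hk i hlt)]
      exact h.skip u j hj hk
    · simp only [hu, if_false]
      exact h.skip u j hj hk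
  · intro b
    rw [hst, hst']
    by_cases hb : b = a
    · subst hb; simp [h.stores, nodeMap]
    · simp [hb, h.stores]
  · intro b n hn
    rw [hlen']
    rw [hst'] at hn
    by_cases hb : b = a
    · subst hb
      rw [Function.update_self, List.mem_append, List.mem_singleton] at hn
      rcases hn with hn | rfl
      · exact h.stores_lt b n hn
      · exact hlt
    · rw [Function.update_of_ne hb] at hn
      exact h.stores_lt b n hn
  · rintro ⟨u, k⟩ hk
    rw [hlen'] at hk
    rw [hso, hso']
    -- Positions of remaining events compare alike in both traces, so the same loads are redirected
    -- to the new store.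
    have hiff : ((nodeMap f (u, k)).1 = t ∧ f t i < (nodeMap f (u, k)).2 ∧
        (θ.events t)[(nodeMap f (u, k)).2]? = some (.ld t a v)) ↔
        ((u, k).1 = t ∧ i < (u, k).2 ∧ (θ'.events t)[(u, k).2]? = some (.ld t a v)) := by
      simp only [nodeMap]
      constructor
      · rintro ⟨rfl, h₁, h₂⟩
        exact ⟨rfl, (h.lt_iff hlt hk).1 h₁, by rw [← h.ev u k hk, h₂]⟩
      · rintro ⟨rfl, h₁, h₂⟩
        exact ⟨rfl, (h.lt_iff hlt hk).2 h₁, by rw [h.ev u k hk, h₂]⟩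
    by_cases hc : (u, k).1 = t ∧ i < (u, k).2 ∧ (θ'.events t)[(u, k).2]? = some (.ld t a v)
    · rw [if_pos hc, if_pos (hiff.2 hc)]
      rfl
    · rw [if_neg hc, if_neg (fun h' => hc (hiff.1 h'))]
      exact h.source (u, k) hk
  · intro n m hnm
    rw [hso'] at hnm
    rw [hlen']
    split_ifs at hnm with hc
    · obtain rfl : (t, i) = m := by simpa using hnm
      exact hlt
    · exact h.source_lt n m hnm
  · intro n m hnm
    rw [hso'] at hnm
    rw [hlen']
    split_ifs at hnm with hc
    · rw [hc.1]
      exact (List.getElem?_eq_some_iff.1 hc.2.2).1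
    · exact h.source_dom n m hnm
  · rintro ⟨u, j⟩ m hnm
    rw [hso] at hnm
    simp only [hlen']
    split_ifs at hnm with hc
    · simp only at hc
      obtain ⟨rfl, h₁, h₂⟩ := hc
      by_contra hk
      have := h.skip u j (List.getElem?_eq_some_iff.1 h₂).1 fun k hk' he =>
        hk ⟨(u, k), hk', by simp [nodeMap, he]⟩
      rw [h₂] at this
      simp at this
    · exact h.source_some _ m hnm

theorem Trace.length_append_le (θ : Trace D T) (b : Act D T) (t : T) :
    (θ.events t).length ≤ ((θ.append b).events t).length := by
  have key : ∀ (u : T) (l : List (Act D T)), (θ.events u).length ≤ l.length →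
      (θ.events t).length ≤ (Function.update θ.events u l t).length := by
    intro u l hl
    by_cases hu : t = u
    · subst hu; simpa using hl
    · simp [hu]
  cases b <;> exact key _ _ (by simp)

theorem Trace.length_foldl_le (θ : Trace D T) (w : List (Act D T)) (t : T) :
    (θ.events t).length ≤ ((w.foldl Trace.append θ).events t).length := by
  induction w generalizing θ with
  | nil => rfl
  | cons b w ih => exact (θ.length_append_le b t).trans (ih _)

/-- Every store in `w` has been issued. -/
def Issued (θ : Trace D T) (w : List (Act D T)) : Prop :=
  ∀ α t a v β, w = α ++ .st t a v :: β →
    ∃ b ∈ (α.foldl Trace.append θ).events t, b.isIssue = true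

theorem Issued.tail {b : Act D T} {w : List (Act D T)} (h : Issued θ (b :: w)) :
    Issued (θ.append b) w := by
  intro α t a v β hw
  exact h (b :: α) t a v β (by simp [hw])

theorem Issued.left {u w : List (Act D T)} (h : Issued θ (u ++ w)) : Issued θ u := by
  intro α t a v β hw
  exact h α t a v (β ++ w) (by simp [hw])

theorem Issued.right {u w : List (Act D T)} (h : Issued θ (u ++ w)) :
    Issued (u.foldl Trace.append θ) w := by
  intro α t a v β hw
  have := h (u ++ α) t a v β (by simp [hw])
  rwa [List.foldl_append] at this

theorem TraceErase.keep (h : TraceErase f θ θ') (b : Act D T)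
    (hi : ∀ t a v, b = .st t a v → ∃ c ∈ θ.events t, c.isIssue = true) :
    ∃ g, TraceErase g (θ.append b) (θ'.append b) ∧
      (∀ t k, k < (θ'.events t).length → g t k = f t k) ∧
      (θ'.next b).2 < ((θ'.append b).events (θ'.next b).1).length ∧
      θ.next b = nodeMap g (θ'.next b) := by
  classical
  by_cases hb : ∃ t a v, b = .st t a v
  · obtain ⟨t, a, v, rfl⟩ := hb
    obtain ⟨h₁, h₂⟩ := h.next_st (a := a) (v := v) (hi t a v rfl)
    exact ⟨f, h.keep_st (hi t a v rfl), fun _ _ _ => rfl,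
      h₁.trans_le (Trace.length_append_le _ _ _), h₂⟩
  -- The action becomes the last event of its thread in both traces; `g` matches these two positions
  -- and agrees with `f` on the old ones.
  · let g : T → ℕ → ℕ := fun u k =>
      if u = b.thread ∧ k = (θ'.events b.thread).length then (θ.events b.thread).length else f u k
    have hg : ∀ u k, k < (θ'.events u).length → g u k = f u k := by
      intro u k hk
      refine if_neg ?_
      rintro ⟨rfl, rfl⟩
      omega
    have hgt : g b.thread (θ'.events b.thread).length = (θ.events b.thread).length :=
      if_pos ⟨rfl, rfl⟩
    have h' := h.congr hg
    cases b with
    | isu t => exact ⟨g, h'.keep_isu hgt, hg, by simp [Trace.append, Trace.next],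
        Prod.ext rfl hgt.symm⟩
    | loc t => exact ⟨g, h'.keep_loc hgt, hg, by simp [Trace.append, Trace.next],
        Prod.ext rfl hgt.symm⟩
    | ld t a v => exact ⟨g, h'.keep_ld hgt, hg, by simp [Trace.append, Trace.next],
        Prod.ext rfl hgt.symm⟩
    | st t a v => exact (hb ⟨t, a, v, rfl⟩).elim

/-- The last clause matches the nodes of kept actions, computed at intermediate prefixes, under the
final position map. This is needed because `path` in a witness refers to such nodes. -/
theorem TraceErase.foldl {w w' : List (Act D T)} (hw : Erase w w') (h : TraceErase f θ θ')
    (hi : Issued θ w) :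
    ∃ g, TraceErase g (w.foldl Trace.append θ) (w'.foldl Trace.append θ') ∧
      (∀ t k, k < (θ'.events t).length → g t k = f t k) ∧
      ∀ α' b β', w' = α' ++ b :: β' → ∃ α β, w = α ++ b :: β ∧ Erase α α' ∧
        ((α'.foldl Trace.append θ').next b).2 < ((w'.foldl Trace.append θ').events
          ((α'.foldl Trace.append θ').next b).1).length ∧
        (α.foldl Trace.append θ).next b = nodeMap g ((α'.foldl Trace.append θ').next b) := by
  induction hw generalizing θ θ' f with
  | nil => exact ⟨f, h, fun _ _ _ => rfl, fun α' b β' he => by simp at he⟩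
  | keep b w w' hw ih =>
    obtain ⟨g, h₁, h₂, h₃, h₄⟩ := h.keep b fun t a v hb => by
      subst hb
      exact hi [] t a v w rfl
    obtain ⟨g', h₅, h₆, h₇⟩ := ih h₁ hi.tail
    refine ⟨g', h₅, fun t k hk => ?_, ?_⟩
    · rw [h₆ t k (hk.trans_le (θ'.length_append_le b t)), h₂ t k hk]
    · intro α' c β' he
      rcases α' with _ | ⟨c', α'⟩
      · obtain ⟨rfl, rfl⟩ : b = c ∧ w' = β' := by simpa using he
        refine ⟨[], w, rfl, .nil, h₃.trans_le (Trace.length_foldl_le _ _ _), ?_⟩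
        simp only [List.foldl_nil]
        rw [h₄]
        simp only [nodeMap]
        rw [h₆ _ _ h₃]
      · obtain ⟨rfl, he'⟩ : b = c' ∧ w' = α' ++ c :: β' := by simpa using he
        obtain ⟨α, β, rfl, h₈, h₉, h₁₀⟩ := h₇ α' c β' he'
        exact ⟨b :: α, β, rfl, .keep _ _ _ h₈, h₉, h₁₀⟩
  | skip t w w' hw ih =>
    obtain ⟨g', h₅, h₆, h₇⟩ := ih (h.skip_loc t) hi.tail
    refine ⟨g', h₅, h₆, ?_⟩
    intro α' c β' he
    obtain ⟨α, β, rfl, h₈, h₉, h₁₀⟩ := h₇ α' c β' he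
    exact ⟨.loc t :: α, β, rfl, .skip _ _ _ h₈, h₉, h₁₀⟩

theorem traceErase_empty : TraceErase (fun _ k => k) (Trace.empty D T) (Trace.empty D T) := by
  constructor <;> simp [Trace.empty]

end
end TSO

/-! ### Removing fences preserves feasible attacks -/

namespace TSO
section Simulation
variable {D R L L' T : Type*} [Zero D] [DecidableEq D] [DecidableEq R] [DecidableEq T]

/-- The open issues of the trace count the buffer entries; hence every store action of a run finds
an open issue, as `Run.issued` states. -/
theorem Step.pending {P : Program D R L T} {s s' : State D R L T} {b : Act D T}
    (h : Step P s b s') {θ : Trace D T}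
    (hθ : ∀ t, (θ.events t).countP Act.isIssue = (s.buf t).length) (t : T) :
    ((θ.append b).events t).countP Act.isIssue = (s'.buf t).length := by
  cases h with
  | instr u i s b s' hs =>
    cases hs <;> by_cases htu : t = u <;>
      first
      | (subst htu; simp [Trace.append, hθ, List.countP_append, Act.isIssue])
      | simp [Trace.append, hθ, htu]
  | flush _ u a v β hb =>
    by_cases htu : t = u
    · subst htu
      have hc := hθ t
      rw [hb] at hc
      have hlt : (θ.events t).findIdx Act.isIssue < (θ.events t).length := by
        refine List.findIdx_lt_length_of_exists ?_
        exact List.countP_pos_iff.1 (by rw [hc]; simp)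
      simp only [Trace.append, Trace.next, Function.update_self]
      rw [List.countP_set hlt, hc, if_pos List.findIdx_getElem]
      simp [Act.isIssue]
    · simp [Trace.append, hθ, htu]

theorem Run.issued {P : Program D R L T} {s s' : State D R L T} {w : List (Act D T)}
    (h : Run P s w s') {θ : Trace D T}
    (hθ : ∀ t, (θ.events t).countP Act.isIssue = (s.buf t).length) : Issued θ w := by
  induction h generalizing θ with
  | nil s => intro α t a v β he; simp at he
  | cons s s₁ s' b w hs _ ih =>
    intro α t a v β he
    rcases α with _ | ⟨c, α⟩
    · obtain ⟨rfl, rfl⟩ : b = .st t a v ∧ w = β := by simpa using he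
      refine List.countP_pos_iff.1 ?_
      rw [List.foldl_nil, hθ]
      cases hs with
      | instr u i s b s' hs => cases hs
      | flush _ _ _ _ β hb => simp [hb]
    · obtain ⟨rfl, he'⟩ : b = c ∧ w = α ++ .st t a v :: β := by simpa using he
      exact ih (hs.pending hθ) α t a v β he'

def LInstr.relabel (f : L' → L) (i : LInstr D R L') : LInstr D R L := ⟨f i.src, i.instr, f i.dst⟩

def State.relabel (f : L' → L) (s : State D R L' T) : State D R L T :=
  ⟨f ∘ s.pc, s.mem, s.reg, s.buf⟩

def Attack.relabel (f : L' → L) (A : Attack D R L' T) : Attack D R L T :=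
  ⟨A.attacker, A.store.relabel f, A.load.relabel f⟩

/-- Up to the relabelling `f`, the program `P'` results from `P` by inserting fences. -/
structure Program.Sim (P' : Program D R L' T) (P : Program D R L T) (f : L' → L) : Prop where
  entry : ∀ t, f (P'.thread t).entry = (P.thread t).entry
  code : ∀ t, ∀ i ∈ (P'.thread t).code,
    i.relabel f ∈ (P.thread t).code ∨ (i.instr = .mfence ∧ f i.src = f i.dst)

variable {P' : Program D R L' T} {P : Program D R L T} {f : L' → L}

theorem InstrStep.relabel {t : T} {i : LInstr D R L'} {s s' : State D R L' T} {b : Act D T}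
    (h : InstrStep P' t i s b s') (hi : i.relabel f ∈ (P.thread t).code) :
    InstrStep P t (i.relabel f) (s.relabel f) b (s'.relabel f) := by
  rw [instrStep_iff] at h ⊢
  obtain ⟨e, ρ, -, h₁, h₂, h₃, h₄, rfl⟩ := h
  refine ⟨e, ρ, hi, congrArg f h₁, h₂, ?_, h₄, ?_⟩
  · cases e <;> exact h₃
  · cases e <;> simp [State.relabel, State.exec, LInstr.relabel, Function.comp_update]

theorem Program.Sim.step (hS : P'.Sim P f) {s s' : State D R L' T} {b : Act D T}
    (h : Step P' s b s') : Step P (s.relabel f) b (s'.relabel f) ∨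
      ∃ t, b = .loc t ∧ s'.relabel f = s.relabel f := by
  cases h with
  | instr t i s b s' hs =>
    rcases hS.code t i hs.mem_code with hi | ⟨hi, hl⟩
    · exact .inl (.instr t _ _ _ _ (hs.relabel hi))
    · refine .inr ?_
      cases hs with
      | mfence _ hsrc _ hb =>
        refine ⟨t, rfl, ?_⟩
        rw [← hsrc] at hl
        simp [State.relabel, Function.comp_update, ← hl]
      | _ => simp_all
  | flush s t a v β hb => exact .inl (.flush (s.relabel f) t a v β hb)

theorem Program.Sim.run (hS : P'.Sim P f) {s s' : State D R L' T} {w : List (Act D T)}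
    (h : Run P' s w s') : ∃ w', Erase w w' ∧ Run P (s.relabel f) w' (s'.relabel f) := by
  induction h with
  | nil s => exact ⟨[], .nil, .nil _⟩
  | cons s s₁ s' b w hs _ ih =>
    obtain ⟨w', h₁, h₂⟩ := ih
    rcases hS.step hs with h | ⟨t, rfl, h⟩
    · exact ⟨b :: w', .keep _ _ _ h₁, .cons _ _ _ _ _ h h₂⟩
    · exact ⟨w', .skip _ _ _ h₁, h ▸ h₂⟩

theorem Program.Sim.initState (hS : P'.Sim P f) : P'.initState.relabel f = P.initState := by
  simp only [State.relabel, Program.initState, State.mk.injEq, and_true]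
  exact funext hS.entry

/-- Erasing local actions changes no counts of issues and stores, so the matching of issues with
stores is unaffected. -/
theorem Erase.issueStorePair {τ τ' : List (Act D T)} (h : Erase τ τ') {t : T}
    {α' β' γ' : List (Act D T)} {a d : D} (hp : IssueStorePair τ' t α' β' γ' a d) :
    ∃ α β γ, IssueStorePair τ t α β γ a d ∧ Erase α α' ∧ Erase β β' := by
  obtain ⟨rfl, hc⟩ := hp
  obtain ⟨α, u, rfl, h₁, h₂⟩ := h.split_cons_right
  obtain ⟨β, γ, rfl, h₃, -⟩ := h₂.split_cons_right
  refine ⟨α, β, γ, ⟨rfl, ?_⟩, h₁, h₃⟩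
  rw [← h₁.issueCount_eq, ← (h₁.append h₃).storeCount_eq, hc]

/-- Erasing the actions of the extra fences keeps `isu`, `ld` and `st`, and shrinks the words in
between to subsequences. Most conditions are inherited by subsequences; `path` needs the comparison
of the two traces. -/
theorem Program.Sim.isWitness (hS : P'.Sim P f) {A : Attack D R L' T}
    (hst : A.store.relabel f ∈ (P.thread A.attacker).code)
    (hld : A.load.relabel f ∈ (P.thread A.attacker).code)
    {τ₁ τ₂ τ₃ τ₄ τ : List (Act D T)} {x v y w : D} (h : P'.IsWitness A τ₁ τ₂ τ₃ τ₄ x v y w τ) :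
    ∃ τ₁' τ₂' τ₃' τ₄' τ', P.IsWitness (A.relabel f) τ₁' τ₂' τ₃' τ₄' x v y w τ' := by
  obtain ⟨rfl, ⟨s₁, s₂, s₃, s₄, s₅, r₁, i₁, r₂, i₂, r₃, hbuf⟩, helpers, pair, first, last, path, tail,
    noEarlyRead⟩ := h
  obtain ⟨τ₁', e₁, r₁'⟩ := hS.run r₁
  obtain ⟨τ₂', e₂, r₂'⟩ := hS.run r₂
  obtain ⟨u, e, r₃'⟩ := hS.run r₃
  obtain ⟨τ₃', u, rfl, e₃, e⟩ := e.split_left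
  obtain ⟨τ₄', rfl, e₄⟩ := e.cons_left (by simp)
  rw [hS.initState] at r₁'
  set t := A.attacker with ht
  have ew : Erase (τ₁ ++ .isu t :: (τ₂ ++ .ld t x v :: (τ₃ ++ .st t y w :: τ₄)))
      (τ₁' ++ .isu t :: (τ₂' ++ .ld t x v :: (τ₃' ++ .st t y w :: τ₄'))) :=
    e₁.append (.keep _ _ _ (e₂.append (.keep _ _ _ (e₃.append (.keep _ _ _ e₄)))))
  have hiss : Issued (Trace.empty D T)
      (τ₁ ++ .isu t :: (τ₂ ++ .ld t x v :: (τ₃ ++ .st t y w :: τ₄))) := by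
    refine Run.issued (r₁.append (.cons _ _ _ _ _ (.instr _ _ _ _ _ i₁)
      (r₂.append (.cons _ _ _ _ _ (.instr _ _ _ _ _ i₂) r₃)))) ?_
    simp [Trace.empty, Program.initState]
  refine ⟨τ₁', τ₂', τ₃', τ₄', _, rfl, ⟨_, _, _, _, _, r₁', i₁.relabel hst, r₂', i₂.relabel hld, r₃',
    hbuf⟩, ?_, ?_, ?_, ?_, ?_, ?_, ?_⟩
  · intro u hu α β γ a d hp
    obtain ⟨α₀, β₀, γ₀, hp', -, eβ⟩ := ew.issueStorePair hp
    exact fun b hb => helpers u hu α₀ β₀ γ₀ a d hp' b (eβ.sublist.subset hb)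
  · refine ⟨by simp [Attack.relabel], ?_⟩
    have e' : Erase (τ₁ ++ (τ₂ ++ .ld t x v :: τ₃)) (τ₁' ++ (τ₂' ++ .ld t x v :: τ₃')) :=
      e₁.append (e₂.append (.keep _ _ _ e₃))
    exact (e₁.issueCount_eq t).trans (pair.2.trans (e'.storeCount_eq t).symm)
  · intro α β γ a d hp hlen
    obtain ⟨α₀, β₀, γ₀, hp', eα, eβ⟩ := ew.issueStorePair hp
    refine fun b hb => first α₀ β₀ γ₀ a d hp' ?_ b (eβ.sublist.subset hb)
    have hpre' : α ++ [.isu t] <+: τ₁' :=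
      List.prefix_of_prefix_length_le ⟨β ++ .st t a d :: γ, rfl⟩
        ⟨_, hp.1.trans (List.append_cons _ _ _)⟩ (by simpa using hlen)
    -- The issue of the pair lies in `τ₁'`. If the corresponding one did not lie in `τ₁`, at least
    -- as many issues would precede it as `τ₁'` contains in total.
    by_contra hc
    have hpre : τ₁ <+: α₀ :=
      List.prefix_of_prefix_length_le (List.prefix_append _ _) ⟨_, hp'.1.symm⟩ (not_lt.1 hc)
    have h₁ : issueCount t (α ++ [.isu t]) ≤ issueCount t τ₁' := hpre'.sublist.countP_le
    have h₂ : issueCount t τ₁ ≤ issueCount t α₀ := hpre.sublist.countP_le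
    rw [e₁.issueCount_eq] at h₁
    rw [← eα.issueCount_eq] at h₂
    have h₃ : issueCount t (α ++ [.isu t]) = issueCount t α + 1 := by
      simp [issueCount, Act.isIssue, Act.thread]
    omega
  · exact fun b hb => last b (e₃.sublist.subset hb)
  · intro α b γ he
    have hw : τ₁ ++ .isu t :: (τ₂ ++ .ld t x v :: (τ₃ ++ .st t y w :: τ₄)) =
        (τ₁ ++ .isu t :: τ₂) ++ ((.ld t x v :: (τ₃ ++ [.st t y w])) ++ τ₄) := by simp
    have hw' : τ₁' ++ .isu t :: (τ₂' ++ .ld t x v :: (τ₃' ++ .st t y w :: τ₄')) =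
        (τ₁' ++ .isu t :: τ₂') ++ ((.ld t x v :: (τ₃' ++ [.st t y w])) ++ τ₄') := by simp
    rw [hw] at hiss
    -- The position map is extended in three stages: up to `τ₂`, through `st`, and through `τ₄`. The
    -- middle stage locates `ld` and `b`, and the last one leaves their positions unchanged.
    obtain ⟨g₁, h₁, -, -⟩ := traceErase_empty.foldl (e₁.append (.keep (.isu t) _ _ e₂)) hiss.left
    have em : Erase (.ld t x v :: (τ₃ ++ [.st t y w])) (.ld t x v :: (τ₃' ++ [.st t y w])) :=
      .keep _ _ _ (e₃.append (.keep _ _ _ .nil))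
    obtain ⟨g₂, h₂, -, h₃⟩ := h₁.foldl em hiss.right.left
    obtain ⟨g₃, h₄, h₅, -⟩ := h₂.foldl e₄ hiss.right.right
    obtain ⟨α₀, γ₀, he₀, -, h₆, h₇⟩ := h₃ α b γ he
    obtain ⟨α₁, γ₁, he₁, hα₁, h₈, h₉⟩ := h₃ [] (.ld t x v) (τ₃' ++ [.st t y w]) rfl
    -- The word `α₁` is erased completely, but would begin with `ld` if it were non-empty.
    obtain rfl : α₁ = [] := by
      rcases α₁ with _ | ⟨c, α₁⟩
      · rfl
      · obtain ⟨rfl, -⟩ : Act.ld t x v = c ∧ _ := by simpa using he₁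
        obtain ⟨_, hn, -⟩ := hα₁.cons_left (by simp)
        simp at hn
    have hp := path α₀ b γ₀ he₀
    have hm : ∀ n : T × ℕ, n.2 < (((Act.ld t x v :: (τ₃' ++ [.st t y w])).foldl Trace.append
        ((τ₁' ++ .isu t :: τ₂').foldl Trace.append (Trace.empty D T))).events n.1).length →
        nodeMap g₂ n = nodeMap g₃ n := fun n hn => Prod.ext rfl (h₅ _ _ hn).symm
    rw [hm _ h₆] at h₇
    rw [hm _ h₈] at h₉
    have key := h₄.transGen (h₈.trans_le (Trace.length_foldl_le _ _ _))
      (h₆.trans_le (Trace.length_foldl_le _ _ _)) (m := _) (n := _) (by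
        rw [← h₇, ← h₉]
        rw [hw] at hp
        simp only [traceOf, List.foldl_append, List.foldl_cons, List.foldl_nil] at hp ⊢
        exact hp)
    simp only [traceOf]
    simp only [List.foldl_append, List.foldl_cons, List.foldl_nil] at key ⊢
    exact key
  · exact fun b hb => tail b (e₄.sublist.subset hb)
  · intro a d hb
    exact noEarlyRead a d ((Erase.keep (.st t y w) _ _ e₄).sublist.subset hb)

theorem Program.Sim.feasible (hS : P'.Sim P f) {A : Attack D R L' T} (h : P'.Feasible A) :
    P.Feasible (A.relabel f) := by
  obtain ⟨⟨⟨hst, e₁, e₂, he⟩, hld, r, e, he'⟩, τ₁, τ₂, τ₃, τ₄, x, v, y, w, τ, hw⟩ := h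
  have hst' := (hS.code _ _ hst).resolve_right (by simp [he])
  have hld' := (hS.code _ _ hld).resolve_right (by simp [he'])
  obtain ⟨τ₁', τ₂', τ₃', τ₄', τ', hw'⟩ := hS.isWitness hst' hld' hw
  exact ⟨⟨⟨hst', e₁, e₂, he⟩, hld', r, e, he'⟩, τ₁', τ₂', τ₃', τ₄', x, v, y, w, τ', hw'⟩

end Simulation
end TSO

/-! ### Fence insertion and eliminating sets -/

namespace TSO
section Fence
variable {D R L T : Type*} [Zero D] [DecidableEq D] [DecidableEq R] [DecidableEq L] [DecidableEq T]
variable {P : Program D R L T} {A : Attack D R L T} {F F' : Finset L}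

theorem Program.mem_code_fence {t : T} {i : LInstr D R (L ⊕ L)} :
    i ∈ ((P.fence F).thread t).code ↔ (∃ j ∈ (P.thread t).code, j.fence F = i) ∨
      ∃ l ∈ F ∩ (P.thread t).labels, ⟨.inl l, .mfence, .inr l⟩ = i := by
  simp [Program.fence, Thread.fence]

theorem LInstr.relabel_fence (i : LInstr D R L) (F : Finset L) :
    (i.fence F).relabel (Sum.elim id id) = i := by
  simp only [LInstr.relabel, LInstr.fence]
  split_ifs <;> rfl

theorem Attack.relabel_fence (A : Attack D R L T) (F : Finset L) :
    (A.fence F).relabel (Sum.elim id id) = A := by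
  simp [Attack.relabel, Attack.fence, LInstr.relabel_fence]

theorem Program.sim_fence (P : Program D R L T) (F : Finset L) :
    (P.fence F).Sim P (Sum.elim id id) where
  entry _ := rfl
  code t i hi := by
    rcases Program.mem_code_fence.1 hi with ⟨j, hj, rfl⟩ | ⟨l, -, rfl⟩
    · exact .inl (by rwa [LInstr.relabel_fence])
    · exact .inr ⟨rfl, rfl⟩

/-- The labels of the program with fences at more than `F`, as labels of the program with fences
at `F`. -/
def fenceMap (F : Finset L) : L ⊕ L → L ⊕ L :=
  Sum.elim .inl fun l => if l ∈ F then .inr l else .inl l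

theorem LInstr.relabel_fenceMap (i : LInstr D R L) (hF : F ⊆ F') :
    (i.fence F').relabel (fenceMap F) = i.fence F := by
  simp only [LInstr.relabel, LInstr.fence, fenceMap]
  by_cases h : i.src ∈ F
  · simp [h, hF h]
  · by_cases h' : i.src ∈ F' <;> simp [h, h']

theorem Attack.relabel_fenceMap (A : Attack D R L T) (hF : F ⊆ F') :
    (A.fence F').relabel (fenceMap F) = A.fence F := by
  simp [Attack.relabel, Attack.fence, LInstr.relabel_fenceMap, hF]

theorem Program.sim_fence_of_subset (P : Program D R L T) (hF : F ⊆ F') :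
    (P.fence F').Sim (P.fence F) (fenceMap F) where
  entry _ := rfl
  code t i hi := by
    rcases Program.mem_code_fence.1 hi with ⟨j, hj, rfl⟩ | ⟨l, hl, rfl⟩
    · exact .inl (Program.mem_code_fence.2 (.inl ⟨j, hj, (j.relabel_fenceMap hF).symm⟩))
    · by_cases h : l ∈ F
      · refine .inl (Program.mem_code_fence.2 (.inr ⟨l, ?_, ?_⟩))
        · exact Finset.mem_inter.2 ⟨h, (Finset.mem_inter.1 hl).2⟩
        · simp [LInstr.relabel, fenceMap, h]
      · exact .inr ⟨rfl, by simp [fenceMap, h]⟩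

theorem Program.Feasible.of_fence (h : (P.fence F).Feasible (A.fence F)) : P.Feasible A :=
  A.relabel_fence F ▸ (P.sim_fence F).feasible h

/-- The added instructions are fences, so the store and the load of an attack stem from instructions
of `P`. -/
theorem Program.Feasible.exists_fence {B : Attack D R (L ⊕ L) T} (h : (P.fence F).Feasible B) :
    ∃ A : Attack D R L T, B = A.fence F := by
  obtain ⟨⟨⟨hst, e₁, e₂, he⟩, hld, r, e, he'⟩, -⟩ := h
  rcases Program.mem_code_fence.1 hst with ⟨j, -, hj⟩ | ⟨l, -, hl⟩
  · rcases Program.mem_code_fence.1 hld with ⟨k, -, hk⟩ | ⟨l, -, hl⟩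
    · refine ⟨⟨B.attacker, j, k⟩, ?_⟩
      simp only [Attack.fence, hj, hk]
    · simp [← hl] at he'
  · simp [← hl] at he

variable [Fintype T]

/-- The program with fences at `F'` simulates the one with fences at `F`, so an attack feasible in
the former is feasible in the latter. -/
theorem Program.IsEliminating.mono (h : P.IsEliminating A F) (hF : F ⊆ F') (hF' : F' ⊆ P.labels) :
    P.IsEliminating A F' :=
  ⟨hF', fun hA => h.2 (A.relabel_fenceMap hF ▸ (P.sim_fence_of_subset hF).feasible hA)⟩

theorem Program.isValidFenceSet_iff :
    P.IsValidFenceSet F ↔ F ⊆ P.labels ∧ ∀ A, P.Feasible A → P.IsEliminating A F := by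
  rw [Program.IsValidFenceSet, robust_iff]
  refine and_congr_right fun hF => ⟨fun h A _ => ⟨hF, h _⟩, fun h B hB => ?_⟩
  obtain ⟨A, rfl⟩ := hB.exists_fence
  exact (h A hB.of_fence).2 hB

theorem Program.instr_eq_mfence {t : T} {i : LInstr D R (L ⊕ L)} {l : L}
    (hi : i ∈ ((P.fence P.labels).thread t).code) (hl : i.src = .inl l) : i.instr = .mfence := by
  rcases Program.mem_code_fence.1 hi with ⟨j, hj, rfl⟩ | ⟨l, -, rfl⟩
  · have : j.src ∈ P.labels := by
      simp only [Program.labels, Finset.mem_biUnion, Finset.mem_univ, true_and]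
      refine ⟨t, ?_⟩
      simp only [Thread.labels, Finset.mem_insert, Finset.mem_union, List.mem_toFinset,
        List.mem_map]
      exact .inr (.inl ⟨j, hj, rfl⟩)
    simp [LInstr.fence, this] at hl
  · rfl

/-- With fences at all labels, a thread with a pending store is stuck behind the next fence. -/
theorem Run.pc_eq_of_pending {s s' : State D R (L ⊕ L) T} {w : List (Act D T)}
    (h : Run (P.fence P.labels) s w s') {t : T} {l : L} (hl : s.pc t = .inl l)
    (hw : storeCount t w < (s.buf t).length) : s'.pc t = .inl l := by
  induction h with
  | nil => exact hl
  | cons s s₁ s' b w hs _ ih =>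
    cases hs with
    | instr u i s b s₁ hs =>
      by_cases hu : t = u
      · subst hu
        exfalso
        obtain ⟨e, ρ, hi, hsrc, heff, hen, -, -⟩ := instrStep_iff.1 hs
        have hm := Program.instr_eq_mfence hi (hsrc.symm.trans hl)
        have hb : s.buf t = [] := by
          cases hs <;> simp_all
        simp [hb] at hw
      · have h₁ : s₁.pc t = s.pc t := by cases hs <;> simp [hu]
        have h₂ : s₁.buf t = s.buf t := by cases hs <;> simp [hu]
        refine ih (h₁.trans hl) ?_
        rw [h₂]
        refine lt_of_le_of_lt ?_ hw
        exact (List.sublist_cons_self b w).countP_le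
    | flush _ u a v β hb =>
      refine ih hl ?_
      by_cases hu : t = u
      · subst hu
        simp only [hb, List.length_cons, storeCount, List.countP_cons, Function.update_self] at hw ⊢
        simp [Act.isStore, Act.thread] at hw
        exact hw
      · simp only [Function.update_of_ne hu]
        refine lt_of_le_of_lt ?_ hw
        exact (List.sublist_cons_self _ w).countP_le

/-- After issuing the store, the attacker stands at an old label, where only a fence can be
executed. It stays there until `st` has left the buffer, so it cannot execute the load first. -/
theorem Program.isEliminating_labels (P : Program D R L T) (A : Attack D R L T) :
    P.IsEliminating A P.labels := by
  refine ⟨subset_rfl, ?_⟩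
  rintro ⟨-, τ₁, τ₂, τ₃, τ₄, x, v, y, w, τ, hw⟩
  obtain ⟨s₁, s₂, s₃, s₄, s₅, r₁, i₁, r₂, i₂, -, -⟩ := hw.run
  have hcount := hw.pair.2
  obtain ⟨G, -, hG⟩ := r₁.exists_rep
  have hcnt := hG.cnt (A.fence P.labels).attacker
  simp only [storeCount_append] at hcount
  have hbuf : (s₂.buf (A.fence P.labels).attacker).length =
      (s₁.buf (A.fence P.labels).attacker).length + 1 := by
    cases i₁ with
    | store => simp
  have hpc : s₂.pc (A.fence P.labels).attacker = .inl A.store.dst := by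
    cases i₁ with
    | store => simp [Attack.fence, LInstr.fence]
  -- By the counts in `pair`, `τ₂` contains at most as many stores as were buffered before the
  -- issue.
  have hpc' := r₂.pc_eq_of_pending hpc (by omega)
  obtain ⟨r, e, he⟩ := i₂.exists_load
  have hsrc : (A.fence P.labels).load.src = .inl A.store.dst := by
    rw [← hpc']
    cases i₂ <;> exact Eq.symm (by assumption)
  rw [Program.instr_eq_mfence i₂.mem_code hsrc] at he
  simp at he

end Fence
end TSO

/-! ### Correctness of the integer linear program -/

namespace TSO
section ILP
variable {D R L T : Type*} [Zero D] [DecidableEq D] [DecidableEq R] [DecidableEq L] [DecidableEq T]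
  [Fintype T]
variable {P : Program D R L T} {A : Attack D R L T} {F G : Finset L} {c : L → ℝ} {x : P.ILPVar → ℤ}

theorem Program.IsEliminating.exists_irreducible (h : P.IsEliminating A F) :
    ∃ G ⊆ F, P.IsIrreducibleEliminating A G := by
  induction F using Finset.strongInduction with
  | H F ih =>
    by_cases hF : ∃ F' ⊂ F, P.IsEliminating A F'
    · obtain ⟨F', hF', h'⟩ := hF
      obtain ⟨G, hG, hG'⟩ := ih F' hF' h'
      exact ⟨G, hG.trans hF'.subset, hG'⟩
    · push Not at hF
      exact ⟨F, subset_rfl, h, hF⟩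

theorem Program.mem_attackFenceSets (hA : P.Feasible A) (hG : P.IsIrreducibleEliminating A G) :
    G ∈ P.attackFenceSets := by
  simp only [Program.attackFenceSets, Finset.mem_filter, Finset.mem_powerset]
  exact ⟨hG.1.1, A, hA, hG⟩

theorem Program.subset_of_mem_attackFenceSets (hG : G ∈ P.attackFenceSets) : G ⊆ P.labels := by
  simp only [Program.attackFenceSets, Finset.mem_filter, Finset.mem_powerset] at hG
  exact hG.1

theorem card_filter_coe_mem {s G : Finset L} (hG : G ⊆ s)
    [DecidablePred fun l : {l // l ∈ s} => l.1 ∈ G] :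
    (Finset.univ.filter fun l : {l // l ∈ s} => l.1 ∈ G).card = G.card := by
  refine Finset.card_bij (fun l _ => l.1) (fun l hl => (Finset.mem_filter.1 hl).2)
    (fun l _ l' _ h => Subtype.ext h) fun l hl => ?_
  exact ⟨⟨l, hG hl⟩, by simpa using hl, rfl⟩

theorem Program.mem_fenceSet {l : L} :
    l ∈ P.fenceSet x ↔ ∃ h : l ∈ P.labels, x (.inl ⟨l, h⟩) = 1 := by
  simp only [Program.fenceSet, Finset.mem_filter, and_iff_right_iff_imp]
  exact fun h => h.1

theorem Program.objective_eq (hx : ∀ n, x n = 0 ∨ x n = 1) :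
    P.objective c x = ∑ l ∈ P.fenceSet x, c l := by
  have hsub : P.fenceSet x ⊆ P.labels := fun l hl => (Program.mem_fenceSet.1 hl).1
  rw [← Finset.inter_eq_right.2 hsub, ← Finset.sum_ite_mem, ← Finset.sum_coe_sort,
    Program.objective]
  refine Finset.sum_congr rfl fun l _ => ?_
  rcases hx (.inl l) with h | h
  · rw [if_neg, h]
    · simp
    · rw [Program.mem_fenceSet]
      rintro ⟨h₁, h₂⟩
      have : x (.inl l) = 1 := h₂
      omega
  · rw [if_pos (Program.mem_fenceSet.2 ⟨l.2, h⟩), h]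
    simp

/-- The point of the integer linear program that belongs to a fence set. -/
def Program.ilpPoint (P : Program D R L T) (F : Finset L) : P.ILPVar → ℤ :=
  Sum.elim (fun l => if l.1 ∈ F then 1 else 0) fun G => if G.1 ⊆ F then 1 else 0

theorem Program.ilpPoint_zero_one (P : Program D R L T) (F : Finset L) (n : P.ILPVar) :
    P.ilpPoint F n = 0 ∨ P.ilpPoint F n = 1 := by
  rcases n with l | G <;> simp only [Program.ilpPoint, Sum.elim_inl, Sum.elim_inr] <;> split_ifs <;>
    simp

theorem Program.fenceSet_ilpPoint (hF : F ⊆ P.labels) : P.fenceSet (P.ilpPoint F) = F := by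
  ext l
  simp only [Program.mem_fenceSet, Program.ilpPoint, Sum.elim_inl]
  constructor
  · rintro ⟨_, h⟩
    by_contra hc
    simp [hc] at h
  · exact fun hl => ⟨hF hl, if_pos hl⟩

/-- The point selects every irreducible set contained in `F`; each feasible attack has one, since an
eliminating set can be shrunk to an irreducible one. -/
theorem Program.isILPFeasible_ilpPoint (hF : ∀ A, P.Feasible A → P.IsEliminating A F) :
    P.IsILPFeasible (P.ilpPoint F) where
  zero_one := P.ilpPoint_zero_one F
  select A hA := by
    classical
    obtain ⟨G, hGF, hG⟩ := (hF A hA).exists_irreducible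
    have h₁ : P.ilpPoint F (.inr ⟨G, Program.mem_attackFenceSets hA hG⟩) = 1 := if_pos hGF
    rw [ge_iff_le, ← h₁]
    refine Finset.single_le_sum (f := fun G => P.ilpPoint F (.inr G)) (fun G _ => ?_) ?_
    · rcases P.ilpPoint_zero_one F (.inr G) with h | h <;> simp [h]
    · exact Finset.mem_filter.2 ⟨Finset.mem_univ _, hG⟩
  insertion G := by
    by_cases hG : G.1 ⊆ F
    · have h₁ : P.ilpPoint F (.inr G) = 1 := if_pos hG
      rw [h₁, mul_one, ge_iff_le, ← card_filter_coe_mem (Program.subset_of_mem_attackFenceSets G.2),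
        Finset.sum_congr rfl (g := fun _ => 1)]
      · simp
      · exact fun l hl => if_pos (hG (Finset.mem_filter.1 hl).2)
    · have h₁ : P.ilpPoint F (.inr G) = 0 := if_neg hG
      rw [h₁, mul_zero]
      refine Finset.sum_nonneg fun l _ => ?_
      rcases P.ilpPoint_zero_one F (.inl l) with h | h <;> simp [h]

/-- For each attack some irreducible set `G` has value 1. Its constraint then forces all labels of
`G` into the fence set, which is eliminating by monotonicity. -/
theorem Program.IsILPFeasible.isValidFenceSet (hx : P.IsILPFeasible x) :
    P.IsValidFenceSet (P.fenceSet x) := by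
  have hsub : P.fenceSet x ⊆ P.labels := fun l hl => (Program.mem_fenceSet.1 hl).1
  refine Program.isValidFenceSet_iff.2 ⟨hsub, fun A hA => ?_⟩
  obtain ⟨G, hG, hG₀⟩ : ∃ G : {F // F ∈ P.attackFenceSets},
      P.IsIrreducibleEliminating A G.1 ∧ x (.inr G) ≠ 0 := by
    classical
    obtain ⟨G, hG, hG'⟩ := Finset.exists_ne_zero_of_sum_ne_zero
      (zero_lt_one.trans_le (ge_iff_le.1 (hx.select A hA))).ne'
    exact ⟨G, (Finset.mem_filter.1 hG).2, hG'⟩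
  have hG₁ := (hx.zero_one _).resolve_left hG₀
  have hins := hx.insertion G
  rw [hG₁, mul_one, ← card_filter_coe_mem (Program.subset_of_mem_attackFenceSets G.2)] at hins
  refine hG.1.mono (fun l hl => ?_) hsub
  have hl' := Program.subset_of_mem_attackFenceSets G.2 hl
  refine Program.mem_fenceSet.2 ⟨hl', ?_⟩
  -- The slacks `1 - x l` over the labels of `G` are non-negative and their sum is at most `0`, so
  -- each of them vanishes.
  have hnonneg : ∀ n, 0 ≤ 1 - x n := fun n => by rcases hx.zero_one n with h | h <;> simp [h]
  have hmem : (⟨l, hl'⟩ : {l // l ∈ P.labels}) ∈ Finset.univ.filter fun l => l.1 ∈ G.1 :=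
    Finset.mem_filter.2 ⟨Finset.mem_univ _, hl⟩
  have hsum := Finset.single_le_sum (f := fun l => 1 - x (.inl l)) (fun l _ => hnonneg (.inl l)) hmem
  rw [Finset.sum_sub_distrib, Finset.sum_const, nsmul_one] at hsum
  have h₁ := hnonneg (.inl ⟨l, hl'⟩)
  have h₂ : 1 - x (.inl ⟨l, hl'⟩) ≤ 0 := hsum.trans (by linarith)
  linarith

theorem Program.exists_isILPOptimal (P : Program D R L T) (c : L → ℝ) :
    ∃ x : P.ILPVar → ℤ, P.IsILPOptimal c x := by
  have hfin : {x : P.ILPVar → ℤ | P.IsILPFeasible x}.Finite := by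
    refine (Set.Finite.pi' fun _ => Set.toFinite {0, 1}).subset fun x hx n => ?_
    exact hx.zero_one n
  obtain ⟨x, hx, hmin⟩ := Set.exists_min_image _ (P.objective c) hfin
    ⟨_, P.isILPFeasible_ilpPoint fun A _ => P.isEliminating_labels A⟩
  exact ⟨x, hx, hmin⟩

/-- Every valid fence set competes in the integer program, with its cost as objective. -/
theorem Program.IsILPOptimal.solves (hx : P.IsILPOptimal c x) :
    P.SolvesFenceComputation c (P.fenceSet x) := by
  refine ⟨hx.1.isValidFenceSet, fun F hF => ?_⟩
  obtain ⟨hF, hF'⟩ := Program.isValidFenceSet_iff.1 hF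
  rw [← Program.objective_eq hx.1.zero_one]
  refine (hx.2 _ (P.isILPFeasible_ilpPoint hF')).trans_eq ?_
  rw [Program.objective_eq (P.ilpPoint_zero_one F), Program.fenceSet_ilpPoint hF]

end ILP
end TSO

theorem mainTheorem8 {D R L T : Type*} [Zero D] [DecidableEq D] [DecidableEq R] [DecidableEq L]
    [DecidableEq T] [Fintype T] (P : TSO.Program D R L T) (c : L → ℝ)
    (hc : ∀ l ∈ P.labels, 0 < c l) :
    (∃ x : P.ILPVar → ℤ, P.IsILPOptimal c x) ∧
    ∀ x : P.ILPVar → ℤ, P.IsILPOptimal c x → P.SolvesFenceComputation c (P.fenceSet x) := by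
  exact ⟨P.exists_isILPOptimal c, fun x hx => hx.solves⟩
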